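/- Let $s\in(0,1)$ and $c_s=\frac{4^s s\,\Gamma(s+\frac12)}{\sqrt{\pi}\,\Gamma(1-s)}$. For $\eta\in C_c^\infty(\mathbb R)$ put $$(-\Delta)^s\eta(x)=c_s\,\mathrm{p.v.}\!\int_{\mathbb R}\frac{\eta(x)-\eta(y)}{|x-y|^{1+2s}}\,dy=\frac{c_s}{2}\int_{\mathbb R}\frac{2\eta(x)-\eta(x+h)-\eta(x-h)}{|h|^{1+2s}}\,dh,$$ $$\mathcal N^s_{(0,\infty)}\eta(x)=c_s\int_0^\infty\frac{\eta(x)-\eta(y)}{|x-y|^{1+2s}}\,dy\qquad(x<0).$$ A measurable function $u:\mathbb R\to\mathbb R$ is called a *distributional solution with faster growth* of the one-dimensional Neumann problem $$(-\Delta)^s u\overset{1}{=}0\ \text{ in }(0,\infty),\qquad \mathcal N^s_{(0,\infty)}u\overset{1}{=}0\ \text{ in }(-\infty,0)$$ if $|u(x)|\le C'(1+|x|)^{2s+1-\varepsilon'}$ for all $x\in\mathbb R$, for some $C',\varepsilon'>0$, and $$\int_{-\infty}^0 u\,\mathcal N^s_{(0,\infty)}\eta\,dx+\int_0^\infty u\,(-\Delta)^s\eta\,dx=0$$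 for every $\eta\in C_c^\infty(\mathbb R)$ with $\int_0^\infty\eta\,dx=\int_{-\infty}^0\eta\,dx=0$. Let $f$ be the meromorphic function $$f(\beta)=\frac{\Gamma(\beta+1)\sin(\pi s)}{\Gamma(\beta-2s+1)\sin(\pi(\beta-2s))}\left(\frac{\sin(\pi(\beta-s))}{\sin(\pi s)}+\frac{\Gamma(2s-\beta)\Gamma(\beta+1)}{\Gamma(2s)}\right)$$ and let $B_0=\inf\{\operatorname{Re}\beta:\ f(\beta)=0,\ \operatorname{Re}\beta>0,\ \beta\neq 2s-1\}$. **Theorem.** Let $\delta>0$ and let $u\in C^{\max\{2s-1,0\}+\delta}_{\mathrm{loc}}(\mathbb R)$ be a distributional solution with faster growth of the Neumann problem above, with $u(0)=0$ and $$|u(x)|\le C(1+x)^{B_0-\varepsilon}\qquad\text{for all }x\ge 0,$$ for some $C>0$ and $\varepsilon>0$. Then $u\equiv 0$ on $\mathbb R$. Here, for $a>0$ written as $a=k+\alpha$ with $k\in\mathbb N\cup\{0\}$ and $\alpha\in(0,1]$, $u\in C^a_{\mathrm{loc}}(\mathbb R)$ means that $u$ is $k$ times continuously differentiable and $u^{(k)}$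 is $\alpha$-Hölder continuous on every bounded interval. -/

import Mathlib

open MeasureTheory Set
open scoped ContDiff

noncomputable section

/-- The normalising constant `c_s = 4 ^ s * s * Γ(s + 1/2) / (Γ(1 - s) * √π)` of the fractional
Laplacian on the real line. -/
def fracLapConst (s : ℝ) : ℝ :=
  (4 : ℝ) ^ s * s * Real.Gamma (s + 1 / 2) / (Real.Gamma (1 - s) * Real.sqrt Real.pi)

/-- The fractional Laplacian on the real line, `c_s p.v. ∫ (φ x - φ y) / |x - y| ^ (1 + 2 s) dy`,
in its absolutely convergent form by symmetrised second differences. It is only applied to smooth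
compactly supported `φ`, for which the integral converges and equals the principal value. -/
def fracLaplacian (s : ℝ) (φ : ℝ → ℝ) (x : ℝ) : ℝ :=
  fracLapConst s / 2 * ∫ h : ℝ, (2 * φ x - φ (x + h) - φ (x - h)) / |h| ^ (1 + 2 * s)

/-- The nonlocal normal derivative of the half-line `(0, ∞)`, evaluated at points `x < 0`:
`c_s ∫_0^∞ (φ x - φ y) / |x - y| ^ (1 + 2 s) dy`. -/
def nonlocalNormalDeriv (s : ℝ) (φ : ℝ → ℝ) (x : ℝ) : ℝ :=
  fracLapConst s * ∫ y in Ioi (0 : ℝ), (φ x - φ y) / |x - y| ^ (1 + 2 * s)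

/-- Distributional solutions with faster growth of the Neumann problem
`(-Δ)^s u = 0` in `(0, ∞)`, `N^s u = 0` in `(-∞, 0)`: (measurable) functions of growth of order
less than `2 s + 1` that satisfy the equation against all smooth compactly supported functions
whose integrals over both half-lines vanish. -/
structure IsFasterGrowthNeumannSolution (s : ℝ) (u : ℝ → ℝ) : Prop where
  aestronglyMeasurable : AEStronglyMeasurable u volume
  growth : ∃ C ε : ℝ, 0 < ε ∧ ∀ x : ℝ, |u x| ≤ C * (1 + |x|) ^ (2 * s + 1 - ε)
  weak_eq : ∀ η : ℝ → ℝ, ContDiff ℝ ∞ η → HasCompactSupport η →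
    ∫ x in Ioi (0 : ℝ), η x = 0 → ∫ x in Iio (0 : ℝ), η x = 0 →
    (∫ x in Iio (0 : ℝ), u x * nonlocalNormalDeriv s η x) +
      (∫ x in Ioi (0 : ℝ), u x * fracLaplacian s η x) = 0

/-- The class `C^a_loc(ℝ)` for real `a > 0`: writing `a = k + α` with `k` a natural number and
`0 < α ≤ 1`, the function is `k` times continuously differentiable and its `k`-th derivative is
`α`-Hölder continuous on every bounded interval. -/
def LocallyHolderOfOrder (a : ℝ) (u : ℝ → ℝ) : Prop :=
  ContDiff ℝ (⌈a⌉₊ - 1 : ℕ) u ∧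
    ∀ R : ℝ, 0 < R → ∃ C : ℝ, ∀ x ∈ Icc (-R) R, ∀ y ∈ Icc (-R) R,
      |iteratedDeriv (⌈a⌉₊ - 1) u x - iteratedDeriv (⌈a⌉₊ - 1) u y| ≤
        C * |x - y| ^ (a - ((⌈a⌉₊ - 1 : ℕ) : ℝ))

/-- The meromorphic function `f` attached to the half-line Neumann problem. -/
def neumannSymbol (s : ℝ) (β : ℂ) : ℂ :=
  Complex.Gamma (β + 1) * Complex.sin (Real.pi * s) /
      (Complex.Gamma (β - 2 * s + 1) * Complex.sin (Real.pi * (β - 2 * s))) *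
    (Complex.sin (Real.pi * (β - s)) / Complex.sin (Real.pi * s) +
      Complex.Gamma (2 * s - β) * Complex.Gamma (β + 1) / Complex.Gamma (2 * s))

/-- The exponent `B₀ = inf {Re β : f β = 0, Re β > 0, β ≠ 2 s - 1}`.

In the half-plane `Re β > 0` the sine below vanishes exactly at `β = 2 s - 1` (if `2 s > 1`) and at
`β = 2 s, 2 s + 1, 2 s + 2, …`. The latter are the poles (of order two) of `f` in that half-plane,
where the total function `neumannSymbol` takes a meaningless value; everywhere else in the
half-plane its value is the genuine one. So the condition on the sine removes `2 s - 1` and the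
poles, and nothing else. -/
def neumannExponent (s : ℝ) : ℝ :=
  sInf {b : ℝ | ∃ β : ℂ, neumannSymbol s β = 0 ∧
    Complex.sin (Real.pi * (β - 2 * s)) ≠ 0 ∧ 0 < β.re ∧ β ≠ 2 * s - 1 ∧ b = β.re}

end

/-! Test functions carried by one half-line turn the problem into two equations linking the interior
values v(τ) = u(e^τ) with the exterior values w(τ) = u(-e^τ). All kernels are homogeneous, so in the
logarithmic variable both equations are correlations. For test functions (y^(2s) g(log y))' and
their reflections, the bilateral Laplace transforms of the kernels are multiples of that of g. With
A = `betaFactor`, the first equation has factors -A(β) sin π(β-s) / sin πs on v and A(β) on w; the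
second has (2s-β)/(2s) on w and A(β) on v (`mellin_halfLaplacian`, `mellin_reflPotential`,
`expTransform_exteriorKernel`). Taking a derivative as test function supplies the vanishing mean and
one extra power of decay, so the kernels can be integrated against any growth of order below 2s+1.

Eliminating w (`corr_elimination`, `exists_annihilating_kernel`) leaves one equation for v, with
multiplier H = `halfLineSymbol`. Up to the factor -A(β)(2s-β)/(2s), H is the bracket in f. Hence H
has no zeros with max(2s-1, 0) < Re β < min(B₀, 2s+1)
(`halfLineSymbol_ne_zero_of_re_lt_neumannExponent`).

Regularity and u(0) = 0 give u = O(|x|^a) at the origin with a > max(2s-1, 0), and the growth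
hypotheses give u = O(x^γ) at infinity with γ below 2s+1 and below B₀ (or γ ≤ 0). So there is a
closed zero-free strip a₀ ≤ Re β ≤ a₁ with a₀ < a and γ < a₁ (`exists_zero_free_strip`). On it 1/H
is holomorphic and O(1/(1 + (Im β)²)), so its inverse transform θ is the same from either edge and
is bounded by a multiple of min(e^(-a₀t), e^(-a₁t)). That is exactly the decay needed to pair with
v. Convolving the equation for v with θ removes H and leaves v orthogonal to all g₂ * g₁, so v = 0
(`eq_zero_of_corr_eq_zero`).

Once u vanishes on the positive half-line, the second equation says that u(-t) t^(-2s) is orthogonal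
to all bumps of mean zero, so u(-t) = K t^(2s). The first equation then gives K A(2s) = 0 after
pairing with a suitable g, and A(2s) ≠ 0. -/

open Filter Topology Asymptotics

/-! ### Beta integral and second differences -/

/-- Beta integral on the half-line. -/
theorem mellin_one_add_rpow_neg {c : ℝ} {a : ℂ} (ha : 0 < a.re) (hac : a.re < c) :
    mellin (fun x : ℝ => (((1 + x) ^ (-c) : ℝ) : ℂ)) a =
      Complex.Gamma a * Complex.Gamma (c - a) / Complex.Gamma c := by
  have hcre : 0 < ((c : ℂ) - a).re := by simp; linarith
  have hB := Complex.betaIntegral_eq_Gamma_mul_div a (c - a) ha hcre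
  rw [show a + (c - a) = (c : ℂ) by ring] at hB
  rw [← hB, mellin, Complex.betaIntegral, intervalIntegral.integral_of_le zero_le_one,
    integral_Ioc_eq_integral_Ioo]
  -- The substitution x = t/(1-t), for which 1 + x = 1/(1-t), leads to Euler's Beta integral on (0,
  -- 1).
  have himg : (fun t : ℝ => t / (1 - t)) '' Ioo 0 1 = Ioi 0 := by
    ext x
    simp only [mem_image, mem_Ioo, mem_Ioi]
    constructor
    · rintro ⟨t, ⟨h0, h1⟩, rfl⟩
      exact div_pos h0 (by linarith)
    · intro hx
      refine ⟨x / (1 + x), ⟨by positivity, ?_⟩, ?_⟩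
      · rw [div_lt_one (by linarith)]; linarith
      · have : (1 + x) ≠ 0 := by linarith
        field_simp
        ring
  have hinj : InjOn (fun t : ℝ => t / (1 - t)) (Ioo 0 1) := by
    intro x hx y hy hxy
    simp only at hxy
    have h1 : 1 - x ≠ 0 := by linarith [hx.2]
    have h2 : 1 - y ≠ 0 := by linarith [hy.2]
    rw [div_eq_div_iff h1 h2] at hxy
    linarith
  have hder : ∀ t ∈ Ioo (0 : ℝ) 1,
      HasDerivWithinAt (fun t : ℝ => t / (1 - t)) (1 / (1 - t) ^ 2) (Ioo 0 1) t := by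
    intro t ht
    have h1 : 1 - t ≠ 0 := by linarith [ht.2]
    have := ((hasDerivAt_id t).div ((hasDerivAt_const t (1 : ℝ)).sub (hasDerivAt_id t)) h1)
    refine (this.congr_deriv ?_).hasDerivWithinAt
    simp
  rw [← himg, integral_image_eq_integral_abs_deriv_smul measurableSet_Ioo hder hinj]
  refine setIntegral_congr_fun measurableSet_Ioo ?_
  intro t ht
  have h1 : 0 < 1 - t := by linarith [ht.2]
  have h0 : 0 < t := ht.1
  simp only [smul_eq_mul, Complex.real_smul]
  have e1 : 1 + t / (1 - t) = (1 - t)⁻¹ := by field_simp; ring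
  rw [e1, Real.inv_rpow h1.le, Real.rpow_neg h1.le, inv_inv, abs_of_pos (by positivity)]
  have hne : ((1 - t : ℝ) : ℂ) ≠ 0 := by exact_mod_cast h1.ne'
  have e4 : ((t / (1 - t) : ℝ) : ℂ) ^ (a - 1) =
      (t : ℂ) ^ (a - 1) * ((1 - t : ℝ) : ℂ) ^ (-(a - 1)) := by
    rw [div_eq_mul_inv, Complex.ofReal_mul,
      Complex.mul_cpow_ofReal_nonneg h0.le (by positivity : (0:ℝ) ≤ (1 - t)⁻¹),
      Complex.ofReal_inv, Complex.inv_cpow _ _ (by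
        rw [Complex.arg_ofReal_of_nonneg h1.le]; exact Real.pi_pos.ne), ← Complex.cpow_neg]
  have e2 : ((1 / (1 - t) ^ 2 : ℝ) : ℂ) = ((1 - t : ℝ) : ℂ) ^ (-2 : ℂ) := by
    rw [Complex.cpow_neg, Complex.cpow_ofNat]; push_cast; rw [one_div]
  rw [e2, e4, Complex.ofReal_cpow h1.le]
  have e3 : (1 - (t : ℂ)) = ((1 - t : ℝ) : ℂ) := by push_cast; ring
  rw [e3, show ((c : ℂ) - a - 1) = -2 + (-(a - 1)) + c by ring, Complex.cpow_add _ _ hne,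
    Complex.cpow_add _ _ hne]
  ring

/-- Quantitative bound for second-order differences. -/
theorem abs_second_difference_le {f f' f'' : ℝ → ℝ} {x h K : ℝ} (hh : 0 ≤ h)
    (hf : ∀ y ∈ Icc (x - h) (x + h), HasDerivAt f (f' y) y)
    (hf' : ∀ y ∈ Icc (x - h) (x + h), HasDerivAt f' (f'' y) y)
    (hK : ∀ y ∈ Icc (x - h) (x + h), |f'' y| ≤ K) :
    |2 * f x - f (x + h) - f (x - h)| ≤ 2 * K * h ^ 2 := by
  have hK0 : 0 ≤ K := (abs_nonneg _).trans (hK x ⟨by linarith, by linarith⟩)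
  -- The mean value inequality is used twice: first in the step t, then for f' between x - t and x +
  -- t.
  have h1 : ∀ t ∈ Icc (0 : ℝ) h, HasDerivWithinAt (fun t => 2 * f x - f (x + t) - f (x - t))
      (f' (x - t) - f' (x + t)) (Icc 0 h) t := by
    intro t ht
    have a1 := (hf (x + t) ⟨by linarith [ht.1], by linarith [ht.2]⟩).comp_const_add x t
    have a2 := (hf (x - t) ⟨by linarith [ht.2], by linarith [ht.1]⟩).comp_const_sub x t
    exact (((hasDerivAt_const t (2 * f x)).sub a1).sub a2 |>.congr_deriv
      (by ring)).hasDerivWithinAt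
  have h2 : ∀ t ∈ Ico (0 : ℝ) h, ‖f' (x - t) - f' (x + t)‖ ≤ 2 * K * h := by
    intro t ht
    have := (convex_Icc (x - h) (x + h)).norm_image_sub_le_of_norm_hasDerivWithin_le
      (fun y hy => (hf' y hy).hasDerivWithinAt) (fun y hy => by simpa using hK y hy)
      (x := x + t) (y := x - t) ⟨by linarith [ht.1], by linarith [ht.2]⟩
      ⟨by linarith [ht.2], by linarith [ht.1]⟩
    refine this.trans ?_
    rw [Real.norm_eq_abs, show x - t - (x + t) = -(2 * t) by ring, abs_neg,
      abs_of_nonneg (by linarith [ht.1])]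
    nlinarith [ht.2]
  have := norm_image_sub_le_of_norm_deriv_le_segment' h1 h2 h ⟨hh, le_rfl⟩
  simp only [Real.norm_eq_abs, add_zero, sub_zero] at this
  calc _ = |2 * f x - f (x + h) - f (x - h) - (2 * f x - f x - f x)| := by ring_nf
    _ ≤ _ := this
    _ = _ := by ring

/-! ### Mellin transform of the second difference of a power -/

/-- Symmetric second difference of `x ↦ x₊ ^ b` at `1`. -/
noncomputable def powDiff (b h : ℝ) : ℝ := 2 - (max (1 - h) 0) ^ b - (1 + h) ^ b

theorem continuous_max_rpow {b : ℝ} (hb : 0 < b) :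
    Continuous fun h : ℝ => (max (1 - h) 0) ^ b :=
  ((continuous_const.sub continuous_id).max continuous_const).rpow_const fun _ => Or.inr hb.le

theorem continuousOn_one_add_rpow (b : ℝ) : ContinuousOn (fun h : ℝ => (1 + h) ^ b) (Ioi (-1)) :=
  (continuousOn_const.add continuousOn_id).rpow_const fun x hx => Or.inl (by
    have : -1 < x := hx
    have h2 : (1 : ℝ) + x ≠ 0 := by linarith
    exact h2)

theorem isBigO_one_add_rpow_atTop (b : ℝ) :
    (fun h : ℝ => (1 + h) ^ b) =O[atTop] fun h => h ^ b := by
  have : Tendsto (fun h : ℝ => (1 + h⁻¹) ^ b) atTop (𝓝 ((1 + 0) ^ b)) :=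
    (tendsto_const_nhds.add tendsto_inv_atTop_zero).rpow_const (Or.inl (by norm_num))
  have h2 := (this.isBigO_one ℝ).mul (isBigO_refl (fun h : ℝ => h ^ b) atTop)
  refine (h2.congr' ?_ ?_)
  · filter_upwards [eventually_gt_atTop 0] with h hh
    rw [← Real.mul_rpow (by positivity) hh.le]
    congr 1
    field_simp
    ring
  · simp

theorem isBigO_one_sub_one_add_rpow_zero (b : ℝ) :
    (fun h : ℝ => 1 - (1 + h) ^ b) =O[𝓝[>] 0] fun h => h ^ (1 : ℝ) := by
  have h1 : DifferentiableAt ℝ (fun h : ℝ => 1 - (1 + h) ^ b) 0 := by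
    refine (differentiableAt_const _).sub (DifferentiableAt.rpow_const (by fun_prop) (Or.inl ?_))
    norm_num
  simpa using h1.isBigO_sub.mono nhdsWithin_le_nhds

theorem isBigO_one_sub_max_rpow_zero {b : ℝ} :
    (fun h : ℝ => 1 - (max (1 - h) 0) ^ b) =O[𝓝[>] 0] fun h => h ^ (1 : ℝ) := by
  have h1 : DifferentiableAt ℝ (fun h : ℝ => 1 - (1 - h) ^ b) 0 := by
    refine (differentiableAt_const _).sub (DifferentiableAt.rpow_const (by fun_prop) (Or.inl ?_))
    norm_num
  have h2 := h1.isBigO_sub.mono (nhdsWithin_le_nhds (s := Ioi 0))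
  simp only [sub_zero, Real.one_rpow, sub_self, Real.rpow_one] at h2 ⊢
  refine h2.congr' ?_ EventuallyEq.rfl
  filter_upwards [nhdsWithin_le_nhds (Iio_mem_nhds (zero_lt_one' ℝ))] with h hh
  rw [max_eq_left (by linarith [mem_Iio.mp hh])]

theorem isBigO_one_sub_max_rpow_atTop {b : ℝ} (hb : 0 < b) :
    (fun h : ℝ => 1 - (max (1 - h) 0) ^ b) =O[atTop] fun h => h ^ (-(0 : ℝ)) := by
  simp only [neg_zero, Real.rpow_zero]
  refine (isBigO_refl (fun _ : ℝ => (1 : ℝ)) atTop).congr' ?_ EventuallyEq.rfl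
  filter_upwards [eventually_gt_atTop 1] with h hh
  rw [max_eq_right (by linarith), Real.zero_rpow hb.ne', sub_zero]

theorem isBigO_one_sub_one_add_rpow_atTop {b : ℝ} (hb : 0 < b) :
    (fun h : ℝ => 1 - (1 + h) ^ b) =O[atTop] fun h => h ^ (-(-b)) := by
  rw [neg_neg]
  refine IsBigO.sub ?_ (isBigO_one_add_rpow_atTop b)
  have : Tendsto (fun h : ℝ => h ^ b) atTop atTop := tendsto_rpow_atTop hb
  exact (isLittleO_const_left.2 (Or.inr (tendsto_norm_atTop_atTop.comp this))).isBigO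

theorem powDiff_eq (b h : ℝ) :
    powDiff b h = (1 - (max (1 - h) 0) ^ b) + (1 - (1 + h) ^ b) := by
  unfold powDiff; ring

theorem isBigO_powDiff_atTop {b : ℝ} (hb : 0 < b) :
    powDiff b =O[atTop] fun h => h ^ (-(-b)) := by
  have : powDiff b = fun h => (1 - (max (1 - h) 0) ^ b) + (1 - (1 + h) ^ b) := by
    funext h; exact powDiff_eq b h
  rw [this]
  refine IsBigO.add ((isBigO_one_sub_max_rpow_atTop hb).trans ?_)
    (isBigO_one_sub_one_add_rpow_atTop hb)
  rw [neg_neg]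
  simp only [neg_zero, Real.rpow_zero]
  exact (isLittleO_const_left.2 (Or.inr (tendsto_norm_atTop_atTop.comp
    (tendsto_rpow_atTop hb)))).isBigO

theorem isBigO_powDiff_zero (b : ℝ) :
    powDiff b =O[𝓝[>] 0] fun h => h ^ (-(-2 : ℝ)) := by
  have hc : ContinuousOn (fun y : ℝ => b * ((b - 1) * y ^ (b - 1 - 1))) (Icc (1 / 2) (3 / 2)) :=
    continuousOn_const.mul (continuousOn_const.mul (continuousOn_id.rpow_const fun x hx =>
      Or.inl (by simp only [id]; linarith [hx.1])))
  obtain ⟨K, hK⟩ := isCompact_Icc.exists_bound_of_continuousOn hc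
  refine IsBigO.of_bound (2 * K) ?_
  filter_upwards [self_mem_nhdsWithin,
    nhdsWithin_le_nhds (Iio_mem_nhds (show (0 : ℝ) < 1 / 2 by norm_num))] with h h0 h1
  have h0 : 0 < h := h0
  have h1 : h < 1 / 2 := h1
  have key := abs_second_difference_le (f := fun y => y ^ b) (f' := fun y => b * y ^ (b - 1))
    (f'' := fun y => b * ((b - 1) * y ^ (b - 1 - 1))) (x := 1) (h := h) (K := K) h0.le
    (fun y hy => Real.hasDerivAt_rpow_const (Or.inl (by linarith [hy.1])))
    (fun y hy => (Real.hasDerivAt_rpow_const (Or.inl (by linarith [hy.1]))).const_mul _)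
    (fun y hy => hK y ⟨by linarith [hy.1], by linarith [hy.2]⟩)
  rw [neg_neg, Real.rpow_two, Real.norm_eq_abs, Real.norm_eq_abs, abs_of_nonneg (sq_nonneg h),
    powDiff, max_eq_left (by linarith)]
  simp only [Real.one_rpow, mul_one] at key
  rwa [show 2 - (1 - h) ^ b - (1 + h) ^ b = 2 - (1 + h) ^ b - (1 - h) ^ b by ring]

theorem continuousOn_powDiff {b : ℝ} (hb : 0 < b) : ContinuousOn (powDiff b) (Ioi 0) :=
  (continuousOn_const.sub (continuous_max_rpow hb).continuousOn).sub
    ((continuousOn_one_add_rpow b).mono fun x hx => by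
      simp only [mem_Ioi] at hx ⊢; linarith)

theorem ContinuousOn.locallyIntegrableOn_ofReal {f : ℝ → ℝ} (h : ContinuousOn f (Ioi 0)) :
    LocallyIntegrableOn (fun x => ((f x : ℝ) : ℂ)) (Ioi 0) :=
  ContinuousOn.locallyIntegrableOn (Complex.continuous_ofReal.comp_continuousOn h)
    measurableSet_Ioi

theorem continuousOn_one_sub_max {b : ℝ} (hb : 0 < b) :
    ContinuousOn (fun h : ℝ => 1 - (max (1 - h) 0) ^ b) (Ioi 0) :=
  (continuous_const.sub (continuous_max_rpow hb)).continuousOn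

theorem continuousOn_one_sub_one_add (b : ℝ) :
    ContinuousOn (fun h : ℝ => 1 - (1 + h) ^ b) (Ioi 0) :=
  continuousOn_const.sub ((continuousOn_one_add_rpow b).mono fun x hx => by
      simp only [mem_Ioi] at hx ⊢; linarith)

theorem mellinConvergent_one_sub_max {b : ℝ} (hb : 0 < b) {z : ℂ} (hz1 : -1 < z.re)
    (hz0 : z.re < 0) :
    MellinConvergent (fun h : ℝ => ((1 - (max (1 - h) 0) ^ b : ℝ) : ℂ)) z :=
  mellinConvergent_of_isBigO_rpow (continuousOn_one_sub_max hb).locallyIntegrableOn_ofReal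
    (Complex.isBigO_ofReal_left.2 (isBigO_one_sub_max_rpow_atTop hb)) hz0
    (by simpa using Complex.isBigO_ofReal_left.2 (isBigO_one_sub_max_rpow_zero (b := b))) hz1

theorem mellinConvergent_one_sub_one_add {b : ℝ} (hb : 0 < b) {z : ℂ} (hz1 : -1 < z.re)
    (hz0 : z.re < -b) :
    MellinConvergent (fun h : ℝ => ((1 - (1 + h) ^ b : ℝ) : ℂ)) z :=
  mellinConvergent_of_isBigO_rpow (continuousOn_one_sub_one_add b).locallyIntegrableOn_ofReal
    (Complex.isBigO_ofReal_left.2 (isBigO_one_sub_one_add_rpow_atTop hb)) hz0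
    (by simpa using Complex.isBigO_ofReal_left.2 (isBigO_one_sub_one_add_rpow_zero b)) hz1

/-- Integration by parts with primitive h^z (1 - (1-h)^b). The boundary term at 0 vanishes because
Re z > -1, and the one at 1 is the summand 1. -/
theorem setIntegral_Ioo_cpow_mul_one_sub_rpow {b : ℝ} (hb : 0 < b) {z : ℂ} (hz1 : -1 < z.re)
    (hz0 : z.re < 0) :
    z * ∫ h in Ioo (0 : ℝ) 1, (h : ℂ) ^ (z - 1) * ((1 - (1 - h) ^ b : ℝ) : ℂ) =
      1 - b * Complex.betaIntegral (z + 1) b := by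
  have hint1 : IntegrableOn (fun h : ℝ => (h : ℂ) ^ (z - 1) * ((1 - (1 - h) ^ b : ℝ) : ℂ))
      (Ioo 0 1) := by
    refine ((mellinConvergent_one_sub_max hb hz1 hz0).mono_set Ioo_subset_Ioi_self).congr_fun ?_
      measurableSet_Ioo
    intro h hh
    simp only [smul_eq_mul]
    rw [max_eq_left (by linarith [hh.2])]
  have hint2 := (Complex.betaIntegral_convergent (u := z + 1) (v := b) (by simp; linarith)
    (by simpa using hb))
  have hint1' : IntervalIntegrable
      (fun h : ℝ => (h : ℂ) ^ (z - 1) * ((1 - (1 - h) ^ b : ℝ) : ℂ)) volume 0 1 := by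
    rwa [intervalIntegrable_iff_integrableOn_Ioo_of_le zero_le_one]
  have hder : ∀ x ∈ Ioo (0 : ℝ) 1, HasDerivAt
      (fun h : ℝ => (h : ℂ) ^ z * ((1 - (1 - h) ^ b : ℝ) : ℂ))
      (z * ((x : ℂ) ^ (z - 1) * ((1 - (1 - x) ^ b : ℝ) : ℂ)) +
        b * ((x : ℂ) ^ (z + 1 - 1) * (1 - (x : ℂ)) ^ ((b : ℂ) - 1))) x := by
    intro x hx
    have hz : z ≠ 0 := by rintro rfl; simp at hz0
    have h1 : 0 < 1 - x := by linarith [hx.2]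
    have d1 := hasDerivAt_ofReal_cpow_const (x := x) hx.1.ne' hz
    have d2 : HasDerivAt (fun h : ℝ => ((1 - (1 - h) ^ b : ℝ) : ℂ))
        ((b * (1 - x) ^ (b - 1) : ℝ) : ℂ) x := by
      have e := ((Real.hasDerivAt_rpow_const (x := 1 - x) (p := b)
        (Or.inl h1.ne')).comp_const_sub 1 x).const_sub 1
      have e' := e.congr_deriv (neg_neg _)
      exact e'.ofReal_comp
    refine (d1.mul d2).congr_deriv ?_
    rw [Complex.ofReal_mul, Complex.ofReal_cpow h1.le]
    push_cast
    rw [add_sub_cancel_right]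
    ring
  have key := intervalIntegral.integral_eq_sub_of_hasDerivAt_of_tendsto (fa := 0) (fb := 1)
    zero_lt_one hder ((hint1'.const_mul z).add (hint2.const_mul (b : ℂ))) ?_ ?_
  · rw [intervalIntegral.integral_add (hint1'.const_mul z) (hint2.const_mul (b : ℂ)),
      intervalIntegral.integral_const_mul, intervalIntegral.integral_const_mul,
      intervalIntegral.integral_of_le (zero_le_one (α := ℝ)), integral_Ioc_eq_integral_Ioo] at key
    rw [Complex.betaIntegral]
    linear_combination key
  · rw [tendsto_zero_iff_norm_tendsto_zero]
    have hO := (isBigO_one_sub_max_rpow_zero (b := b)).norm_left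
    have h3 : (fun x : ℝ => ‖(x : ℂ) ^ z * ((1 - (1 - x) ^ b : ℝ) : ℂ)‖) =O[𝓝[>] 0]
        fun x => x ^ (z.re + 1) := by
      refine ((isBigO_refl (fun x : ℝ => x ^ z.re) (𝓝[>] 0)).mul hO).congr' ?_ ?_
      · filter_upwards [self_mem_nhdsWithin,
          nhdsWithin_le_nhds (Iio_mem_nhds (zero_lt_one' ℝ))] with h h0 h1
        have h1 : h < 1 := h1
        rw [norm_mul, Complex.norm_cpow_eq_rpow_re_of_pos h0, Complex.norm_real,
          max_eq_left (by linarith)]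
      · filter_upwards [self_mem_nhdsWithin] with h h0
        rw [Real.rpow_add h0]
    refine h3.trans_tendsto ?_
    have : Tendsto (fun x : ℝ => x ^ (z.re + 1)) (𝓝 0) (𝓝 (0 ^ (z.re + 1))) :=
      tendsto_id.rpow_const (Or.inr (by linarith))
    rw [Real.zero_rpow (by linarith)] at this
    exact this.mono_left nhdsWithin_le_nhds
  · have c1 : ContinuousAt (fun h : ℝ => (h : ℂ) ^ z * ((1 - (1 - h) ^ b : ℝ) : ℂ)) 1 := by
      refine ContinuousAt.mul ?_ (Complex.continuous_ofReal.continuousAt.comp ?_)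
      · exact Complex.continuousAt_ofReal_cpow_const 1 z (Or.inr one_ne_zero)
      · exact continuousAt_const.sub (((continuousAt_const.sub continuousAt_id)).rpow_const
          (Or.inr hb.le))
    have c2 := c1.tendsto.mono_left (nhdsWithin_le_nhds (s := Iio 1))
    simpa [Real.zero_rpow hb.ne'] using c2

/-- Beyond h = 1 the integrand is the pure power h^(z-1), whose integral -1/z cancels the boundary
term left by the integration by parts on (0, 1). -/
theorem mellin_one_sub_max {b : ℝ} (hb : 0 < b) {z : ℂ} (hz1 : -1 < z.re) (hz0 : z.re < 0) :
    z * mellin (fun h : ℝ => ((1 - (max (1 - h) 0) ^ b : ℝ) : ℂ)) z =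
      -(b * Complex.betaIntegral (z + 1) b) := by
  have hz : z ≠ 0 := by rintro rfl; simp at hz0
  have hint := mellinConvergent_one_sub_max hb hz1 hz0
  rw [MellinConvergent, ← Ioc_union_Ioi_eq_Ioi (zero_le_one (α := ℝ)), integrableOn_union] at hint
  rw [mellin, ← Ioc_union_Ioi_eq_Ioi (zero_le_one (α := ℝ)),
    setIntegral_union (by rw [Set.disjoint_left]; intro x hx hx'; exact absurd hx.2 (not_le.2 hx'))
      measurableSet_Ioi hint.1 hint.2, integral_Ioc_eq_integral_Ioo, mul_add]
  have e1 : ∫ t in Ioo (0 : ℝ) 1, (t : ℂ) ^ (z - 1) • ((1 - (max (1 - t) 0) ^ b : ℝ) : ℂ) =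
      ∫ h in Ioo (0 : ℝ) 1, (h : ℂ) ^ (z - 1) * ((1 - (1 - h) ^ b : ℝ) : ℂ) := by
    refine setIntegral_congr_fun measurableSet_Ioo fun t ht => ?_
    simp only [smul_eq_mul]
    rw [max_eq_left (by linarith [ht.2])]
  have e2 : ∫ t in Ioi (1 : ℝ), (t : ℂ) ^ (z - 1) • ((1 - (max (1 - t) 0) ^ b : ℝ) : ℂ) =
      ∫ h in Ioi (1 : ℝ), (h : ℂ) ^ (z - 1) := by
    refine setIntegral_congr_fun measurableSet_Ioi fun t ht => ?_
    have : (1 : ℝ) < t := ht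
    simp only [smul_eq_mul]
    rw [max_eq_right (by linarith), Real.zero_rpow hb.ne']
    simp
  rw [e1, e2, setIntegral_Ioo_cpow_mul_one_sub_rpow hb hz1 hz0,
    integral_Ioi_cpow_of_lt (by simp; linarith) zero_lt_one]
  simp
  field_simp
  ring

/-- Integration by parts on the whole half-line; the strip -1 < Re z < -b is where both boundary
terms vanish. The result is the Beta integral already computed. -/
theorem mellin_one_sub_one_add {b : ℝ} (hb : 0 < b) {z : ℂ} (hz1 : -1 < z.re)
    (hz0 : z.re < -b) :
    z * mellin (fun h : ℝ => ((1 - (1 + h) ^ b : ℝ) : ℂ)) z =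
      b * mellin (fun h : ℝ => (((1 + h) ^ (-(1 - b)) : ℝ) : ℂ)) (z + 1) := by
  have hz : z ≠ 0 := by rintro rfl; simp at hz0; linarith
  have hint1 := mellinConvergent_one_sub_one_add hb hz1 hz0
  have hint2 : MellinConvergent (fun h : ℝ => (((1 + h) ^ (-(1 - b)) : ℝ) : ℂ)) (z + 1) := by
    refine mellinConvergent_of_isBigO_rpow (a := 1 - b) (b := 0)
      (((continuousOn_one_add_rpow _).mono fun x hx => by
        simp only [mem_Ioi] at hx ⊢; linarith).locallyIntegrableOn_ofReal)
      (Complex.isBigO_ofReal_left.2 (isBigO_one_add_rpow_atTop _)) (by simp; linarith)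
      (Complex.isBigO_ofReal_left.2 ?_) (by simp; linarith)
    have : ContinuousAt (fun h : ℝ => (1 + h) ^ (-(1 - b))) 0 :=
      (continuousAt_const.add continuousAt_id).rpow_const (Or.inl (by simp))
    simpa using (this.tendsto.isBigO_one ℝ).mono (nhdsWithin_le_nhds (s := Ioi 0))
  have hder : ∀ x ∈ Ioi (0 : ℝ), HasDerivAt
      (fun h : ℝ => (h : ℂ) ^ z * ((1 - (1 + h) ^ b : ℝ) : ℂ))
      (z * ((x : ℂ) ^ (z - 1) • ((1 - (1 + x) ^ b : ℝ) : ℂ)) -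
        b * ((x : ℂ) ^ (z + 1 - 1) • (((1 + x) ^ (-(1 - b)) : ℝ) : ℂ))) x := by
    intro x hx
    have hx : 0 < x := hx
    have h1 : 0 < 1 + x := by linarith
    have d1 := hasDerivAt_ofReal_cpow_const (x := x) hx.ne' hz
    have d2 : HasDerivAt (fun h : ℝ => ((1 - (1 + h) ^ b : ℝ) : ℂ))
        ((-(b * (1 + x) ^ (b - 1)) : ℝ) : ℂ) x :=
      (((Real.hasDerivAt_rpow_const (x := 1 + x) (p := b)
        (Or.inl h1.ne')).comp_const_add 1 x).const_sub 1).ofReal_comp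
    refine (d1.mul d2).congr_deriv ?_
    simp only [smul_eq_mul]
    rw [add_sub_cancel_right, neg_sub]
    push_cast
    ring
  -- The `if` builds the limit 0 into the value at the left end point, where one-sided continuity is
  -- required.
  have key := integral_Ioi_of_hasDerivAt_of_tendsto
    (a := 0) (m := 0) (f := fun h : ℝ => if h ≤ 0 then 0 else
      (h : ℂ) ^ z * ((1 - (1 + h) ^ b : ℝ) : ℂ)) ?_ ?_
    ((hint1.const_mul z).sub (hint2.const_mul (b : ℂ))) ?_
  · simp only [Pi.sub_apply] at key
    rw [integral_sub (hint1.const_mul z) (hint2.const_mul (b : ℂ)),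
      integral_const_mul, integral_const_mul] at key
    simp only [le_refl, if_true, sub_zero] at key
    rw [mellin, mellin]
    linear_combination key
  · rw [ContinuousWithinAt, if_pos le_rfl, tendsto_zero_iff_norm_tendsto_zero]
    have hO := (isBigO_one_sub_one_add_rpow_zero b).norm_left
    have h3 : (fun x : ℝ => ‖(x : ℂ) ^ z * ((1 - (1 + x) ^ b : ℝ) : ℂ)‖) =O[𝓝[>] 0]
        fun x => x ^ (z.re + 1) := by
      refine ((isBigO_refl (fun x : ℝ => x ^ z.re) (𝓝[>] 0)).mul hO).congr' ?_ ?_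
      · filter_upwards [self_mem_nhdsWithin] with h h0
        rw [norm_mul, Complex.norm_cpow_eq_rpow_re_of_pos h0, Complex.norm_real]
      · filter_upwards [self_mem_nhdsWithin] with h h0
        rw [Real.rpow_add h0]
    have h4 : Tendsto (fun x : ℝ => x ^ (z.re + 1)) (𝓝[>] 0) (𝓝 0) := by
      have : Tendsto (fun x : ℝ => x ^ (z.re + 1)) (𝓝 0) (𝓝 (0 ^ (z.re + 1))) :=
        tendsto_id.rpow_const (Or.inr (by linarith))
      rw [Real.zero_rpow (by linarith)] at this
      exact this.mono_left nhdsWithin_le_nhds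
    have h5 := h3.trans_tendsto h4
    rw [← Ioi_insert, nhdsWithin_insert]
    refine Tendsto.sup ?_ ?_
    · rw [tendsto_pure_left]
      intro s hs
      simpa using mem_of_mem_nhds hs
    · refine h5.congr' ?_
      filter_upwards [self_mem_nhdsWithin] with h h0
      rw [if_neg (not_le.2 h0)]
  · intro x hx
    refine (hder x hx).congr_of_eventuallyEq ?_
    filter_upwards [Ioi_mem_nhds hx] with h h0
    rw [if_neg (not_le.2 h0)]
  · rw [tendsto_zero_iff_norm_tendsto_zero]
    have h3 : (fun x : ℝ => ‖(x : ℂ) ^ z * ((1 - (1 + x) ^ b : ℝ) : ℂ)‖) =O[atTop]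
        fun x => x ^ (-(-b - z.re)) := by
      refine ((isBigO_refl (fun x : ℝ => x ^ z.re) atTop).mul
        (isBigO_one_sub_one_add_rpow_atTop hb).norm_left).congr' ?_ ?_
      · filter_upwards [eventually_gt_atTop 0] with h h0
        rw [norm_mul, Complex.norm_cpow_eq_rpow_re_of_pos h0, Complex.norm_real]
      · filter_upwards [eventually_gt_atTop 0] with h h0
        rw [← Real.rpow_add h0]
        congr 1; ring
    refine (h3.trans_tendsto (tendsto_rpow_neg_atTop (by linarith))).congr' ?_
    filter_upwards [eventually_gt_atTop 0] with h h0
    rw [if_neg (not_le.2 h0)]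

theorem Complex.inv_Gamma_one_sub (w : ℂ) (hw : Complex.Gamma w ≠ 0)
    (hw' : Complex.Gamma (1 - w) ≠ 0) :
    (Complex.Gamma (1 - w))⁻¹ = Complex.Gamma w * Complex.sin (Real.pi * w) / Real.pi := by
  have hpi : (Real.pi : ℂ) ≠ 0 := by exact_mod_cast Real.pi_ne_zero
  have r := Complex.Gamma_mul_Gamma_one_sub w
  have hs : Complex.sin (Real.pi * w) ≠ 0 := by
    intro h
    rw [h, div_zero] at r
    exact mul_ne_zero hw hw' r
  generalize Complex.sin (Real.pi * w) = S at *
  rw [eq_div_iff hs] at r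
  rw [eq_div_iff hpi, ← r]
  field_simp

/-- In this strip the two halves of the second difference converge separately, each to a Beta
integral. The reflection formula brings both to the common factor Γ(b+1) Γ(-z-b) / Γ(1-z), leaving a
trigonometric identity. -/
theorem mellin_powDiff_of_neg_one_lt {b : ℝ} (hb : 0 < b) (hb1 : b < 1) {z : ℂ}
    (hz1 : -1 < z.re) (hz0 : z.re < -b) :
    mellin (fun h : ℝ => ((powDiff b h : ℝ) : ℂ)) z =
      Complex.Gamma (b + 1) * Complex.Gamma (-z - b) / Complex.Gamma (1 - z) *
        (Complex.sin (Real.pi * (b + z / 2)) / Complex.sin (Real.pi * (z / 2))) := by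
  have hz00 : z.re < 0 := by linarith
  have hz : z ≠ 0 := by rintro rfl; simp at hz00
  have h1 := mellin_one_sub_max hb hz1 hz00
  have h2 := mellin_one_sub_one_add hb hz1 hz0
  have hadd : mellin (fun h : ℝ => ((powDiff b h : ℝ) : ℂ)) z =
      mellin (fun h : ℝ => ((1 - (max (1 - h) 0) ^ b : ℝ) : ℂ)) z +
      mellin (fun h : ℝ => ((1 - (1 + h) ^ b : ℝ) : ℂ)) z := by
    rw [← (hasMellin_add (mellinConvergent_one_sub_max hb hz1 hz00)
      (mellinConvergent_one_sub_one_add hb hz1 hz0)).2]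
    congr 1
    funext h
    rw [powDiff_eq]
    push_cast
    ring
  rw [mellin_one_add_rpow_neg (by simp; linarith) (by simp; linarith)] at h2
  rw [Complex.betaIntegral_eq_Gamma_mul_div _ _ (by simp; linarith) (by simpa using hb)] at h1
  have hb' : (b : ℂ) ≠ 0 := by exact_mod_cast hb.ne'
  have r1 := Complex.Gamma_mul_Gamma_one_sub (-z - b)
  have r2 := Complex.Gamma_mul_Gamma_one_sub b
  have r3 := Complex.Gamma_mul_Gamma_one_sub (-z)
  have g1 : Complex.Gamma (-z - b) ≠ 0 := Complex.Gamma_ne_zero_of_re_pos (by simp; linarith)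
  have g2 : Complex.Gamma (1 - (-z - b)) ≠ 0 :=
    Complex.Gamma_ne_zero_of_re_pos (by simp; linarith)
  have g3 : Complex.Gamma (b : ℂ) ≠ 0 := Complex.Gamma_ne_zero_of_re_pos (by simpa using hb)
  have g4 : Complex.Gamma (1 - (b : ℂ)) ≠ 0 :=
    Complex.Gamma_ne_zero_of_re_pos (by simpa using hb1)
  have g5 : Complex.Gamma (-z) ≠ 0 := Complex.Gamma_ne_zero_of_re_pos (by simpa using hz00)
  have g6 : Complex.Gamma (1 - (-z)) ≠ 0 :=
    Complex.Gamma_ne_zero_of_re_pos (by simp; linarith)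
  have hpi : (Real.pi : ℂ) ≠ 0 := by exact_mod_cast Real.pi_ne_zero
  have s1 : Complex.sin (Real.pi * (-z - b)) ≠ 0 := by
    intro h; rw [h, div_zero] at r1; exact mul_ne_zero g1 g2 r1
  have s2 : Complex.sin (Real.pi * b) ≠ 0 := by
    intro h; rw [h, div_zero] at r2; exact mul_ne_zero g3 g4 r2
  have s3 : Complex.sin (Real.pi * (-z)) ≠ 0 := by
    intro h; rw [h, div_zero] at r3; exact mul_ne_zero g5 g6 r3
  have e3 : Complex.sin (Real.pi * (-z)) =
      -(2 * Complex.sin (Real.pi * (z / 2)) * Complex.cos (Real.pi * (z / 2))) := by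
    rw [← Complex.sin_two_mul, ← Complex.sin_neg]; congr 1; ring
  have s4 : Complex.sin (Real.pi * (z / 2)) ≠ 0 := by
    intro h; apply s3; rw [e3, h]; ring
  have s5 : Complex.cos (Real.pi * (z / 2)) ≠ 0 := by
    intro h; apply s3; rw [e3, h]; ring
  -- The factor cos(πz/2) produced here cancels the one from the double angle formula in `e3`.
  have e4 : Complex.sin (Real.pi * b) - Complex.sin (Real.pi * (-z - b)) =
      2 * Complex.sin (Real.pi * (b + z / 2)) * Complex.cos (Real.pi * (z / 2)) := by
    rw [Complex.sin_sub_sin]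
    rw [show ((Real.pi * b - Real.pi * (-z - b)) / 2 : ℂ) = Real.pi * (b + z / 2) by ring,
      show ((Real.pi * b + Real.pi * (-z - b)) / 2 : ℂ) = -(Real.pi * (z / 2)) by ring,
      Complex.cos_neg]
  have q1 := Complex.inv_Gamma_one_sub _ g1 g2
  have q2 := Complex.inv_Gamma_one_sub _ g3 g4
  have q3 : Complex.Gamma (z + 1) = Real.pi / (Complex.Gamma (-z) *
      -(2 * Complex.sin (Real.pi * (z / 2)) * Complex.cos (Real.pi * (z / 2)))) := by
    rw [← e3, show z + 1 = 1 - -z by ring]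
    rw [eq_div_iff s3] at r3
    rw [eq_div_iff (mul_ne_zero g5 s3)]
    linear_combination r3
  have q4 : Complex.Gamma (1 - z) = -z * Complex.Gamma (-z) := by
    rw [← Complex.Gamma_add_one _ (neg_ne_zero.2 hz)]; congr 1; ring
  rw [show ((1 - b : ℝ) : ℂ) - (z + 1) = -z - b by push_cast; ring,
    show ((1 - b : ℝ) : ℂ) = 1 - (b : ℂ) by push_cast; ring] at h2
  rw [show z + 1 + (b : ℂ) = 1 - (-z - b) by ring] at h1
  apply mul_left_cancel₀ hz
  rw [hadd, mul_add, h1, h2, div_eq_mul_inv, div_eq_mul_inv, q1, q2, q3, q4,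
    Complex.Gamma_add_one _ hb']
  generalize Complex.sin (Real.pi * (b + z / 2)) = S1 at *
  generalize Complex.sin (Real.pi * (z / 2)) = S2 at *
  generalize Complex.cos (Real.pi * (z / 2)) = C1 at *
  generalize Complex.sin (Real.pi * (-z - b)) = S3 at *
  generalize Complex.sin (Real.pi * b) = S4 at *
  field_simp
  linear_combination -e4

/-- Analytic continuation: the second difference is O(h²) at 0, so its transform is holomorphic down
to Re z > -2 although the separate halves diverge for Re z ≤ -1. The application is at z = -2s,
which may lie below -1. -/
theorem mellin_powDiff {b : ℝ} (hb : 0 < b) (hb1 : b < 1) {z : ℂ}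
    (hz1 : -2 < z.re) (hz0 : z.re < -b) :
    mellin (fun h : ℝ => ((powDiff b h : ℝ) : ℂ)) z =
      Complex.Gamma (b + 1) * Complex.Gamma (-z - b) / Complex.Gamma (1 - z) *
        (Complex.sin (Real.pi * (b + z / 2)) / Complex.sin (Real.pi * (z / 2))) := by
  set U : Set ℂ := Complex.re ⁻¹' Ioo (-2) (-b) with hU
  have hUo : IsOpen U := isOpen_Ioo.preimage Complex.continuous_re
  have hUc : IsPreconnected U :=
    ((convex_Ioo (-2) (-b)).linear_preimage Complex.reLm).isPreconnected
  have hl : DifferentiableOn ℂ (mellin (fun h : ℝ => ((powDiff b h : ℝ) : ℂ))) U := by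
    intro z hz
    exact (mellin_differentiableAt_of_isBigO_rpow
      (continuousOn_powDiff hb).locallyIntegrableOn_ofReal
      (Complex.isBigO_ofReal_left.2 (isBigO_powDiff_atTop hb)) hz.2
      (Complex.isBigO_ofReal_left.2 (isBigO_powDiff_zero b)) hz.1).differentiableWithinAt
  have hr : DifferentiableOn ℂ (fun z : ℂ =>
      Complex.Gamma (b + 1) * Complex.Gamma (-z - b) / Complex.Gamma (1 - z) *
        (Complex.sin (Real.pi * (b + z / 2)) / Complex.sin (Real.pi * (z / 2)))) U := by
    intro z hz
    have hz1 : -2 < z.re := hz.1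
    have hz2 : z.re < -b := hz.2
    have g (w : ℂ) (hw : 0 < w.re) : DifferentiableAt ℂ Complex.Gamma w :=
      Complex.differentiableAt_Gamma _ fun m h => by
        rw [h] at hw
        simp only [Complex.neg_re, Complex.natCast_re] at hw
        have : (0 : ℝ) ≤ m := Nat.cast_nonneg m
        linarith
    refine DifferentiableAt.differentiableWithinAt ?_
    refine DifferentiableAt.mul (DifferentiableAt.div (DifferentiableAt.mul (by fun_prop) ?_) ?_ ?_)
      (DifferentiableAt.div (by fun_prop) (by fun_prop) ?_)
    · exact (g (-z - b) (by simp; linarith)).comp z (by fun_prop)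
    · exact (g (1 - z) (by simp; linarith)).comp z (by fun_prop)
    · exact Complex.Gamma_ne_zero_of_re_pos (by simp; linarith)
    -- The zeros of sin(πz/2) are the even integers, and the open strip between -2 and -b contains
    -- none.
    · rw [Complex.sin_ne_zero_iff]
      intro k hk
      have hpi : (Real.pi : ℂ) ≠ 0 := by exact_mod_cast Real.pi_ne_zero
      have h1 : z = 2 * k := by
        have : (Real.pi : ℂ) * (z - 2 * k) = 0 := by linear_combination 2 * hk
        rcases mul_eq_zero.1 this with h | h
        · exact absurd h hpi
        · linear_combination h
      rw [h1] at hz1 hz2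
      simp at hz1 hz2
      have h3 : (-1 : ℝ) < k := by linarith
      have h4 : (k : ℝ) < 0 := by linarith
      have h3' : (-1 : ℤ) < k := by exact_mod_cast h3
      have h4' : k < 0 := by exact_mod_cast h4
      omega
  -- The midpoint of (-1, -b), an interval that is nonempty because b < 1.
  have hmem : ((-(b + 1) / 2 : ℝ) : ℂ) ∈ U := by
    simp only [hU, mem_preimage, Complex.ofReal_re, mem_Ioo]
    constructor <;> linarith
  refine (hl.analyticOnNhd hUo).eqOn_of_preconnected_of_eventuallyEq (hr.analyticOnNhd hUo)
    hUc hmem ?_ ⟨hz1, hz0⟩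
  have hV : Complex.re ⁻¹' Ioo (-1) (-b) ∈ 𝓝 ((-(b + 1) / 2 : ℝ) : ℂ) := by
    refine (isOpen_Ioo.preimage Complex.continuous_re).mem_nhds ?_
    simp only [mem_preimage, Complex.ofReal_re, mem_Ioo]
    constructor <;> linarith
  filter_upwards [hV] with w hw
  exact mellin_powDiff_of_neg_one_lt hb hb1 hw.1 hw.2

/-! ### Bump functions on the half-line -/

/-- Smooth functions supported in a compact interval of the open half-line. -/
structure IsBump (m M : ℝ) (φ : ℝ → ℝ) : Prop where
  pos : 0 < m
  lt : m < M
  smooth : ContDiff ℝ ∞ φ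
  zero : ∀ y, y ∉ Ioo m M → φ y = 0

namespace IsBump

variable {m M : ℝ} {φ : ℝ → ℝ}

theorem continuous (h : IsBump m M φ) : Continuous φ := h.smooth.continuous

theorem differentiable (h : IsBump m M φ) : Differentiable ℝ φ :=
  h.smooth.differentiable (by simp)

theorem hasDerivAt (h : IsBump m M φ) (x : ℝ) : HasDerivAt φ (deriv φ x) x :=
  (h.differentiable x).hasDerivAt

theorem hasCompactSupport (h : IsBump m M φ) : HasCompactSupport φ :=
  HasCompactSupport.intro isCompact_Icc fun x hx => h.zero x fun hx' => hx (Ioo_subset_Icc_self hx')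

theorem integrable (h : IsBump m M φ) : Integrable φ :=
  h.continuous.integrable_of_hasCompactSupport h.hasCompactSupport

theorem derivative (h : IsBump m M φ) : IsBump m M (deriv φ) where
  pos := h.pos
  lt := h.lt
  smooth := (contDiff_infty_iff_deriv.1 h.smooth).2
  zero := by
    have hc : Continuous (deriv φ) := (contDiff_infty_iff_deriv.1 h.smooth).2.continuous
    have hcl : IsClosed {y | deriv φ y = 0} := isClosed_eq hc continuous_const
    -- The derivative vanishes on the open set outside [m, M]; the closure argument adds the end
    -- points m and M, which also lie outside `Ioo m M`.
    have aux (U : Set ℝ) (hU : IsOpen U) (hd : ∀ y ∈ U, y ∉ Ioo m M) :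
        closure U ⊆ {y | deriv φ y = 0} := by
      refine hcl.closure_subset_iff.2 fun y hy => ?_
      have : φ =ᶠ[𝓝 y] fun _ => 0 := by
        filter_upwards [hU.mem_nhds hy] with z hz using h.zero z (hd z hz)
      simpa using this.deriv_eq
    intro y hy
    rcases le_or_gt y m with h1 | h1
    · refine aux (Iio m) isOpen_Iio (fun y hy hy' => ?_) (by rw [closure_Iio]; exact h1)
      exact absurd hy (not_lt.2 hy'.1.le)
    · refine aux (Ioi M) isOpen_Ioi (fun y hy hy' => ?_) (by
        rw [closure_Ioi]; exact not_lt.1 fun h2 => hy ⟨h1, h2⟩)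
      exact absurd hy (not_lt.2 hy'.2.le)

theorem exists_bound (h : IsBump m M φ) : ∃ K, 0 ≤ K ∧ ∀ x, |φ x| ≤ K := by
  obtain ⟨K, hK⟩ := h.hasCompactSupport.exists_bound_of_continuous h.continuous
  exact ⟨K, (norm_nonneg _).trans (hK 0), hK⟩

variable {E : Type*} [NormedAddCommGroup E] [NormedSpace ℝ E]

theorem integral_smul_eq (h : IsBump m M φ) {S : Set ℝ} (hS : MeasurableSet S) (hmM : Ioo m M ⊆ S)
    (k : ℝ → E) : ∫ y in S, φ y • k y = ∫ y in m..M, φ y • k y := by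
  rw [intervalIntegral.integral_of_le h.lt.le, integral_Ioc_eq_integral_Ioo]
  refine setIntegral_eq_of_subset_of_forall_sdiff_eq_zero hS hmM fun y hy => ?_
  rw [h.zero y hy.2, zero_smul]

theorem integrableOn_smul (h : IsBump m M φ) {k : ℝ → E} (hk : ContinuousOn k (Icc m M))
    (S : Set ℝ) : IntegrableOn (fun y => φ y • k y) S := by
  have h1 : IntegrableOn (fun y => φ y • k y) (Icc m M) :=
    (h.continuous.continuousOn.smul hk).integrableOn_Icc
  refine (h1.of_forall_sdiff_eq_zero (t := univ) MeasurableSet.univ fun y hy => ?_).mono_set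
    (subset_univ S)
  rw [h.zero y fun hy' => hy.2 (Ioo_subset_Icc_self hy'), zero_smul]

theorem integral_deriv_smul [CompleteSpace E] (h : IsBump m M φ) {S : Set ℝ} (hS : MeasurableSet S)
    (hmM : Ioo m M ⊆ S) {k k' : ℝ → E} (hk : ∀ y ∈ Icc m M, HasDerivAt k (k' y) y)
    (hk' : ContinuousOn k' (Icc m M)) :
    ∫ y in S, deriv φ y • k y = -∫ y in S, φ y • k' y := by
  rw [h.integral_smul_eq hS hmM, h.derivative.integral_smul_eq hS hmM, eq_neg_iff_add_eq_zero]
  have huI : uIcc m M = Icc m M := uIcc_of_le h.lt.le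
  have hkc : ContinuousOn k (uIcc m M) := fun y hy =>
    (hk y (huI ▸ hy)).continuousAt.continuousWithinAt
  rw [← huI] at hk'
  have i1 : IntervalIntegrable (fun y => deriv φ y • k y) volume m M :=
    (h.derivative.continuous.continuousOn.smul hkc).intervalIntegrable
  have i2 : IntervalIntegrable (fun y => φ y • k' y) volume m M :=
    (h.continuous.continuousOn.smul hk').intervalIntegrable
  rw [← intervalIntegral.integral_add i1 i2,
    intervalIntegral.integral_eq_sub_of_hasDerivAt (f := fun y => φ y • k y) _ (i1.add i2),
    h.zero m (by simp), h.zero M (by simp), zero_smul, zero_smul, sub_zero]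
  intro y hy
  exact ((h.hasDerivAt y).smul (hk y (huI ▸ hy))).congr_deriv (add_comm _ _)

end IsBump

/-! ### The reflected potential and its Mellin transform -/

/-- The interaction of `ψ`, supported in `(0, ∞)`, with the reflected point `-t`. -/
noncomputable def reflPotential (s : ℝ) (ψ : ℝ → ℝ) (t : ℝ) : ℝ :=
  ∫ y in Ioi (0 : ℝ), ψ y * (t + y) ^ (-(1 + 2 * s))

section Refl

variable {s m M : ℝ} {φ : ℝ → ℝ}

/-- Integration by parts moves the derivative onto the kernel and so gains one power of decay at
infinity. -/
theorem reflPotential_deriv (h : IsBump m M φ) {t : ℝ} (ht : 0 ≤ t) :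
    reflPotential s (deriv φ) t =
      (1 + 2 * s) * ∫ y in Ioi (0 : ℝ), φ y * (t + y) ^ (-(2 + 2 * s)) := by
  have hne : ∀ y ∈ Icc m M, t + y ≠ 0 := fun y hy => by linarith [h.pos, hy.1]
  have := h.integral_deriv_smul measurableSet_Ioi (fun y hy => h.pos.trans hy.1)
    (k := fun y => (t + y) ^ (-(1 + 2 * s)))
    (k' := fun y => (-(1 + 2 * s)) * (t + y) ^ (-(2 + 2 * s))) ?_ ?_
  · simp only [smul_eq_mul] at this
    rw [reflPotential, this, ← integral_neg, ← integral_const_mul]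
    congr 1
    funext y
    ring
  · intro y hy
    have := (Real.hasDerivAt_rpow_const (x := t + y) (p := -(1 + 2 * s))
      (Or.inl (hne y hy))).comp_const_add t y
    exact this.congr_deriv (by congr 2; ring)
  · exact continuousOn_const.mul ((continuousOn_const.add continuousOn_id).rpow_const
      fun y hy => Or.inl (hne y hy))

theorem reflPotential_bound (hs : 0 < s) (h : IsBump m M φ) :
    ∃ K, 0 ≤ K ∧ ∀ t, 0 < t → |reflPotential s (deriv φ) t| ≤ K ∧
      |reflPotential s (deriv φ) t| ≤ K * t ^ (-(2 + 2 * s)) := by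
  have key : ∀ t, 0 < t → ∀ c : ℝ, (∀ y, m < y → (t + y) ^ (-(2 + 2 * s)) ≤ c) →
      |reflPotential s (deriv φ) t| ≤ (1 + 2 * s) * (∫ y in Ioi (0 : ℝ), |φ y|) * c := by
    intro t ht c hc
    rw [reflPotential_deriv h ht.le, abs_mul, abs_of_pos (by linarith), mul_assoc]
    gcongr
    rw [← integral_mul_const]
    refine norm_integral_le_of_norm_le (f := fun y => φ y * (t + y) ^ (-(2 + 2 * s)))
      (h.integrable.abs.integrableOn.mul_const c) ?_
    refine (ae_restrict_mem measurableSet_Ioi).mono fun y hy => ?_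
    have hy : 0 < y := hy
    rw [Real.norm_eq_abs, abs_mul, abs_of_nonneg (Real.rpow_nonneg (by linarith) _)]
    by_cases hym : y ∈ Ioo m M
    · gcongr
      exact hc y hym.1
    · rw [h.zero y hym]; simp
  -- The maximum makes one constant serve both bounds: t + y ≥ m gives the uniform one, t + y ≥ t
  -- the decay.
  refine ⟨(1 + 2 * s) * (∫ y in Ioi (0 : ℝ), |φ y|) * max (m ^ (-(2 + 2 * s))) 1, ?_, ?_⟩
  · have := integral_nonneg (μ := volume.restrict (Ioi (0 : ℝ))) (f := fun y => |φ y|)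
      fun y => abs_nonneg _
    positivity
  · intro t ht
    have hI := integral_nonneg (μ := volume.restrict (Ioi (0 : ℝ))) (f := fun y => |φ y|)
      fun y => abs_nonneg _
    constructor
    · refine key t ht _ fun y hy => ?_
      exact (Real.rpow_le_rpow_of_nonpos h.pos (by linarith) (by linarith)).trans (le_max_left _ _)
    · refine (key t ht (t ^ (-(2 + 2 * s))) fun y hy => ?_).trans ?_
      · exact Real.rpow_le_rpow_of_nonpos ht (by linarith [h.pos]) (by linarith)
      · refine mul_le_mul_of_nonneg_right ?_ (by positivity)
        exact le_mul_of_one_le_right (by positivity) (le_max_right _ _)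

theorem continuousOn_reflPotential (hs : 0 < s) (h : IsBump m M φ) :
    ContinuousOn (reflPotential s (deriv φ)) (Ioi 0) := by
  have : ContinuousOn (fun t => (1 + 2 * s) *
      ∫ y in Ioi (0 : ℝ), φ y * (t + y) ^ (-(2 + 2 * s))) (Ioi 0) := by
    refine continuousOn_const.mul ?_
    refine continuousOn_of_dominated (bound := fun y => |φ y| * m ^ (-(2 + 2 * s))) ?_ ?_ ?_ ?_
    · intro t ht
      refine ContinuousOn.aestronglyMeasurable (h.continuous.continuousOn.mul
        ((continuousOn_const.add continuousOn_id).rpow_const fun y hy => Or.inl ?_))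
        measurableSet_Ioi
      have h1 : 0 < t := ht
      have h2 : 0 < y := hy
      have : (0 : ℝ) < t + y := by linarith
      exact this.ne'
    · intro t ht
      have h1 : 0 < t := ht
      refine (ae_restrict_mem measurableSet_Ioi).mono fun y hy => ?_
      have hy : 0 < y := hy
      rw [Real.norm_eq_abs, abs_mul, abs_of_nonneg (Real.rpow_nonneg (by linarith) _)]
      by_cases hym : y ∈ Ioo m M
      · exact mul_le_mul_of_nonneg_left
          (Real.rpow_le_rpow_of_nonpos h.pos (by linarith [hym.1]) (by linarith)) (abs_nonneg _)
      · rw [h.zero y hym]; simp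
    · exact h.integrable.abs.integrableOn.mul_const _
    · refine (ae_restrict_mem measurableSet_Ioi).mono fun y hy => ?_
      have h2 : 0 < y := hy
      refine continuousOn_const.mul ((continuousOn_id.add continuousOn_const).rpow_const
        fun t ht => Or.inl ?_)
      have h1 : 0 < t := ht
      have : (0 : ℝ) < t + y := by linarith
      exact this.ne'
  exact this.congr fun t ht => reflPotential_deriv h (le_of_lt ht)

theorem IsBump.differentiable_mellin (h : IsBump m M φ) :
    Differentiable ℂ (mellin (fun y => ((φ y : ℝ) : ℂ))) := by
  intro z
  have hz1 : (fun y => ((φ y : ℝ) : ℂ)) =ᶠ[atTop] fun _ => 0 := by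
    filter_upwards [eventually_ge_atTop M] with y hy
    rw [h.zero y fun h' => absurd h'.2 (not_lt.2 hy), Complex.ofReal_zero]
  have hz2 : (fun y => ((φ y : ℝ) : ℂ)) =ᶠ[𝓝[>] 0] fun _ => 0 := by
    filter_upwards [nhdsWithin_le_nhds (Iio_mem_nhds h.pos)] with y hy
    rw [h.zero y fun h' => absurd h'.1 (not_lt.2 (le_of_lt hy)), Complex.ofReal_zero]
  exact mellin_differentiableAt_of_isBigO_rpow (a := z.re + 1) (b := z.re - 1)
    h.continuous.continuousOn.locallyIntegrableOn_ofReal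
    (hz1.trans_isBigO (isBigO_zero _ _)) (by linarith)
    (hz2.trans_isBigO (isBigO_zero _ _)) (by linarith)

theorem IsBump.mellin_deriv (h : IsBump m M φ) (z : ℂ) :
    mellin (fun y => ((deriv φ y : ℝ) : ℂ)) (z + 1) =
      -z * mellin (fun y => ((φ y : ℝ) : ℂ)) z := by
  have hne : ∀ y ∈ Icc m M, y ≠ 0 := fun y hy => by linarith [h.pos, hy.1]
  by_cases hz : z = 0
  · subst hz
    have := h.integral_deriv_smul measurableSet_Ioi (fun y hy => h.pos.trans hy.1)
      (k := fun y : ℝ => (1 : ℂ)) (k' := fun y : ℝ => 0) (fun y _ => hasDerivAt_const _ _)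
      continuousOn_const
    simpa [mellin] using this
  have := h.integral_deriv_smul measurableSet_Ioi (fun y hy => h.pos.trans hy.1)
    (k := fun y : ℝ => (y : ℂ) ^ z) (k' := fun y : ℝ => z * (y : ℂ) ^ (z - 1))
    (fun y hy => hasDerivAt_ofReal_cpow_const (hne y hy) hz)
    (fun y hy => continuousWithinAt_const.mul
      (Complex.continuousAt_ofReal_cpow_const y _ (Or.inr (hne y hy))).continuousWithinAt)
  rw [mellin, mellin]
  simp only [Complex.real_smul, smul_eq_mul, add_sub_cancel_right] at this ⊢
  rw [neg_mul, ← integral_const_mul]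
  refine Eq.trans ?_ (this.trans ?_)
  · congr 1; funext y; ring
  · congr 2; funext y; ring

/-- After Fubini, the substitution of yt for t makes the inner integral a Beta integral with
exponent 2 + 2s times a power of y, and that power produces the Mellin transform of φ at β - 2s. -/
theorem mellin_reflPotential (hs : 0 < s) (h : IsBump m M φ) {β : ℂ} (h1 : -1 < β.re)
    (h2 : β.re < 2 * s + 1) :
    mellin (fun t => ((reflPotential s (deriv φ) t : ℝ) : ℂ)) (β + 1) =
      Complex.Gamma (β + 1) * Complex.Gamma (2 * s + 1 - β) / Complex.Gamma (2 * s + 1) *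
        mellin (fun y => ((φ y : ℝ) : ℂ)) (β - 2 * s) := by
  set c : ℝ := 2 + 2 * s with hc
  have e1 : mellin (fun t => ((reflPotential s (deriv φ) t : ℝ) : ℂ)) (β + 1) =
      ∫ t in Ioi (0 : ℝ), ∫ y in Ioi (0 : ℝ), (1 + 2 * s : ℂ) *
        ((t : ℂ) ^ β * (φ y * ((t + y) ^ (-c) : ℝ))) := by
    rw [mellin]
    refine setIntegral_congr_fun measurableSet_Ioi fun t ht => ?_
    rw [reflPotential_deriv h (le_of_lt ht), integral_const_mul, integral_const_mul,
      add_sub_cancel_right, Complex.ofReal_mul, ← integral_complex_ofReal, smul_eq_mul]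
    push_cast
    ring
  have hint : Integrable (Function.uncurry fun t y : ℝ => (1 + 2 * s : ℂ) *
        ((t : ℂ) ^ β * (φ y * ((t + y) ^ (-c) : ℝ))))
      ((volume.restrict (Ioi 0)).prod (volume.restrict (Ioi 0))) := by
    refine Integrable.const_mul ?_ _
    -- On the support of φ one has t + y ≥ t + m, so a product of a function of t and a function of
    -- y dominates the integrand.
    have hA : IntegrableOn (fun t : ℝ => (t : ℝ) ^ β.re * (t + m) ^ (-c)) (Ioi 0) := by
      have hm := h.pos
      have := mellin_convergent_of_isBigO_scalar (f := fun t => (t + m) ^ (-c)) (a := c) (b := 0)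
        (s := β.re + 1) ?_ ?_ (by rw [hc]; linarith) ?_ (by linarith)
      · simpa using this
      · refine ContinuousOn.locallyIntegrableOn ((continuousOn_id.add
          continuousOn_const).rpow_const fun t ht => Or.inl ?_) measurableSet_Ioi
        have : 0 < t := ht
        have h3 : (0 : ℝ) < t + m := by linarith
        exact h3.ne'
      · refine IsBigO.of_bound 1 ?_
        filter_upwards [eventually_gt_atTop 0] with t ht
        rw [one_mul, Real.norm_of_nonneg (by positivity), Real.norm_of_nonneg (by positivity)]
        exact Real.rpow_le_rpow_of_nonpos ht (by linarith) (by linarith)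
      · have : ContinuousAt (fun t : ℝ => (t + m) ^ (-c)) 0 :=
          (continuousAt_id.add continuousAt_const).rpow_const (Or.inl (by simpa using hm.ne'))
        simpa using (this.tendsto.isBigO_one ℝ).mono (nhdsWithin_le_nhds (s := Ioi 0))
    refine (hA.mul_prod h.integrable.abs.integrableOn).mono' ?_ ?_
    · refine Measurable.aestronglyMeasurable ?_
      have := h.continuous.measurable
      fun_prop
    · simp only [Measure.prod_restrict]
      refine (ae_restrict_mem (measurableSet_Ioi.prod measurableSet_Ioi)).mono ?_
      rintro ⟨t, y⟩ ⟨ht, hy⟩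
      have ht : 0 < t := ht
      have hy : 0 < y := hy
      change ‖(t : ℂ) ^ β * (φ y * ((t + y) ^ (-c) : ℝ))‖ ≤ t ^ β.re * (t + m) ^ (-c) * |φ y|
      rw [norm_mul, norm_mul, Complex.norm_cpow_eq_rpow_re_of_pos ht, Complex.norm_real,
        Complex.norm_real, Real.norm_eq_abs, Real.norm_eq_abs,
        abs_of_nonneg (Real.rpow_nonneg (by linarith) (-c)), mul_comm (|φ y|), ← mul_assoc]
      by_cases hym : y ∈ Ioo m M
      · exact mul_le_mul_of_nonneg_right (mul_le_mul_of_nonneg_left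
          (Real.rpow_le_rpow_of_nonpos (by linarith [h.pos]) (by linarith [hym.1]) (by linarith))
          (by positivity)) (abs_nonneg _)
      · rw [h.zero y hym]; simp
  rw [e1, integral_integral_swap hint, mellin, ← integral_const_mul]
  refine setIntegral_congr_fun measurableSet_Ioi fun y hy => ?_
  have hy : 0 < y := hy
  have hyc : (y : ℂ) ≠ 0 := by exact_mod_cast hy.ne'
  have e2 : ∫ t in Ioi (0 : ℝ), (t : ℂ) ^ (β + 1 - 1) • (((1 + y⁻¹ * t) ^ (-c) : ℝ) : ℂ) =
      (y : ℂ) ^ (β + 1) * (Complex.Gamma (β + 1) * Complex.Gamma (c - (β + 1)) / Complex.Gamma c) := by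
    have := mellin_comp_mul_left (fun x : ℝ => (((1 + x) ^ (-c) : ℝ) : ℂ)) (β + 1)
      (inv_pos.2 hy)
    rw [mellin, mellin_one_add_rpow_neg (by simp; linarith) (by simp; linarith)] at this
    rw [this, smul_eq_mul, Complex.ofReal_inv, Complex.inv_cpow _ _ (by
      rw [Complex.arg_ofReal_of_nonneg hy.le]; exact Real.pi_pos.ne), Complex.cpow_neg, inv_inv]
  have e3 : ∀ t ∈ Ioi (0 : ℝ), (1 + 2 * s : ℂ) * ((t : ℂ) ^ β * (φ y * ((t + y) ^ (-c) : ℝ))) =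
      ((1 + 2 * s : ℂ) * φ y * ((y ^ (-c) : ℝ) : ℂ)) *
        ((t : ℂ) ^ (β + 1 - 1) • (((1 + y⁻¹ * t) ^ (-c) : ℝ) : ℂ)) := by
    intro t ht
    have ht : 0 < t := ht
    have : t + y = y * (1 + y⁻¹ * t) := by field_simp; ring
    rw [this, Real.mul_rpow hy.le (by positivity), add_sub_cancel_right, smul_eq_mul]
    push_cast
    ring
  rw [setIntegral_congr_fun measurableSet_Ioi e3, integral_const_mul, e2, hc]
  have hg : Complex.Gamma ((2 + 2 * s : ℝ) : ℂ) = (2 * s + 1) * Complex.Gamma (2 * s + 1) := by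
    rw [← Complex.Gamma_add_one]
    · congr 1; push_cast; ring
    · intro h0
      have : (2 * s + 1 : ℝ) = 0 := by exact_mod_cast h0
      linarith
  have hs1 : (2 * s + 1 : ℂ) ≠ 0 := by
    intro h0
    have : (2 * s + 1 : ℝ) = 0 := by exact_mod_cast h0
    linarith
  rw [hg, Complex.ofReal_cpow hy.le, smul_eq_mul,
    show ((2 + 2 * s : ℝ) : ℂ) - (β + 1) = 2 * s + 1 - β by push_cast; ring,
    show (β - 2 * s - 1 : ℂ) = (β + 1) + ((-(2 + 2 * s) : ℝ) : ℂ) by push_cast; ring,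
    Complex.cpow_add (β + 1) _ hyc]
  field_simp
  ring

end Refl

/-! ### The fractional Laplacian of a bump and its Mellin transform -/

/-- The fractional Laplacian without its normalising constant. -/
noncomputable def halfLaplacian (s : ℝ) (ψ : ℝ → ℝ) (x : ℝ) : ℝ :=
  ∫ h in Ioi (0 : ℝ), (2 * ψ x - ψ (x + h) - ψ (x - h)) * h ^ (-(1 + 2 * s))

theorem integrableOn_ite_rpow {p q : ℝ} (hp : -1 < p) (hq : q < -1) :
    IntegrableOn (fun h : ℝ => if h ≤ 1 then h ^ p else h ^ q) (Ioi 0) := by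
  rw [← Ioc_union_Ioi_eq_Ioi (zero_le_one (α := ℝ)), integrableOn_union]
  constructor
  · have := (intervalIntegral.intervalIntegrable_rpow' hp (a := 0) (b := 1))
    rw [intervalIntegrable_iff_integrableOn_Ioc_of_le zero_le_one] at this
    exact this.congr_fun (fun x hx => by simp only; rw [if_pos hx.2]) measurableSet_Ioc
  · exact (integrableOn_Ioi_rpow_of_lt hq zero_lt_one).congr_fun
      (fun x hx => by simp only; rw [if_neg (not_le.2 hx)]) measurableSet_Ioi

section HalfLap

variable {s m M : ℝ} {φ ψ : ℝ → ℝ}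

theorem IsBump.exists_second_difference_bound (h : IsBump m M ψ) :
    ∃ K, 0 ≤ K ∧ ∀ x t : ℝ, 0 ≤ t → |2 * ψ x - ψ (x + t) - ψ (x - t)| ≤ K ∧
      |2 * ψ x - ψ (x + t) - ψ (x - t)| ≤ K * t ^ 2 := by
  obtain ⟨K1, hK1, hb1⟩ := h.exists_bound
  obtain ⟨K2, hK2, hb2⟩ := h.derivative.derivative.exists_bound
  refine ⟨max (4 * K1) (2 * K2), by positivity, fun x t ht => ⟨?_, ?_⟩⟩
  · refine le_trans ?_ (le_max_left _ _)
    rw [abs_le]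
    have := abs_le.1 (hb1 x)
    have := abs_le.1 (hb1 (x + t))
    have := abs_le.1 (hb1 (x - t))
    constructor <;> linarith
  · refine (abs_second_difference_le ht (fun y _ => h.hasDerivAt y)
      (fun y _ => h.derivative.hasDerivAt y) (fun y _ => hb2 y)).trans ?_
    gcongr
    exact le_max_right _ _

theorem second_difference_mul_le {K D t b : ℝ} (ht : 0 < t) (h1 : |D| ≤ K * t ^ b)
    (h2 : |D| ≤ K * t ^ 2) :
    |D * t ^ (-(1 + 2 * s))| ≤
      K * if t ≤ 1 then t ^ (1 - 2 * s) else t ^ (b - (1 + 2 * s)) := by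
  rw [abs_mul, abs_of_pos (Real.rpow_pos_of_pos ht _)]
  split_ifs with h
  · rw [show 1 - 2 * s = 2 + (-(1 + 2 * s)) by ring, Real.rpow_add ht, ← mul_assoc, Real.rpow_two]
    gcongr
  · rw [show b - (1 + 2 * s) = b + (-(1 + 2 * s)) by ring, Real.rpow_add ht, ← mul_assoc]
    gcongr

theorem IsBump.continuous_halfLaplacian (hs : 0 < s) (hs1 : s < 1) (h : IsBump m M ψ) :
    Continuous (halfLaplacian s ψ) ∧ ∃ K, 0 ≤ K ∧ ∀ x, |halfLaplacian s ψ x| ≤ K := by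
  obtain ⟨K, hK, hb⟩ := h.exists_second_difference_bound
  have hbd : ∀ x : ℝ, ∀ᵐ t : ℝ ∂(volume.restrict (Ioi 0)),
      ‖(2 * ψ x - ψ (x + t) - ψ (x - t)) * t ^ (-(1 + 2 * s))‖ ≤
        K * if t ≤ 1 then t ^ (1 - 2 * s) else t ^ (0 - (1 + 2 * s)) := by
    intro x
    refine (ae_restrict_mem measurableSet_Ioi).mono fun t ht => ?_
    have ht : 0 < t := ht
    exact second_difference_mul_le ht (by simpa using (hb x t ht.le).1) (hb x t ht.le).2
  have hint : IntegrableOn (fun t : ℝ => K * if t ≤ 1 then t ^ (1 - 2 * s)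
      else t ^ (0 - (1 + 2 * s))) (Ioi 0) :=
    (integrableOn_ite_rpow (by linarith) (by linarith)).const_mul K
  have hc := h.continuous
  refine ⟨?_, _, ?_, fun x => norm_integral_le_of_norm_le hint (hbd x)⟩
  · refine continuous_of_dominated (fun x => ?_) hbd hint ?_
    · refine Measurable.aestronglyMeasurable ?_
      have := hc.measurable
      fun_prop
    · refine Eventually.of_forall fun t => ?_
      fun_prop
  · exact (norm_nonneg _).trans (norm_integral_le_of_norm_le hint (hbd 0))

/-- To the right of the support only the term ψ(x - t) survives, and integration by parts again
gains one power of decay. -/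
theorem halfLaplacian_deriv_far (h : IsBump m M φ) {x : ℝ} (hx : M < x) :
    halfLaplacian s (deriv φ) x =
      (1 + 2 * s) * ∫ y, φ y * (x - y) ^ (-(2 + 2 * s)) := by
  have e1 : halfLaplacian s (deriv φ) x =
      -∫ t in Ioi (0 : ℝ), deriv φ (x - t) * t ^ (-(1 + 2 * s)) := by
    rw [halfLaplacian, ← integral_neg]
    refine setIntegral_congr_fun measurableSet_Ioi fun t ht => ?_
    have ht : 0 < t := ht
    rw [h.derivative.zero x fun h' => absurd h'.2 (by linarith),
      h.derivative.zero (x + t) fun h' => absurd h'.2 (by linarith)]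
    ring
  have e2 : ∫ t in Ioi (0 : ℝ), deriv φ (x - t) * t ^ (-(1 + 2 * s)) =
      ∫ t : ℝ, deriv φ (x - t) * (x - (x - t)) ^ (-(1 + 2 * s)) := by
    rw [setIntegral_eq_integral_of_forall_compl_eq_zero]
    · simp
    · intro t ht
      have ht : t ≤ 0 := not_lt.1 ht
      rw [h.derivative.zero (x - t) fun h' => absurd h'.2 (by linarith), zero_mul]
  rw [e1, e2, integral_sub_left_eq_self
    (fun y => deriv φ y * (x - y) ^ (-(1 + 2 * s))) volume x]
  have hne : ∀ y ∈ Icc m M, x - y ≠ 0 := fun y hy => by linarith [hy.2]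
  have := h.integral_deriv_smul MeasurableSet.univ (subset_univ _)
    (k := fun y => (x - y) ^ (-(1 + 2 * s)))
    (k' := fun y => (1 + 2 * s) * (x - y) ^ (-(2 + 2 * s))) ?_ ?_
  · simp only [smul_eq_mul, setIntegral_univ] at this
    rw [this, neg_neg, ← integral_const_mul]
    congr 1
    funext y
    ring
  · intro y hy
    have := (Real.hasDerivAt_rpow_const (x := x - y) (p := -(1 + 2 * s))
      (Or.inl (hne y hy))).comp_const_sub x y
    refine this.congr_deriv ?_
    rw [show -(1 + 2 * s) - 1 = -(2 + 2 * s) by ring]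
    ring
  · exact continuousOn_const.mul ((continuousOn_const.sub continuousOn_id).rpow_const
      fun y hy => Or.inl (hne y hy))

theorem halfLaplacian_bound (hs : 0 < s) (hs1 : s < 1) (h : IsBump m M φ) :
    ∃ K, 0 ≤ K ∧ ∀ x, 0 < x → |halfLaplacian s (deriv φ) x| ≤ K ∧
      |halfLaplacian s (deriv φ) x| ≤ K * x ^ (-(2 + 2 * s)) := by
  obtain ⟨-, K, hK, hb⟩ := h.derivative.continuous_halfLaplacian hs hs1
  have hM : 0 < M := h.pos.trans h.lt
  set I := ∫ y, |φ y| with hI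
  have hI0 : 0 ≤ I := integral_nonneg fun y => abs_nonneg _
  -- `K1` serves x > 2M, where x - y ≥ x/2 on the support; `K2` converts the uniform bound `K` into
  -- the decaying one for x ≤ 2M.
  set K1 := (1 + 2 * s) * I * (2 : ℝ) ^ (2 + 2 * s) with hK1
  set K2 := K * (2 * M) ^ (2 + 2 * s) with hK2
  have hK10 : 0 ≤ K1 := by positivity
  have hK20 : 0 ≤ K2 := by positivity
  refine ⟨K + K1 + K2, by positivity, fun x hx => ⟨(hb x).trans (by linarith), ?_⟩⟩
  rcases le_or_gt x (2 * M) with hx2 | hx2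
  · have h1 : 1 ≤ (2 * M) ^ (2 + 2 * s) * x ^ (-(2 + 2 * s)) := by
      rw [Real.rpow_neg hx.le, ← div_eq_mul_inv, one_le_div (by positivity)]
      exact Real.rpow_le_rpow hx.le hx2 (by linarith)
    calc _ ≤ K := hb x
      _ ≤ K * ((2 * M) ^ (2 + 2 * s) * x ^ (-(2 + 2 * s))) := le_mul_of_one_le_right hK h1
      _ = K2 * x ^ (-(2 + 2 * s)) := by rw [hK2]; ring
      _ ≤ _ := by gcongr; linarith
  · rw [halfLaplacian_deriv_far h (by linarith), abs_mul, abs_of_pos (by linarith)]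
    have h1 : |∫ y, φ y * (x - y) ^ (-(2 + 2 * s))| ≤ I * (x / 2) ^ (-(2 + 2 * s)) := by
      rw [hI, ← integral_mul_const]
      refine norm_integral_le_of_norm_le (f := fun y => φ y * (x - y) ^ (-(2 + 2 * s)))
        (h.integrable.abs.mul_const _) (Eventually.of_forall fun y => ?_)
      rw [Real.norm_eq_abs, abs_mul]
      by_cases hy : y ∈ Ioo m M
      · have : x / 2 ≤ x - y := by linarith [hy.2]
        rw [abs_of_nonneg (Real.rpow_nonneg (by linarith) _)]
        exact mul_le_mul_of_nonneg_left
          (Real.rpow_le_rpow_of_nonpos (by linarith) this (by linarith)) (abs_nonneg _)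
      · rw [h.zero y hy]; simp
    calc _ ≤ (1 + 2 * s) * (I * (x / 2) ^ (-(2 + 2 * s))) := by gcongr
      _ = K1 * x ^ (-(2 + 2 * s)) := by
        rw [hK1, Real.div_rpow hx.le (by norm_num), Real.rpow_neg (by norm_num : (0:ℝ) ≤ 2)]
        field_simp
      _ ≤ _ := by gcongr; linarith

/-- The second difference is symmetric, so it can be moved from ψ to the power x₊^b extended by zero
to the left. Homogeneity then normalises the point y to 1. -/
theorem setIntegral_rpow_mul_second_difference (h : IsBump m M ψ) {b t : ℝ} (hb : 0 < b)
    (ht : 0 < t) :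
    ∫ x in Ioi (0 : ℝ), x ^ b * (2 * ψ x - ψ (x + t) - ψ (x - t)) =
      ∫ y in Ioi (0 : ℝ), ψ y * (y ^ b * powDiff b (t / y)) := by
  have hc := h.continuous
  have hpc : Continuous fun x : ℝ => (max x 0) ^ b :=
    (continuous_id.max continuous_const).rpow_const fun _ => Or.inr hb.le
  have hint (f : ℝ → ℝ) (hf : Continuous f) : Integrable fun x => ψ x * f x :=
    (hc.mul hf).integrable_of_hasCompactSupport h.hasCompactSupport.mul_right
  have i1 := hint (fun x => (max x 0) ^ b) hpc
  have i2 := hint (fun x => (max (x - t) 0) ^ b) (hpc.comp (by fun_prop : Continuous (fun x => x - t)))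
  have i3 := hint (fun x => (max (x + t) 0) ^ b) (hpc.comp (by fun_prop : Continuous (fun x => x + t)))
  have j2 : Integrable fun x => ψ (x + t) * (max x 0) ^ b := by
    simpa using i2.comp_add_right t
  have j3 : Integrable fun x => ψ (x - t) * (max x 0) ^ b := by
    simpa using i3.comp_sub_right t
  have e1 : ∫ x in Ioi (0 : ℝ), x ^ b * (2 * ψ x - ψ (x + t) - ψ (x - t)) =
      ∫ x, (2 * (ψ x * (max x 0) ^ b) - ψ (x + t) * (max x 0) ^ b - ψ (x - t) * (max x 0) ^ b) := by
    symm
    rw [← setIntegral_eq_integral_of_forall_compl_eq_zero (s := Ioi 0)]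
    · refine setIntegral_congr_fun measurableSet_Ioi fun x hx => ?_
      have hx : 0 < x := hx
      rw [max_eq_left hx.le]
      ring
    · intro x hx
      rw [max_eq_right (not_lt.1 hx), Real.zero_rpow hb.ne']
      ring
  have e2 : ∫ x, ψ (x + t) * (max x 0) ^ b = ∫ x, ψ x * (max (x - t) 0) ^ b := by
    rw [← integral_add_right_eq_self (fun x => ψ x * (max (x - t) 0) ^ b) t]
    simp
  have e3 : ∫ x, ψ (x - t) * (max x 0) ^ b = ∫ x, ψ x * (max (x + t) 0) ^ b := by
    rw [← integral_sub_right_eq_self (fun x => ψ x * (max (x + t) 0) ^ b) t]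
    simp
  have k1 : Integrable fun x => 2 * (ψ x * (max x 0) ^ b) - ψ (x + t) * (max x 0) ^ b :=
    (i1.const_mul 2).sub j2
  have k2 : Integrable fun x => 2 * (ψ x * (max x 0) ^ b) - ψ x * (max (x - t) 0) ^ b :=
    (i1.const_mul 2).sub i2
  rw [e1, integral_sub k1 j3, integral_sub (i1.const_mul 2) j2,
    integral_const_mul, e2, e3, ← integral_const_mul, ← integral_sub (i1.const_mul 2) i2,
    ← integral_sub k2 i3]
  rw [← setIntegral_eq_integral_of_forall_compl_eq_zero (s := Ioi 0)]
  · refine setIntegral_congr_fun measurableSet_Ioi fun y hy => ?_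
    have hy : 0 < y := hy
    simp only [powDiff]
    have q1 : max (y - t) 0 = y * max (1 - t / y) 0 := by
      rw [mul_max_of_nonneg _ _ hy.le, mul_zero]
      congr 1
      field_simp
    have q2 : y + t = y * (1 + t / y) := by field_simp
    rw [max_eq_left hy.le, max_eq_left (by linarith : 0 ≤ y + t), q1, q2,
      Real.mul_rpow hy.le (le_max_right _ _), Real.mul_rpow hy.le (by positivity)]
    ring
  · intro x hx
    rw [h.zero x fun h' => hx (h.pos.trans h'.1)]
    ring

/-- By symmetry and homogeneity the operator sends x₊^b to a constant times y^(b-2s) on the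
half-line. Two exchanges of integrals make this rigorous; b < 2s gives convergence of the constant
at infinity. -/
theorem integral_rpow_mul_halfLaplacian (hs : 0 < s) (hs1 : s < 1) (h : IsBump m M ψ) {b : ℝ}
    (hb : 0 < b) (hb2 : b < 2 * s) :
    ∫ x in Ioi (0 : ℝ), x ^ b * halfLaplacian s ψ x =
      (∫ t in Ioi (0 : ℝ), powDiff b t * t ^ (-(1 + 2 * s))) *
        ∫ y in Ioi (0 : ℝ), ψ y * y ^ (b - 2 * s) := by
  have hc := h.continuous
  have hM : 0 < M := h.pos.trans h.lt
  have hmeas := hc.measurable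
  obtain ⟨K, hK, hbd⟩ := h.exists_second_difference_bound
  set μ := volume.restrict (Ioi (0 : ℝ)) with hμ
  -- first exchange of integrals
  have hF : Integrable (Function.uncurry fun x t : ℝ =>
      x ^ b * ((2 * ψ x - ψ (x + t) - ψ (x - t)) * t ^ (-(1 + 2 * s)))) (μ.prod μ) := by
    have hFm : AEStronglyMeasurable (Function.uncurry fun x t : ℝ =>
      x ^ b * ((2 * ψ x - ψ (x + t) - ψ (x - t)) * t ^ (-(1 + 2 * s)))) (μ.prod μ) := by
      refine Measurable.aestronglyMeasurable ?_
      fun_prop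
    have hsec : ∀ t : ℝ, 0 < t → IntegrableOn (fun x : ℝ => x ^ b *
        (2 * ψ x - ψ (x + t) - ψ (x - t))) (Ioc 0 (M + t)) := by
      intro t ht
      refine (ContinuousOn.integrableOn_Icc ?_).mono_set Ioc_subset_Icc_self
      exact (continuousOn_id.rpow_const fun _ _ => Or.inr hb.le).mul (by fun_prop)
    have hz : ∀ t : ℝ, 0 < t → ∀ x, x ∉ Ioc 0 (M + t) → 0 < x →
        2 * ψ x - ψ (x + t) - ψ (x - t) = 0 := by
      intro t ht x hx hx0
      have hx' : M + t < x := by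
        by_contra hcon
        exact hx ⟨hx0, not_lt.1 hcon⟩
      rw [h.zero x fun h' => absurd h'.2 (by linarith),
        h.zero (x + t) fun h' => absurd h'.2 (by linarith),
        h.zero (x - t) fun h' => absurd h'.2 (by linarith)]
      ring
    rw [integrable_prod_iff' hFm]
    constructor
    · refine (ae_restrict_mem measurableSet_Ioi).mono fun t ht => ?_
      have ht : 0 < t := ht
      have h0 : IntegrableOn (fun x : ℝ => x ^ b *
        (2 * ψ x - ψ (x + t) - ψ (x - t)) * t ^ (-(1 + 2 * s))) (Ioc 0 (M + t)) :=
        (hsec t ht).mul_const _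
      have := h0.of_forall_sdiff_eq_zero (t := Ioi 0) measurableSet_Ioi (fun x hx => by
          rw [hz t ht x hx.2 hx.1]; ring)
      refine this.congr_fun (fun x _ => ?_) measurableSet_Ioi
      simp only [Function.uncurry]
      ring
    -- For t ≤ 1 the second difference is O(t²) on an interval of length at most M + 1. For t > 1
    -- its L¹ norm is at most four times that of ψ, while the weight is at most (M + t)^b.
    · have hmaj : IntegrableOn (fun t : ℝ => (4 * (∫ x, |ψ x|) * (M + 1) ^ b +
          K * (M + 1) ^ (b + 1)) *
          if t ≤ 1 then t ^ (1 - 2 * s) else t ^ (b - (1 + 2 * s))) (Ioi 0) :=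
        (integrableOn_ite_rpow (by linarith) (by linarith)).const_mul _
      refine hmaj.mono' (hFm.norm.prod_swap.integral_prod_right') ?_
      refine (ae_restrict_mem measurableSet_Ioi).mono fun t ht => ?_
      have ht : 0 < t := ht
      have hI0 : 0 ≤ ∫ x, |ψ x| := integral_nonneg fun y => abs_nonneg _
      rw [Real.norm_of_nonneg (integral_nonneg fun _ => norm_nonneg _)]
      have e1 : ∫ x, ‖Function.uncurry (fun x t : ℝ =>
          x ^ b * ((2 * ψ x - ψ (x + t) - ψ (x - t)) * t ^ (-(1 + 2 * s)))) (x, t)‖ ∂μ =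
          (∫ x in Ioc 0 (M + t), x ^ b * |2 * ψ x - ψ (x + t) - ψ (x - t)|) *
            t ^ (-(1 + 2 * s)) := by
        rw [← integral_mul_const]
        refine (setIntegral_eq_of_subset_of_forall_sdiff_eq_zero measurableSet_Ioi
          (fun x hx => hx.1) (fun x hx => ?_)).trans
          (setIntegral_congr_fun measurableSet_Ioc fun x hx => ?_)
        · change ‖x ^ b * ((2 * ψ x - ψ (x + t) - ψ (x - t)) * t ^ (-(1 + 2 * s)))‖ = 0
          rw [hz t ht x hx.2 hx.1]; simp
        · change ‖x ^ b * ((2 * ψ x - ψ (x + t) - ψ (x - t)) * t ^ (-(1 + 2 * s)))‖ = _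
          rw [norm_mul, norm_mul, Real.norm_of_nonneg (Real.rpow_nonneg hx.1.le _),
            Real.norm_of_nonneg (Real.rpow_nonneg ht.le _), Real.norm_eq_abs]
          ring
      rw [e1]
      have hN0 : 0 ≤ ∫ x in Ioc 0 (M + t), x ^ b * |2 * ψ x - ψ (x + t) - ψ (x - t)| :=
        setIntegral_nonneg measurableSet_Ioc fun x hx =>
          mul_nonneg (Real.rpow_nonneg hx.1.le _) (abs_nonneg _)
      have hsec' := (hsec t ht).norm
      split_ifs with ht1
      · have hN : ∫ x in Ioc 0 (M + t), x ^ b * |2 * ψ x - ψ (x + t) - ψ (x - t)| ≤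
            K * (M + 1) ^ (b + 1) * t ^ 2 := by
          have : ∫ x in Ioc 0 (M + t), x ^ b * |2 * ψ x - ψ (x + t) - ψ (x - t)| ≤
              ∫ x in Ioc 0 (M + t), (M + 1) ^ b * (K * t ^ 2) := by
            refine integral_mono_of_nonneg ?_ (integrable_const _) ?_
            · exact (ae_restrict_mem measurableSet_Ioc).mono fun x hx =>
                mul_nonneg (Real.rpow_nonneg hx.1.le _) (abs_nonneg _)
            · refine (ae_restrict_mem measurableSet_Ioc).mono fun x hx => ?_
              exact mul_le_mul (Real.rpow_le_rpow hx.1.le (by linarith [hx.2]) hb.le)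
                (hbd x t ht.le).2 (abs_nonneg _) (by positivity)
          refine this.trans ?_
          rw [setIntegral_const, smul_eq_mul, Real.volume_real_Ioc_of_le (by linarith), sub_zero,
            Real.rpow_add (by linarith), Real.rpow_one]
          have : (M + t) * ((M + 1) ^ b * (K * t ^ 2)) ≤
              (M + 1) * ((M + 1) ^ b * (K * t ^ 2)) := by gcongr
          linarith
        rw [show 1 - 2 * s = 2 + (-(1 + 2 * s)) by ring, Real.rpow_add ht, ← mul_assoc,
          Real.rpow_two]
        gcongr
        refine hN.trans ?_
        gcongr
        linarith [show 0 ≤ 4 * (∫ x, |ψ x|) * (M + 1) ^ b by positivity]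
      · have ht1 : 1 < t := not_le.1 ht1
        have hN : ∫ x in Ioc 0 (M + t), x ^ b * |2 * ψ x - ψ (x + t) - ψ (x - t)| ≤
            4 * (∫ x, |ψ x|) * (M + 1) ^ b * t ^ b := by
          have i0 := h.integrable.abs
          have i2 := i0.comp_add_right t
          have i3 := i0.comp_sub_right t
          have : ∫ x in Ioc 0 (M + t), x ^ b * |2 * ψ x - ψ (x + t) - ψ (x - t)| ≤
              ∫ x in Ioc 0 (M + t), (M + t) ^ b * (2 * |ψ x| + |ψ (x + t)| + |ψ (x - t)|) := by
            refine integral_mono_of_nonneg ?_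
              (((((i0.const_mul 2).add i2).add i3).const_mul _).integrableOn) ?_
            · exact (ae_restrict_mem measurableSet_Ioc).mono fun x hx =>
                mul_nonneg (Real.rpow_nonneg hx.1.le _) (abs_nonneg _)
            · refine (ae_restrict_mem measurableSet_Ioc).mono fun x hx => ?_
              refine mul_le_mul (Real.rpow_le_rpow hx.1.le hx.2 hb.le) ?_ (abs_nonneg _)
                (Real.rpow_nonneg (by linarith) _)
              calc |2 * ψ x - ψ (x + t) - ψ (x - t)| ≤ |2 * ψ x - ψ (x + t)| + |ψ (x - t)| :=
                    abs_sub _ _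
                _ ≤ |2 * ψ x| + |ψ (x + t)| + |ψ (x - t)| := by
                    gcongr; exact abs_sub _ _
                _ = _ := by rw [abs_mul, abs_two]
          have h2 : ∫ x in Ioc 0 (M + t), (M + t) ^ b * (2 * |ψ x| + |ψ (x + t)| + |ψ (x - t)|) ≤
              ∫ x, (M + t) ^ b * (2 * |ψ x| + |ψ (x + t)| + |ψ (x - t)|) := by
            refine setIntegral_le_integral (((((i0.const_mul 2).add i2).add i3).const_mul _))
              (Eventually.of_forall fun x => ?_)
            have : 0 ≤ (M + t) ^ b := Real.rpow_nonneg (by linarith) _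
            change 0 ≤ (M + t) ^ b * (2 * |ψ x| + |ψ (x + t)| + |ψ (x - t)|)
            positivity
          have h3 : ∫ x, (M + t) ^ b * (2 * |ψ x| + |ψ (x + t)| + |ψ (x - t)|) =
              (M + t) ^ b * (4 * ∫ x, |ψ x|) := by
            have i12 : Integrable fun x => 2 * |ψ x| + |ψ (x + t)| := (i0.const_mul 2).add i2
            rw [integral_const_mul, integral_add i12 i3,
              integral_add (i0.const_mul 2) i2, integral_const_mul,
              integral_add_right_eq_self (fun x => |ψ x|) t,
              integral_sub_right_eq_self (fun x => |ψ x|) t]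
            ring
          have h4 : (M + t) ^ b ≤ (M + 1) ^ b * t ^ b := by
            rw [← Real.mul_rpow (by linarith) ht.le]
            exact Real.rpow_le_rpow (by linarith) (by nlinarith) hb.le
          calc _ ≤ _ := this
            _ ≤ _ := h2
            _ = _ := h3
            _ ≤ (M + 1) ^ b * t ^ b * (4 * ∫ x, |ψ x|) := by gcongr
            _ = _ := by ring
        rw [show b - (1 + 2 * s) = b + (-(1 + 2 * s)) by ring, Real.rpow_add ht, ← mul_assoc]
        gcongr
        refine hN.trans ?_
        gcongr
        linarith [show 0 ≤ K * (M + 1) ^ (b + 1) by positivity]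
  -- second exchange
  set W : ℝ → ℝ := fun k => powDiff b k * k ^ (-(1 + 2 * s)) with hW
  have hWint : IntegrableOn W (Ioi 0) := by
    have := mellin_convergent_of_isBigO_scalar (f := powDiff b) (a := -b) (b := -2)
      (s := -(2 * s)) ((continuousOn_powDiff hb).locallyIntegrableOn measurableSet_Ioi)
      (isBigO_powDiff_atTop hb) (by linarith) (isBigO_powDiff_zero b) (by linarith)
    refine this.congr_fun (fun t _ => ?_) measurableSet_Ioi
    simp only [hW]
    rw [mul_comm, show -(2 * s) - 1 = -(1 + 2 * s) by ring]
  -- Homogeneity of the kernel: in the variable t/y the dependence on y separates, so the inner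
  -- integral is the same constant for every y.
  have hscale : ∀ t y : ℝ, 0 < t → 0 < y →
      t ^ (-(1 + 2 * s)) * (ψ y * (y ^ b * powDiff b (t / y))) =
        ψ y * y ^ (b - (1 + 2 * s)) * W (y⁻¹ * t) := by
    intro t y ht hy
    simp only [hW]
    rw [show t / y = y⁻¹ * t by field_simp, Real.mul_rpow (by positivity) ht.le,
      show b - (1 + 2 * s) = b + -(1 + 2 * s) by ring, Real.rpow_add hy,
      Real.inv_rpow hy.le]
    have : y ^ (-(1 + 2 * s)) ≠ 0 := (Real.rpow_pos_of_pos hy _).ne'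
    field_simp
  have hG : Integrable (Function.uncurry fun t y : ℝ =>
      t ^ (-(1 + 2 * s)) * (ψ y * (y ^ b * powDiff b (t / y)))) (μ.prod μ) := by
    have hGm : AEStronglyMeasurable (Function.uncurry fun t y : ℝ =>
      t ^ (-(1 + 2 * s)) * (ψ y * (y ^ b * powDiff b (t / y)))) (μ.prod μ) := by
      refine Measurable.aestronglyMeasurable ?_
      unfold powDiff
      fun_prop
    rw [integrable_prod_iff' hGm]
    constructor
    · refine (ae_restrict_mem measurableSet_Ioi).mono fun y hy => ?_
      have hy : 0 < y := hy
      have : IntegrableOn (fun t => ψ y * y ^ (b - (1 + 2 * s)) * W (y⁻¹ * t)) (Ioi 0) :=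
        ((integrableOn_Ioi_comp_mul_left_iff W 0 (inv_pos.2 hy)).2 (by simpa using hWint)).const_mul _
      refine this.congr_fun (fun t ht => ?_) measurableSet_Ioi
      simp only [Function.uncurry]
      rw [hscale t y ht hy]
    · have hi : IntegrableOn (fun y => ψ y • (y ^ (b - 2 * s))) (Ioi 0) :=
        h.integrableOn_smul (continuousOn_id.rpow_const fun y hy => Or.inl (by
          have := h.pos.trans_le hy.1
          exact this.ne')) _
      have hi' : IntegrableOn (fun y => ‖ψ y • (y ^ (b - 2 * s))‖ * ∫ k in Ioi 0, ‖W k‖) (Ioi 0) :=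
        hi.norm.mul_const _
      refine hi'.congr_fun (fun y hy => ?_) measurableSet_Ioi
      have hy : 0 < y := hy
      simp only [Function.uncurry]
      have e1 : ∫ t, ‖t ^ (-(1 + 2 * s)) * (ψ y * (y ^ b * powDiff b (t / y)))‖ ∂μ =
          ∫ t in Ioi (0 : ℝ), ‖ψ y * y ^ (b - (1 + 2 * s))‖ * ‖W (y⁻¹ * t)‖ :=
        setIntegral_congr_fun measurableSet_Ioi fun t ht => by
          rw [hscale t y ht hy, norm_mul]
      rw [e1, integral_const_mul, integral_comp_mul_left_Ioi (fun k => ‖W k‖) 0 (inv_pos.2 hy),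
        mul_zero, inv_inv, smul_eq_mul, smul_eq_mul, norm_mul, norm_mul,
        show b - 2 * s = b - (1 + 2 * s) + 1 by ring, Real.rpow_add hy, Real.rpow_one, norm_mul,
        Real.norm_of_nonneg hy.le]
      ring
  calc ∫ x in Ioi (0 : ℝ), x ^ b * halfLaplacian s ψ x
      = ∫ x, ∫ t, x ^ b * ((2 * ψ x - ψ (x + t) - ψ (x - t)) * t ^ (-(1 + 2 * s))) ∂μ ∂μ := by
        simp only [halfLaplacian, ← integral_const_mul, hμ]
    _ = ∫ t, ∫ x, x ^ b * ((2 * ψ x - ψ (x + t) - ψ (x - t)) * t ^ (-(1 + 2 * s))) ∂μ ∂μ :=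
        integral_integral_swap hF
    _ = ∫ t, ∫ y, t ^ (-(1 + 2 * s)) * (ψ y * (y ^ b * powDiff b (t / y))) ∂μ ∂μ := by
        refine setIntegral_congr_fun measurableSet_Ioi fun t ht => ?_
        rw [integral_const_mul, ← setIntegral_rpow_mul_second_difference h hb ht,
          ← integral_const_mul]
        congr 1
        funext x
        ring
    _ = ∫ y, ∫ t, t ^ (-(1 + 2 * s)) * (ψ y * (y ^ b * powDiff b (t / y))) ∂μ ∂μ :=
        integral_integral_swap hG
    _ = ∫ y, (∫ k, W k ∂μ) * (ψ y * y ^ (b - 2 * s)) ∂μ := by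
        refine setIntegral_congr_fun measurableSet_Ioi fun y hy => ?_
        have hy : 0 < y := hy
        have e1 : ∫ t, t ^ (-(1 + 2 * s)) * (ψ y * (y ^ b * powDiff b (t / y))) ∂μ =
          ∫ t in Ioi (0 : ℝ), (ψ y * y ^ (b - (1 + 2 * s))) * W (y⁻¹ * t) :=
          setIntegral_congr_fun measurableSet_Ioi fun t ht => hscale t y ht hy
        rw [e1, integral_const_mul, integral_comp_mul_left_Ioi W 0 (inv_pos.2 hy),
          mul_zero, inv_inv, smul_eq_mul,
          show b - 2 * s = b - (1 + 2 * s) + 1 by ring, Real.rpow_add hy, Real.rpow_one]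
        ring
    _ = _ := integral_const_mul _ _

end HalfLap

/-- The Beta factor common to the transforms of the kernels. -/
noncomputable def betaFactor (s : ℝ) (β : ℂ) : ℂ :=
  Complex.Gamma (β + 1) * Complex.Gamma (2 * s + 1 - β) / Complex.Gamma (2 * s + 1)

theorem Complex.differentiableAt_Gamma_of_re_pos {w : ℂ} (hw : 0 < w.re) :
    DifferentiableAt ℂ Complex.Gamma w :=
  Complex.differentiableAt_Gamma _ fun m h => by
    rw [h] at hw
    simp only [Complex.neg_re, Complex.natCast_re] at hw
    have : (0 : ℝ) ≤ m := Nat.cast_nonneg m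
    linarith

theorem differentiableAt_betaFactor {s : ℝ} {β : ℂ} (h1 : -1 < β.re) (h2 : β.re < 2 * s + 1) :
    DifferentiableAt ℂ (betaFactor s) β := by
  have d1 : DifferentiableAt ℂ (fun β : ℂ => Complex.Gamma (β + 1)) β :=
    (Complex.differentiableAt_Gamma_of_re_pos (w := β + 1) (by simp; linarith)).comp β
      (by fun_prop)
  have d2 : DifferentiableAt ℂ (fun β : ℂ => Complex.Gamma (2 * s + 1 - β)) β :=
    (Complex.differentiableAt_Gamma_of_re_pos (w := 2 * s + 1 - β) (by simp; linarith)).comp β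
      (by fun_prop)
  exact (d1.mul d2).div_const _

section

variable {s m M : ℝ} {φ : ℝ → ℝ}

/-- The constant is `mellin_powDiff` at z = -2s, which contains Γ(2s-b). The derivative on φ
contributes the factor 2s-b that completes it to Γ(2s+1-b). -/
theorem mellin_halfLaplacian_ofReal (hs : 0 < s) (hs1 : s < 1) (h : IsBump m M φ) {b : ℝ}
    (hb : 0 < b) (hb1 : b < 1) (hb2 : b < 2 * s) :
    mellin (fun x => ((halfLaplacian s (deriv φ) x : ℝ) : ℂ)) (b + 1) =
      -(betaFactor s b * (Complex.sin (Real.pi * (b - s)) / Complex.sin (Real.pi * s))) *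
        mellin (fun y => ((φ y : ℝ) : ℂ)) (b - 2 * s) := by
  have e1 : mellin (fun x => ((halfLaplacian s (deriv φ) x : ℝ) : ℂ)) (b + 1) =
      ((∫ x in Ioi (0 : ℝ), x ^ b * halfLaplacian s (deriv φ) x : ℝ) : ℂ) := by
    rw [mellin, ← integral_complex_ofReal]
    refine setIntegral_congr_fun measurableSet_Ioi fun x hx => ?_
    have hx : 0 < x := hx
    simp only [add_sub_cancel_right, smul_eq_mul]
    rw [Complex.ofReal_mul, Complex.ofReal_cpow hx.le]
  have e2 : ((∫ t in Ioi (0 : ℝ), powDiff b t * t ^ (-(1 + 2 * s)) : ℝ) : ℂ) =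
      mellin (fun h : ℝ => ((powDiff b h : ℝ) : ℂ)) ((-(2 * s) : ℝ) : ℂ) := by
    rw [mellin, ← integral_complex_ofReal]
    refine setIntegral_congr_fun measurableSet_Ioi fun x hx => ?_
    have hx : 0 < x := hx
    simp only [smul_eq_mul]
    rw [Complex.ofReal_mul, Complex.ofReal_cpow hx.le, mul_comm]
    congr 2
    push_cast
    ring
  have e3 : ((∫ y in Ioi (0 : ℝ), deriv φ y * y ^ (b - 2 * s) : ℝ) : ℂ) =
      mellin (fun y => ((deriv φ y : ℝ) : ℂ)) ((b - 2 * s : ℂ) + 1) := by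
    rw [mellin, ← integral_complex_ofReal]
    refine setIntegral_congr_fun measurableSet_Ioi fun x hx => ?_
    have hx : 0 < x := hx
    simp only [add_sub_cancel_right, smul_eq_mul]
    rw [Complex.ofReal_mul, Complex.ofReal_cpow hx.le, mul_comm]
    push_cast
    rfl
  rw [e1, integral_rpow_mul_halfLaplacian hs hs1 h.derivative hb hb2, Complex.ofReal_mul, e2, e3,
    h.mellin_deriv, mellin_powDiff hb hb1 (by simp; linarith) (by simpa using hb2), betaFactor]
  have g0 : (2 * s - b : ℂ) ≠ 0 := by
    intro h0
    have : (2 * s - b : ℝ) = 0 := by exact_mod_cast h0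
    linarith
  rw [show (2 * s + 1 - b : ℂ) = 2 * s - b + 1 by ring, Complex.Gamma_add_one _ g0,
    show (-((-(2 * s) : ℝ) : ℂ) - b) = 2 * s - b by push_cast; ring,
    show (1 - ((-(2 * s) : ℝ) : ℂ)) = 2 * s + 1 by push_cast; ring,
    show (Real.pi * (((-(2 * s) : ℝ) : ℂ) / 2)) = -(Real.pi * s) by push_cast; ring,
    show (Real.pi * (b + ((-(2 * s) : ℝ) : ℂ) / 2)) = Real.pi * (b - s) by push_cast; ring,
    Complex.sin_neg, div_neg]
  ring

/-- Both sides are holomorphic for -1 < Re β < 2s+1, the left one by the decay in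
`halfLaplacian_bound`. They agree on a real interval, so the identity theorem applies. -/
theorem mellin_halfLaplacian (hs : 0 < s) (hs1 : s < 1) (h : IsBump m M φ) {β : ℂ}
    (h1 : -1 < β.re) (h2 : β.re < 2 * s + 1) :
    mellin (fun x => ((halfLaplacian s (deriv φ) x : ℝ) : ℂ)) (β + 1) =
      -(betaFactor s β * (Complex.sin (Real.pi * (β - s)) / Complex.sin (Real.pi * s))) *
        mellin (fun y => ((φ y : ℝ) : ℂ)) (β - 2 * s) := by
  set U : Set ℂ := Complex.re ⁻¹' Ioo (-1) (2 * s + 1) with hU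
  have hUo : IsOpen U := isOpen_Ioo.preimage Complex.continuous_re
  have hUc : IsPreconnected U :=
    ((convex_Ioo (-1) (2 * s + 1)).linear_preimage Complex.reLm).isPreconnected
  obtain ⟨K, hK, hb⟩ := halfLaplacian_bound hs hs1 h
  have hcont := (h.derivative.continuous_halfLaplacian hs hs1).1
  have hl : DifferentiableOn ℂ (fun β =>
      mellin (fun x => ((halfLaplacian s (deriv φ) x : ℝ) : ℂ)) (β + 1)) U := by
    intro z hz
    refine DifferentiableAt.differentiableWithinAt ?_
    refine DifferentiableAt.comp (f := fun β : ℂ => β + 1)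
      (g := mellin (fun x => ((halfLaplacian s (deriv φ) x : ℝ) : ℂ))) z
      (mellin_differentiableAt_of_isBigO_rpow (s := z + 1) (a := 2 + 2 * s) (b := 0)
      hcont.continuousOn.locallyIntegrableOn_ofReal (Complex.isBigO_ofReal_left.2 ?_) ?_
      (Complex.isBigO_ofReal_left.2 ?_) ?_) (by fun_prop)
    · refine IsBigO.of_bound K ?_
      filter_upwards [eventually_gt_atTop 0] with x hx
      rw [Real.norm_eq_abs, Real.norm_of_nonneg (by positivity)]
      exact (hb x hx).2
    · have := hz.2
      simp only [Complex.add_re, Complex.one_re]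
      linarith
    · refine IsBigO.of_bound K ?_
      filter_upwards [self_mem_nhdsWithin] with x hx
      simpa using (hb x hx).1
    · have : -1 < z.re := hz.1
      simp only [Complex.add_re, Complex.one_re]
      linarith
  have hr : DifferentiableOn ℂ (fun β : ℂ =>
      -(betaFactor s β * (Complex.sin (Real.pi * (β - s)) / Complex.sin (Real.pi * s))) *
        mellin (fun y => ((φ y : ℝ) : ℂ)) (β - 2 * s)) U := by
    intro z hz
    refine DifferentiableAt.differentiableWithinAt ?_
    refine ((differentiableAt_betaFactor hz.1 hz.2).mul ?_).neg.mul ?_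
    · exact DifferentiableAt.div_const (by fun_prop) _
    · exact (h.differentiable_mellin _).comp z (by fun_prop)
  -- The midpoint of (0, min(1, 2s)), the interval on which the formula is already known.
  set b0 : ℝ := min 1 (2 * s) / 2 with hb0
  have hmin : 0 < min 1 (2 * s) := lt_min one_pos (by linarith)
  have hb00 : 0 < b0 := by positivity
  have hb0m : b0 < min 1 (2 * s) := by linarith
  have hmem : (b0 : ℂ) ∈ U := by
    simp only [hU, mem_preimage, Complex.ofReal_re, mem_Ioo]
    have := hb0m.trans_le (min_le_right _ _)
    constructor <;> linarith
  refine (hl.analyticOnNhd hUo).eqOn_of_preconnected_of_frequently_eq (hr.analyticOnNhd hUo)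
    hUc hmem ?_ ⟨h1, h2⟩
  have ht : Tendsto (fun b : ℝ => (b : ℂ)) (𝓝[≠] b0) (𝓝[≠] (b0 : ℂ)) := by
    refine tendsto_nhdsWithin_iff.2 ⟨(Complex.continuous_ofReal.tendsto b0).mono_left
      nhdsWithin_le_nhds, ?_⟩
    filter_upwards [self_mem_nhdsWithin] with b hb'
    simpa using hb'
  refine ht.frequently (Eventually.frequently ?_)
  filter_upwards [nhdsWithin_le_nhds (Ioo_mem_nhds hb00 hb0m)] with b hb'
  exact mellin_halfLaplacian_ofReal hs hs1 h hb'.1 (hb'.2.trans_le (min_le_left _ _))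
    (hb'.2.trans_le (min_le_right _ _))

end

/-! ### Correlation and convolution in the logarithmic variable -/

theorem Real.exp_image_univ : Real.exp '' univ = Ioi 0 := by
  rw [image_univ, Real.range_exp]

theorem setIntegral_Ioi_eq_integral_exp {E : Type*} [NormedAddCommGroup E] [NormedSpace ℝ E]
    (F : ℝ → E) : ∫ x in Ioi (0 : ℝ), F x = ∫ t, Real.exp t • F (Real.exp t) := by
  rw [← Real.exp_image_univ, integral_image_eq_integral_abs_deriv_smul MeasurableSet.univ
    (fun t _ => (Real.hasDerivAt_exp t).hasDerivWithinAt) Real.exp_injective.injOn,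
    setIntegral_univ]
  simp [abs_of_pos (Real.exp_pos _)]

theorem integrableOn_Ioi_iff_integrable_exp {E : Type*} [NormedAddCommGroup E] [NormedSpace ℝ E]
    (F : ℝ → E) : IntegrableOn F (Ioi 0) ↔ Integrable fun t => Real.exp t • F (Real.exp t) := by
  rw [← Real.exp_image_univ, integrableOn_image_iff_integrableOn_abs_deriv_smul MeasurableSet.univ
    (fun t _ => (Real.hasDerivAt_exp t).hasDerivWithinAt) Real.exp_injective.injOn,
    integrableOn_univ]
  simp [abs_of_pos (Real.exp_pos _)]

/-- Bilateral Laplace transform. -/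
noncomputable def expTransform (k : ℝ → ℂ) (β : ℂ) : ℂ := ∫ t : ℝ, Complex.exp (β * t) * k t

/-- A function on the half-line as a convolution kernel in the logarithmic variable. -/
noncomputable def logKernel (P : ℝ → ℝ) (t : ℝ) : ℂ := ((Real.exp t * P (Real.exp t) : ℝ) : ℂ)

theorem expTransform_logKernel (P : ℝ → ℝ) (β : ℂ) :
    expTransform (logKernel P) β = mellin (fun x => ((P x : ℝ) : ℂ)) (β + 1) := by
  rw [mellin, setIntegral_Ioi_eq_integral_exp, expTransform]
  congr 1
  funext t
  rw [add_sub_cancel_right, logKernel, smul_eq_mul, Complex.real_smul, Complex.cpow_def_of_ne_zero (by exact_mod_cast (Real.exp_pos t).ne'),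
    ← Complex.ofReal_log (Real.exp_pos t).le, Real.log_exp, Complex.ofReal_mul]
  ring_nf

/-- Correlation of `v` with the kernel `k`. -/
noncomputable def corr (v k : ℝ → ℂ) (σ : ℝ) : ℂ := ∫ τ, v τ * k (τ - σ)

/-- Convolution of kernels. -/
noncomputable def kconv (k₁ k₂ : ℝ → ℂ) (t : ℝ) : ℂ := ∫ r, k₁ (t - r) * k₂ r

/-- Integrability against the exponential weight `exp (c t)`. -/
def ExpIntegrable (k : ℝ → ℂ) (c : ℝ) : Prop := Integrable fun t => (Real.exp (c * t) : ℂ) * k t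

theorem ExpIntegrable.aestronglyMeasurable {k : ℝ → ℂ} {c : ℝ} (h : ExpIntegrable k c) :
    AEStronglyMeasurable k := by
  have h1 : AEStronglyMeasurable (fun t : ℝ => ((Real.exp (-(c * t)) : ℝ) : ℂ)) volume :=
    Continuous.aestronglyMeasurable (by fun_prop)
  refine (h1.mul h.1).congr (Eventually.of_forall fun t => ?_)
  simp only [Pi.mul_apply]
  rw [← mul_assoc, ← Complex.ofReal_mul, ← Real.exp_add]
  simp

theorem corr_kconv_of_integrable {v k₁ k₂ : ℝ → ℂ} {ρ : ℝ}
    (h : Integrable (Function.uncurry fun σ τ : ℝ => v τ * k₁ (τ - σ) * k₂ (σ - ρ))) :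
    ∫ σ, corr v k₁ σ * k₂ (σ - ρ) = corr v (kconv k₁ k₂) ρ := by
  calc ∫ σ, corr v k₁ σ * k₂ (σ - ρ)
      = ∫ σ, ∫ τ, v τ * k₁ (τ - σ) * k₂ (σ - ρ) := by
        simp only [corr, integral_mul_const]
    _ = ∫ τ, ∫ σ, v τ * k₁ (τ - σ) * k₂ (σ - ρ) := integral_integral_swap h
    _ = corr v (kconv k₁ k₂) ρ := by
        rw [corr]
        congr 1
        funext τ
        rw [kconv, ← integral_const_mul,
          ← integral_sub_right_eq_self (fun r => v τ * (k₁ (τ - ρ - r) * k₂ r)) ρ]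
        congr 1
        funext σ
        rw [show τ - ρ - (σ - ρ) = τ - σ by ring]
        ring

theorem integrable_convolution_integrand {f g : ℝ → ℂ} (hf : Integrable f) (hg : Integrable g) :
    Integrable (Function.uncurry fun x y : ℝ => f y * g (x - y)) :=
  hf.convolution_integrand (ContinuousLinearMap.mul ℝ ℂ) hg

theorem aestronglyMeasurable_corr_integrand {v k₁ k₂ : ℝ → ℂ} (ρ : ℝ)
    (hv : AEStronglyMeasurable v) (h1 : AEStronglyMeasurable k₁) (h2 : AEStronglyMeasurable k₂) :
    AEStronglyMeasurable (Function.uncurry fun σ τ : ℝ => v τ * k₁ (τ - σ) * k₂ (σ - ρ))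
      (volume.prod volume) := by
  have e1 : AEStronglyMeasurable (fun p : ℝ × ℝ => v p.2) (volume.prod volume) := hv.comp_snd
  have e2 : AEStronglyMeasurable (fun p : ℝ × ℝ => k₁ (p.2 - p.1)) (volume.prod volume) :=
    h1.comp_quasiMeasurePreserving ((quasiMeasurePreserving_sub volume volume).comp
      Measure.measurePreserving_swap.quasiMeasurePreserving)
  have e3 : AEStronglyMeasurable (fun p : ℝ × ℝ => k₂ (p.1 - ρ)) (volume.prod volume) :=
    (h2.comp_measurePreserving (measurePreserving_sub_right volume ρ)).comp_fst
  exact (e1.mul e2).mul e3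

/-- The weight e^(cτ) splits as e^(cρ) e^(c(σ-ρ)) e^(c(τ-σ)), so each exponential in the bound on v
is distributed over the two kernels and leaves a convolution of integrable functions. -/
theorem integrable_corr_of_expIntegrable {v k₁ k₂ : ℝ → ℂ} {p q C : ℝ} (ρ : ℝ)
    (hv : AEStronglyMeasurable v)
    (hvb : ∀ τ, ‖v τ‖ ≤ C * (Real.exp (p * τ) + Real.exp (q * τ)))
    (h1p : ExpIntegrable k₁ p) (h1q : ExpIntegrable k₁ q)
    (h2p : ExpIntegrable k₂ p) (h2q : ExpIntegrable k₂ q) :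
    Integrable (Function.uncurry fun σ τ : ℝ => v τ * k₁ (τ - σ) * k₂ (σ - ρ)) := by
  have aux (c : ℝ) (h1 : ExpIntegrable k₁ c) (h2 : ExpIntegrable k₂ c) :
      Integrable (fun z : ℝ × ℝ => C * Real.exp (c * ρ) *
        (‖(Real.exp (c * (z.1 - ρ)) : ℂ) * k₂ (z.1 - ρ)‖ *
          ‖(Real.exp (c * (z.2 - z.1)) : ℂ) * k₁ (z.2 - z.1)‖)) (volume.prod volume) := by
    have h2' : Integrable fun σ : ℝ => (Real.exp (c * (σ - ρ)) : ℂ) * k₂ (σ - ρ) :=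
      h2.comp_sub_right ρ
    have := ((integrable_convolution_integrand h2' h1).swap).norm.const_mul (C * Real.exp (c * ρ))
    refine this.congr (Eventually.of_forall ?_)
    rintro ⟨σ, τ⟩
    simp [Function.uncurry]
  refine ((aux p h1p h2p).add (aux q h1q h2q)).mono'
    (aestronglyMeasurable_corr_integrand ρ hv h1p.aestronglyMeasurable h2p.aestronglyMeasurable)
    (Eventually.of_forall ?_)
  rintro ⟨σ, τ⟩
  have e (c : ℝ) : Real.exp (c * τ) =
      Real.exp (c * ρ) * (Real.exp (c * (σ - ρ)) * Real.exp (c * (τ - σ))) := by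
    rw [← Real.exp_add, ← Real.exp_add]; congr 1; ring
  change ‖v τ * k₁ (τ - σ) * k₂ (σ - ρ)‖ ≤ _
  simp only [Pi.add_apply]
  rw [norm_mul, norm_mul, norm_mul, norm_mul, norm_mul, norm_mul, Complex.norm_real,
    Complex.norm_real, Complex.norm_real, Complex.norm_real, Real.norm_of_nonneg (Real.exp_pos _).le,
    Real.norm_of_nonneg (Real.exp_pos _).le, Real.norm_of_nonneg (Real.exp_pos _).le,
    Real.norm_of_nonneg (Real.exp_pos _).le]
  calc ‖v τ‖ * ‖k₁ (τ - σ)‖ * ‖k₂ (σ - ρ)‖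
      ≤ (C * (Real.exp (p * τ) + Real.exp (q * τ))) * ‖k₁ (τ - σ)‖ * ‖k₂ (σ - ρ)‖ := by
        gcongr; exact hvb τ
    _ = _ := by rw [e p, e q]; ring

/-- The weight `min (exp (-a₀ τ)) (exp (-a₁ τ))`. -/
noncomputable def minWeight (a₀ a₁ τ : ℝ) : ℝ := min (Real.exp (-a₀ * τ)) (Real.exp (-a₁ * τ))

theorem continuous_minWeight (a₀ a₁ : ℝ) : Continuous (minWeight a₀ a₁) := by
  unfold minWeight; fun_prop

theorem minWeight_pos (a₀ a₁ τ : ℝ) : 0 < minWeight a₀ a₁ τ :=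
  lt_min (Real.exp_pos _) (Real.exp_pos _)

/-- Whichever exponential attains the minimum at τ also bounds the weight at σ, at the cost of its
own factor e^(a₀(τ-σ)) or e^(a₁(τ-σ)). -/
theorem minWeight_le_mul (a₀ a₁ τ σ : ℝ) :
    minWeight a₀ a₁ σ ≤
      minWeight a₀ a₁ τ * (Real.exp (a₀ * (τ - σ)) + Real.exp (a₁ * (τ - σ))) := by
  have e (c : ℝ) : Real.exp (-c * σ) = Real.exp (-c * τ) * Real.exp (c * (τ - σ)) := by
    rw [← Real.exp_add]; congr 1; ring
  rcases min_choice (Real.exp (-a₀ * τ)) (Real.exp (-a₁ * τ)) with h | h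
  · rw [minWeight, minWeight, h]
    refine (min_le_left _ _).trans ?_
    rw [e a₀]
    gcongr
    linarith [Real.exp_pos (a₁ * (τ - σ))]
  · rw [minWeight, minWeight, h]
    refine (min_le_right _ _).trans ?_
    rw [e a₁]
    gcongr
    linarith [Real.exp_pos (a₀ * (τ - σ))]

/-- A version for a kernel θ decaying like the minimum of two exponentials, where v is only
integrable against that minimum. The exponential factors lost in comparing weights are absorbed by
k. -/
theorem integrable_corr_of_minWeight {v k θ : ℝ → ℂ} {a₀ a₁ C : ℝ} (ρ : ℝ)
    (hv : Integrable fun τ => v τ * (minWeight a₀ a₁ τ : ℂ))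
    (hvm : AEStronglyMeasurable v)
    (hk0 : ExpIntegrable k a₀) (hk1 : ExpIntegrable k a₁)
    (hθm : AEStronglyMeasurable θ) (hθ : ∀ t, ‖θ t‖ ≤ C * minWeight a₀ a₁ t) :
    Integrable (Function.uncurry fun σ τ : ℝ => v τ * k (τ - σ) * θ (σ - ρ)) := by
  have hk (c : ℝ) (hk : ExpIntegrable k c) :
      Integrable fun r => (Real.exp (c * -r) : ℂ) * k (-r) := hk.comp_neg
  have hC : 0 ≤ C := by
    have h0 := (norm_nonneg _).trans (hθ 0)
    exact nonneg_of_mul_nonneg_left h0 (minWeight_pos _ _ _)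
  have aux (c : ℝ) (h1 : ExpIntegrable k c) :
      Integrable (fun z : ℝ × ℝ => C * (Real.exp (a₀ * ρ) + Real.exp (a₁ * ρ)) *
        (‖v z.2 * (minWeight a₀ a₁ z.2 : ℂ)‖ *
          ‖(Real.exp (c * (z.2 - z.1)) : ℂ) * k (z.2 - z.1)‖)) (volume.prod volume) := by
    have := (integrable_convolution_integrand hv (hk c h1)).norm.const_mul
      (C * (Real.exp (a₀ * ρ) + Real.exp (a₁ * ρ)))
    refine this.congr (Eventually.of_forall ?_)
    rintro ⟨σ, τ⟩
    simp [Function.uncurry]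
  refine ((aux a₀ hk0).add (aux a₁ hk1)).mono'
    (aestronglyMeasurable_corr_integrand ρ hvm hk0.aestronglyMeasurable hθm)
    (Eventually.of_forall ?_)
  rintro ⟨σ, τ⟩
  change ‖v τ * k (τ - σ) * θ (σ - ρ)‖ ≤ _
  simp only [Pi.add_apply]
  rw [norm_mul, norm_mul, norm_mul, norm_mul, norm_mul, Complex.norm_real,
    Complex.norm_real, Complex.norm_real, Real.norm_of_nonneg (Real.exp_pos _).le,
    Real.norm_of_nonneg (Real.exp_pos _).le, Real.norm_of_nonneg (minWeight_pos _ _ _).le]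
  -- The weight is moved in two stages, from σ - ρ to σ and from σ to τ.
  have hb1 : ‖θ (σ - ρ)‖ ≤ C * (minWeight a₀ a₁ τ * (Real.exp (a₀ * (τ - σ)) +
      Real.exp (a₁ * (τ - σ))) * (Real.exp (a₀ * ρ) + Real.exp (a₁ * ρ))) := by
    refine (hθ _).trans (mul_le_mul_of_nonneg_left ?_ hC)
    have h1 := minWeight_le_mul a₀ a₁ σ (σ - ρ)
    rw [sub_sub_cancel] at h1
    refine h1.trans ?_
    exact mul_le_mul_of_nonneg_right (minWeight_le_mul a₀ a₁ τ σ) (by positivity)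
  calc ‖v τ‖ * ‖k (τ - σ)‖ * ‖θ (σ - ρ)‖ ≤ ‖v τ‖ * ‖k (τ - σ)‖ *
        (C * (minWeight a₀ a₁ τ * (Real.exp (a₀ * (τ - σ)) +
      Real.exp (a₁ * (τ - σ))) * (Real.exp (a₀ * ρ) + Real.exp (a₁ * ρ)))) := by gcongr
    _ = _ := by ring

theorem kconv_weight (k₁ k₂ : ℝ → ℂ) (β : ℂ) (t : ℝ) :
    Complex.exp (β * t) * kconv k₁ k₂ t =
      ∫ r : ℝ, (Complex.exp (β * r) * k₂ r) * (Complex.exp (β * ((t - r : ℝ) : ℂ)) * k₁ (t - r)) := by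
  rw [kconv, ← integral_const_mul]
  congr 1
  funext r
  have : Complex.exp (β * t) = Complex.exp (β * r) * Complex.exp (β * ((t - r : ℝ) : ℂ)) := by
    rw [← Complex.exp_add]; congr 1; push_cast; ring
  rw [this]
  ring

theorem expIntegrable_iff_cexp {k : ℝ → ℂ} (β : ℂ) (hk : AEStronglyMeasurable k) :
    ExpIntegrable k β.re ↔ Integrable fun t : ℝ => Complex.exp (β * t) * k t := by
  rw [ExpIntegrable, ← integrable_norm_iff, ← integrable_norm_iff (f := fun t : ℝ =>
    Complex.exp (β * t) * k t)]
  · refine integrable_congr (Eventually.of_forall fun t => ?_)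
    simp only [norm_mul, Complex.norm_exp, Complex.norm_real,
      Real.norm_of_nonneg (Real.exp_pos _).le]
    simp
  · exact (Continuous.aestronglyMeasurable (by fun_prop)).mul hk
  · exact (Continuous.aestronglyMeasurable (by fun_prop)).mul hk

theorem ExpIntegrable.cexp {k : ℝ → ℂ} {β : ℂ} (h : ExpIntegrable k β.re) :
    Integrable fun t : ℝ => Complex.exp (β * t) * k t :=
  (expIntegrable_iff_cexp β h.aestronglyMeasurable).1 h

theorem expTransform_kconv {k₁ k₂ : ℝ → ℂ} {β : ℂ} (h1 : ExpIntegrable k₁ β.re)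
    (h2 : ExpIntegrable k₂ β.re) :
    expTransform (kconv k₁ k₂) β = expTransform k₁ β * expTransform k₂ β := by
  have := integral_convolution (ContinuousLinearMap.mul ℝ ℂ) (μ := volume) (ν := volume) h2.cexp h1.cexp
  rw [expTransform, expTransform, expTransform, mul_comm]
  refine Eq.trans ?_ this
  congr 1
  funext t
  rw [kconv_weight]
  rfl

theorem ExpIntegrable.kconv {k₁ k₂ : ℝ → ℂ} {c : ℝ} (h1 : ExpIntegrable k₁ c)
    (h2 : ExpIntegrable k₂ c) : ExpIntegrable (kconv k₁ k₂) c := by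
  have := h2.integrable_convolution (ContinuousLinearMap.mul ℝ ℂ) (μ := volume) h1
  refine Integrable.congr this (Eventually.of_forall fun t => ?_)
  simp only
  rw [Complex.ofReal_exp, Complex.ofReal_mul, kconv_weight]
  simp only [convolution, ContinuousLinearMap.mul_apply']
  congr 1
  funext r
  push_cast
  rfl

theorem ExpIntegrable.sub {k₁ k₂ : ℝ → ℂ} {c : ℝ} (h1 : ExpIntegrable k₁ c)
    (h2 : ExpIntegrable k₂ c) : ExpIntegrable (fun t => k₁ t - k₂ t) c := by
  refine (Integrable.sub h1 h2).congr (Eventually.of_forall fun t => ?_)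
  simp [mul_sub]

theorem expTransform_sub {k₁ k₂ : ℝ → ℂ} {β : ℂ} (h1 : ExpIntegrable k₁ β.re)
    (h2 : ExpIntegrable k₂ β.re) :
    expTransform (fun t => k₁ t - k₂ t) β = expTransform k₁ β - expTransform k₂ β := by
  rw [expTransform, expTransform, expTransform, ← integral_sub h1.cexp h2.cexp]
  congr 1
  funext t
  ring

/-! ### Inverse transform and deconvolution -/

/-- Inverse bilateral Laplace transform along the vertical line `Re β = c`. -/
noncomputable def invTransform (E : ℂ → ℂ) (c t : ℝ) : ℂ :=
  (1 / (2 * Real.pi) : ℝ) * ∫ y : ℝ, Complex.exp (-(c + y * Complex.I) * t) * E (c + y * Complex.I)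

theorem norm_cexp_vertical (c y t : ℝ) :
    ‖Complex.exp (-(c + y * Complex.I) * t)‖ = Real.exp (-c * t) := by
  rw [Complex.norm_exp]
  simp

theorem integrable_cexp_mul_vertical {E : ℂ → ℂ} {c : ℝ} (t : ℝ)
    (hE : Integrable fun y : ℝ => E (c + y * Complex.I)) :
    Integrable fun y : ℝ => Complex.exp (-(c + y * Complex.I) * t) * E (c + y * Complex.I) :=
  hE.bdd_mul (c := Real.exp (-c * t)) (Continuous.aestronglyMeasurable (by fun_prop))
    (Eventually.of_forall fun y => (norm_cexp_vertical c y t).le)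

theorem norm_invTransform_le (E : ℂ → ℂ) (c t : ℝ) :
    ‖invTransform E c t‖ ≤
      (1 / (2 * Real.pi) * ∫ y : ℝ, ‖E (c + y * Complex.I)‖) * Real.exp (-c * t) := by
  rw [invTransform, norm_mul, Complex.norm_real, Real.norm_of_nonneg (by positivity), mul_assoc]
  gcongr
  refine (norm_integral_le_integral_norm _).trans (le_of_eq ?_)
  rw [← integral_mul_const]
  congr 1
  funext y
  rw [norm_mul, norm_cexp_vertical, mul_comm]

theorem continuous_invTransform {E : ℂ → ℂ} {c : ℝ}
    (hE : Integrable fun y : ℝ => E (c + y * Complex.I)) : Continuous (invTransform E c) := by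
  have h : Continuous fun t : ℝ => Complex.exp (-(c * t)) * ∫ y : ℝ,
      Complex.exp (-(y * Complex.I) * t) * E (c + y * Complex.I) := by
    refine Continuous.mul (by fun_prop) ?_
    refine continuous_of_dominated (bound := fun y => ‖E (c + y * Complex.I)‖) ?_ ?_ hE.norm ?_
    · intro t
      exact (Continuous.aestronglyMeasurable (by fun_prop)).mul hE.1
    · intro t
      refine Eventually.of_forall fun y => ?_
      rw [norm_mul, Complex.norm_exp]
      simp
    · refine Eventually.of_forall fun y => ?_
      fun_prop
  have e : invTransform E c = fun t : ℝ => ((1 / (2 * Real.pi) : ℝ) : ℂ) *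
      (Complex.exp (-(c * t)) * ∫ y : ℝ,
      Complex.exp (-(y * Complex.I) * t) * E (c + y * Complex.I)) := by
    funext t
    rw [invTransform, ← integral_const_mul (Complex.exp (-(c * t)))]
    congr 2
    funext y
    rw [← mul_assoc, ← Complex.exp_add]
    congr 2
    ring
  rw [e]
  exact continuous_const.mul h

/-- Fubini: convolving with k multiplies each exponential e^(-βt) on the line by the transform of k
at β. -/
theorem kconv_invTransform {k : ℝ → ℂ} {E : ℂ → ℂ} {c : ℝ} (hk : ExpIntegrable k c)
    (hE : Integrable fun y : ℝ => E (c + y * Complex.I)) :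
    kconv k (invTransform E c) = invTransform (fun β => expTransform k β * E β) c := by
  funext t
  have hkre (y : ℝ) : ExpIntegrable k ((c : ℂ) + y * Complex.I).re := by simpa using hk
  have hint : Integrable (Function.uncurry fun r y : ℝ =>
      k (t - r) * (Complex.exp (-(c + y * Complex.I) * r) * E (c + y * Complex.I))) := by
    have h1 : Integrable fun r : ℝ => (Real.exp (c * (t - r)) : ℂ) * k (t - r) :=
      Integrable.comp_sub_left hk t
    have h2 := (h1.mul_prod hE).norm.const_mul (Real.exp (-c * t))
    refine h2.mono' ?_ (Eventually.of_forall ?_)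
    · have m1 : AEStronglyMeasurable (fun r : ℝ => k (t - r)) volume :=
        hk.aestronglyMeasurable.comp_measurePreserving (Measure.measurePreserving_sub_left volume t)
      exact (m1.comp_fst (ν := volume)).mul ((Continuous.aestronglyMeasurable (by fun_prop)).mul
        (hE.1.comp_snd (μ := volume)))
    · rintro ⟨r, y⟩
      change ‖k (t - r) * (Complex.exp (-(c + y * Complex.I) * r) * E (c + y * Complex.I))‖ ≤
        Real.exp (-c * t) * ‖(Real.exp (c * (t - r)) : ℂ) * k (t - r) * E (c + y * Complex.I)‖
      rw [norm_mul, norm_mul, norm_cexp_vertical, norm_mul, norm_mul, Complex.norm_real,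
        Real.norm_of_nonneg (Real.exp_pos _).le,
        show -c * r = -c * t + c * (t - r) by ring, Real.exp_add]
      apply le_of_eq
      ring
  calc kconv k (invTransform E c) t
      = (1 / (2 * Real.pi) : ℝ) * ∫ r : ℝ, ∫ y : ℝ,
        k (t - r) * (Complex.exp (-(c + y * Complex.I) * r) * E (c + y * Complex.I)) := by
        rw [kconv, ← integral_const_mul]
        congr 1
        funext r
        rw [invTransform, integral_const_mul]
        ring
    _ = (1 / (2 * Real.pi) : ℝ) * ∫ y : ℝ, ∫ r : ℝ,
        k (t - r) * (Complex.exp (-(c + y * Complex.I) * r) * E (c + y * Complex.I)) := by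
        rw [integral_integral_swap hint]
    _ = invTransform (fun β => expTransform k β * E β) c t := by
        rw [invTransform]
        congr 2
        funext y
        rw [expTransform, ← integral_sub_left_eq_self (fun r : ℝ =>
          Complex.exp ((c + y * Complex.I) * r) * k r) volume t, ← integral_mul_const,
          ← integral_const_mul]
        congr 1
        funext r
        have : Complex.exp (-(c + y * Complex.I) * r) = Complex.exp (-(c + y * Complex.I) * t) *
            Complex.exp ((c + y * Complex.I) * ((t - r : ℝ) : ℂ)) := by
          rw [← Complex.exp_add]; congr 1; push_cast; ring
        rw [this]
        ring

/-- Cauchy's theorem on rectangles; the horizontal sides at height ±T contribute O(1/(1+T²)). -/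
theorem invTransform_eq_of_strip {E : ℂ → ℂ} {a₀ a₁ C : ℝ} (h01 : a₀ ≤ a₁) (t : ℝ)
    (hd : ∀ z : ℂ, a₀ ≤ z.re → z.re ≤ a₁ → DifferentiableAt ℂ E z)
    (hb : ∀ z : ℂ, a₀ ≤ z.re → z.re ≤ a₁ → ‖E z‖ ≤ C / (1 + z.im ^ 2))
    (h0 : Integrable fun y : ℝ => E (a₀ + y * Complex.I))
    (h1 : Integrable fun y : ℝ => E (a₁ + y * Complex.I)) :
    invTransform E a₀ t = invTransform E a₁ t := by
  set F : ℂ → ℂ := fun z => Complex.exp (-z * t) * E z with hF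
  have hC : 0 ≤ C := by
    have := (norm_nonneg _).trans (hb a₀ le_rfl (by simpa using h01))
    simpa using this
  set B : ℝ := Real.exp (|t| * max |a₀| |a₁|) * C with hB
  have hB0 : 0 ≤ B := by positivity
  have hFb : ∀ z : ℂ, a₀ ≤ z.re → z.re ≤ a₁ → ‖F z‖ ≤ B / (1 + z.im ^ 2) := by
    intro z hz0 hz1
    rw [hF, hB, norm_mul, Complex.norm_exp, mul_div_assoc]
    refine mul_le_mul (Real.exp_le_exp.2 ?_) (hb z hz0 hz1) (norm_nonneg _) (Real.exp_pos _).le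
    have : |z.re| ≤ max |a₀| |a₁| := abs_le_max_abs_abs hz0 hz1
    calc (-z * t).re ≤ |(-z * t).re| := le_abs_self _
      _ = |t| * |z.re| := by simp [abs_mul, mul_comm]
      _ ≤ _ := by gcongr
  have hrect : ∀ T : ℝ, Complex.I * (∫ y : ℝ in -T..T, F (a₁ + y * Complex.I)) -
      Complex.I * (∫ y : ℝ in -T..T, F (a₀ + y * Complex.I)) =
      (∫ x : ℝ in a₀..a₁, F (x + T * Complex.I)) -
        ∫ x : ℝ in a₀..a₁, F (x + (-T : ℝ) * Complex.I) := by
    intro T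
    have := Complex.integral_boundary_rect_eq_zero_of_differentiableOn F
      (a₀ + (-T : ℝ) * Complex.I) (a₁ + T * Complex.I) ?_
    · simp only [Complex.add_re, Complex.add_im, Complex.ofReal_re, Complex.ofReal_im,
        Complex.mul_re, Complex.mul_im, Complex.I_re, Complex.I_im, mul_zero, mul_one, zero_add,
        add_zero, sub_zero, smul_eq_mul] at this
      linear_combination this
    · intro z hz
      rw [Complex.mem_reProdIm] at hz
      have hz1 := hz.1
      simp only [Complex.add_re, Complex.ofReal_re, Complex.mul_re, Complex.I_re, Complex.ofReal_im,
        Complex.I_im, mul_zero, zero_mul, sub_zero, add_zero] at hz1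
      rw [uIcc_of_le h01] at hz1
      exact ((by fun_prop : DifferentiableAt ℂ (fun z : ℂ => Complex.exp (-z * t)) z).mul
        (hd z hz1.1 hz1.2)).differentiableWithinAt
  have hhor : ∀ T : ℝ, ‖(∫ x : ℝ in a₀..a₁, F (x + T * Complex.I))‖ ≤
      B / (1 + T ^ 2) * |a₁ - a₀| := by
    intro T
    refine intervalIntegral.norm_integral_le_of_norm_le_const fun x hx => ?_
    rw [uIoc_of_le h01] at hx
    have := hFb (x + T * Complex.I) (by simpa using hx.1.le) (by simpa using hx.2)
    simpa using this
  have hlim0 : Tendsto (fun T : ℝ => B / (1 + T ^ 2) * |a₁ - a₀|) atTop (𝓝 0) := by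
    have h2 : Tendsto (fun T : ℝ => 1 + T ^ 2) atTop atTop :=
      tendsto_atTop_add_const_left _ _ (tendsto_pow_atTop two_ne_zero)
    simpa using (h2.const_div_atTop B).mul_const |a₁ - a₀|
  have hT1 : Tendsto (fun T : ℝ => ∫ x : ℝ in a₀..a₁, F (x + T * Complex.I)) atTop (𝓝 0) :=
    squeeze_zero_norm hhor hlim0
  have hT2 : Tendsto (fun T : ℝ => ∫ x : ℝ in a₀..a₁, F (x + (-T : ℝ) * Complex.I)) atTop
      (𝓝 0) := by
    refine squeeze_zero_norm (fun T => ?_) hlim0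
    have := hhor (-T)
    rwa [neg_sq] at this
  have hI (c : ℝ) (hc : Integrable fun y : ℝ => E (c + y * Complex.I)) :
      Tendsto (fun T : ℝ => ∫ y : ℝ in -T..T, F (c + y * Complex.I)) atTop
        (𝓝 (∫ y : ℝ, F (c + y * Complex.I))) :=
    intervalIntegral_tendsto_integral (integrable_cexp_mul_vertical t hc) tendsto_neg_atTop_atBot
      tendsto_id
  have hL := ((hI a₁ h1).const_mul Complex.I).sub ((hI a₀ h0).const_mul Complex.I)
  have hR := hT1.sub hT2
  simp only [hrect] at hL
  have := tendsto_nhds_unique hL hR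
  rw [sub_zero, ← mul_sub] at this
  have h3 := (mul_eq_zero.1 this).resolve_left Complex.I_ne_zero
  rw [invTransform, invTransform]
  congr 1
  exact (sub_eq_zero.1 h3).symm

open scoped FourierTransform in
-- Fourier inversion for the Schwartz function e^(ct) g(t), with frequency ξ = -y/(2π).
theorem expTransform_bump {g : ℝ → ℝ} (hg : ContDiff ℝ ∞ g) (hc : HasCompactSupport g) (c : ℝ) :
    (Integrable fun y : ℝ => expTransform (fun t => (g t : ℂ)) (c + y * Complex.I)) ∧
      invTransform (expTransform fun t => (g t : ℂ)) c = fun t => (g t : ℂ) := by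
  set f : ℝ → ℂ := fun t => Complex.exp (c * t) * g t with hf
  have hfs : ContDiff ℝ ∞ f := by
    have h1 : ContDiff ℝ ∞ fun t : ℝ => Complex.exp (c * t) :=
      (contDiff_const.mul Complex.ofRealCLM.contDiff).cexp
    exact h1.mul (Complex.ofRealCLM.contDiff.comp hg)
  have hfc : HasCompactSupport f := by
    have : HasCompactSupport fun t => (g t : ℂ) := hc.comp_left (g := Complex.ofReal) (by simp)
    exact this.mul_left
  set S := hfc.toSchwartzMap hfs with hS
  have hSf : (S : ℝ → ℂ) = f := rfl
  have hfi : Integrable f := by rw [← hSf]; exact S.integrable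
  have hFi : Integrable (𝓕 f) := by
    rw [← hSf, ← SchwartzMap.fourier_coe]
    exact (𝓕 S).integrable
  have hinv := hfs.continuous.fourierInv_fourier_eq hfi hFi
  have key : ∀ y : ℝ, expTransform (fun t => (g t : ℂ)) (c + y * Complex.I) =
      𝓕 f (-(1 / (2 * Real.pi)) * y) := by
    intro y
    rw [Real.fourier_real_eq_integral_exp_smul, expTransform]
    congr 1
    funext t
    rw [hf, smul_eq_mul, ← mul_assoc, ← Complex.exp_add]
    congr 2
    have : (Real.pi : ℂ) ≠ 0 := by exact_mod_cast Real.pi_ne_zero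
    push_cast
    field_simp
    ring
  have hpi : -(1 / (2 * Real.pi)) ≠ 0 := by
    have := Real.pi_pos
    rw [neg_ne_zero]
    positivity
  constructor
  · simp only [key]
    exact hFi.comp_mul_left' hpi
  · funext t
    have h1 : ∫ y : ℝ, Complex.exp (-(c + y * Complex.I) * t) *
        expTransform (fun t => (g t : ℂ)) (c + y * Complex.I) =
        ∫ y : ℝ, (fun ξ : ℝ => Complex.exp (-(c * t)) * (Complex.exp (2 * Real.pi * ξ * t * Complex.I) *
          𝓕 f ξ)) (-(1 / (2 * Real.pi)) * y) := by
      congr 1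
      funext y
      beta_reduce
      rw [key, ← mul_assoc, ← Complex.exp_add]
      congr 2
      have : (Real.pi : ℂ) ≠ 0 := by exact_mod_cast Real.pi_ne_zero
      push_cast
      field_simp
      ring
    have h2 : ∫ ξ : ℝ, Complex.exp (2 * Real.pi * ξ * t * Complex.I) * 𝓕 f ξ = f t := by
      rw [← congrFun hinv t, Real.fourierInv_eq']
      congr 1
      funext ξ
      simp only [smul_eq_mul, RCLike.inner_apply, conj_trivial]
      congr 2
      push_cast
      ring
    rw [invTransform, h1, Measure.integral_comp_mul_left (fun ξ : ℝ => Complex.exp (-(c * t)) *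
      (Complex.exp (2 * Real.pi * ξ * t * Complex.I) * 𝓕 f ξ)), integral_const_mul, h2, hf,
      inv_neg, abs_neg, abs_of_pos (by have := Real.pi_pos; positivity), Complex.real_smul]
    have hpi' : (Real.pi : ℂ) ≠ 0 := by exact_mod_cast Real.pi_ne_zero
    have h3 : Complex.exp (-(c * t)) * Complex.exp (c * t) = 1 := by
      rw [← Complex.exp_add]; simp
    push_cast
    field_simp
    linear_combination (g t : ℂ) * h3

/-- The fundamental lemma of the calculus of variations, used twice: first with g₁ against the
continuous correlation of v with g₂, then with g₂ against v. -/
theorem eq_zero_of_corr_kconv_bump {v : ℝ → ℂ} (hv : Continuous v)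
    (h : ∀ g₁ g₂ : ℝ → ℝ, ContDiff ℝ ∞ g₁ → HasCompactSupport g₁ → ContDiff ℝ ∞ g₂ →
      HasCompactSupport g₂ →
      corr v (kconv (fun t => (g₂ t : ℂ)) fun t => (g₁ t : ℂ)) 0 = 0) : v = 0 := by
  have hcont : ∀ g₂ : ℝ → ℝ, ContDiff ℝ ∞ g₂ → HasCompactSupport g₂ →
      Continuous (corr v fun t => (g₂ t : ℂ)) := by
    intro g hg hgc
    have hgc' : HasCompactSupport fun t => (g (-t) : ℂ) := by
      have h1 : HasCompactSupport fun t => g (-t) :=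
        hgc.comp_homeomorph (Homeomorph.neg ℝ)
      exact h1.comp_left (g := Complex.ofReal) (by simp)
    have hgcont : Continuous fun t => (g (-t) : ℂ) :=
      Complex.continuous_ofReal.comp (hg.continuous.comp continuous_neg)
    have := hgc'.continuous_convolution_right (ContinuousLinearMap.mul ℝ ℂ) (μ := volume)
      hv.locallyIntegrable hgcont
    refine this.congr fun σ => ?_
    simp [convolution, corr]
  have h1 : ∀ g₂ : ℝ → ℝ, ContDiff ℝ ∞ g₂ → HasCompactSupport g₂ →
      ∫ τ, g₂ τ • v τ = 0 := by
    intro g₂ hg₂ hc₂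
    have hae : ∀ᵐ σ, corr v (fun t => (g₂ t : ℂ)) σ = 0 := by
      refine ae_eq_zero_of_integral_contDiff_smul_eq_zero
        (hcont g₂ hg₂ hc₂).locallyIntegrable fun g₁ hg₁ hc₁ => ?_
      rw [← h g₁ g₂ hg₁ hc₁ hg₂ hc₂, ← corr_kconv_of_integrable]
      · congr 1
        funext σ
        rw [sub_zero, Complex.real_smul, mul_comm]
      · obtain ⟨R₁, hR₁⟩ := hc₁.isCompact.isBounded.subset_closedBall 0
        obtain ⟨R₂, hR₂⟩ := hc₂.isCompact.isBounded.subset_closedBall 0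
        refine Continuous.integrable_of_hasCompactSupport ?_ ?_
        · have c1 := hg₁.continuous
          have c2 := hg₂.continuous
          simp only [Function.uncurry_def]
          fun_prop
        · refine HasCompactSupport.intro (K := Metric.closedBall 0 R₁ ×ˢ
            Metric.closedBall 0 (R₁ + R₂)) ((isCompact_closedBall _ _).prod
            (isCompact_closedBall _ _)) ?_
          rintro ⟨σ, τ⟩ hστ
          simp only [Function.uncurry_apply_pair, sub_zero]
          by_contra hne
          have n1 : g₁ σ ≠ 0 := fun h0 => hne (by rw [h0]; simp)
          have n2 : g₂ (τ - σ) ≠ 0 := fun h0 => hne (by rw [h0]; simp)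
          have m1 := hR₁ (subset_tsupport _ n1)
          have m2 := hR₂ (subset_tsupport _ n2)
          rw [mem_closedBall_zero_iff] at m1 m2
          apply hστ
          refine ⟨by simpa using m1, ?_⟩
          rw [mem_closedBall_zero_iff]
          calc ‖τ‖ = ‖σ + (τ - σ)‖ := by congr 1; ring
            _ ≤ ‖σ‖ + ‖τ - σ‖ := norm_add_le _ _
            _ ≤ _ := add_le_add m1 m2
    have h2 : corr v (fun t => (g₂ t : ℂ)) = fun _ => 0 :=
      (hcont g₂ hg₂ hc₂).ae_eq_iff_eq volume continuous_const |>.1 hae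
    have h3 := congrFun h2 0
    rw [corr] at h3
    rw [← h3]
    congr 1
    funext τ
    rw [sub_zero, Complex.real_smul, mul_comm]
  have hae := ae_eq_zero_of_integral_contDiff_smul_eq_zero hv.locallyIntegrable h1
  exact (hv.ae_eq_iff_eq volume continuous_const).1 hae

/-- Deconvolution: with θ the inverse transform of 1/H, the kernel k * θ has transform ĝ₁ĝ₂ on the
line Re z = a₀, so it equals g₂ * g₁. Since v annihilates k, it annihilates g₂ * g₁. -/
theorem eq_zero_of_corr_eq_zero {v : ℝ → ℂ} (hv : Continuous v) {a₀ a₁ C : ℝ} (h01 : a₀ ≤ a₁)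
    (hint : Integrable fun τ => v τ * (minWeight a₀ a₁ τ : ℂ)) {H : ℂ → ℂ}
    (hd : ∀ z : ℂ, a₀ ≤ z.re → z.re ≤ a₁ → DifferentiableAt ℂ H z)
    (h0 : ∀ z : ℂ, a₀ ≤ z.re → z.re ≤ a₁ → H z ≠ 0)
    (hb : ∀ z : ℂ, a₀ ≤ z.re → z.re ≤ a₁ → ‖(H z)⁻¹‖ ≤ C / (1 + z.im ^ 2))
    (hk : ∀ g₁ g₂ : ℝ → ℝ, ContDiff ℝ ∞ g₁ → HasCompactSupport g₁ → ContDiff ℝ ∞ g₂ →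
      HasCompactSupport g₂ → ∃ k : ℝ → ℂ, ExpIntegrable k a₀ ∧ ExpIntegrable k a₁ ∧
        (∀ σ, corr v k σ = 0) ∧ ∀ z : ℂ, z.re = a₀ → expTransform k z =
          expTransform (fun t => (g₁ t : ℂ)) z * expTransform (fun t => (g₂ t : ℂ)) z * H z) :
    v = 0 := by
  refine eq_zero_of_corr_kconv_bump hv fun g₁ g₂ hg₁ hc₁ hg₂ hc₂ => ?_
  obtain ⟨k, hk0, hk1, hcorr, htr⟩ := hk g₁ g₂ hg₁ hc₁ hg₂ hc₂
  set E : ℂ → ℂ := fun z => (H z)⁻¹ with hE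
  have hEint : ∀ c : ℝ, a₀ ≤ c → c ≤ a₁ → Integrable fun y : ℝ => E (c + y * Complex.I) := by
    intro c hc0 hc1
    have hbd : Integrable fun y : ℝ => C * (1 + y ^ 2)⁻¹ := integrable_inv_one_add_sq.const_mul C
    refine hbd.mono' ?_ (Eventually.of_forall fun y => ?_)
    · refine Continuous.aestronglyMeasurable (continuous_iff_continuousAt.2 fun y => ?_)
      have h1 : a₀ ≤ ((c : ℂ) + y * Complex.I).re := by simpa using hc0
      have h2 : ((c : ℂ) + y * Complex.I).re ≤ a₁ := by simpa using hc1
      exact ((hd _ h1 h2).continuousAt.inv₀ (h0 _ h1 h2)).comp (f := fun y : ℝ => (c : ℂ) + y * Complex.I)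
        (by fun_prop)
    · have := hb (c + y * Complex.I) (by simpa using hc0) (by simpa using hc1)
      simpa [hE, div_eq_mul_inv] using this
  have hE0 := hEint a₀ le_rfl h01
  have hE1 := hEint a₁ h01 le_rfl
  set θ := invTransform E a₀ with hθ
  have hθ1 : ∀ t, θ t = invTransform E a₁ t := fun t =>
    invTransform_eq_of_strip h01 t (fun z h1 h2 => (hd z h1 h2).inv (h0 z h1 h2)) hb hE0 hE1
  set C0 : ℝ := 1 / (2 * Real.pi) * ∫ y : ℝ, ‖E (a₀ + y * Complex.I)‖ with hC0
  set C1 : ℝ := 1 / (2 * Real.pi) * ∫ y : ℝ, ‖E (a₁ + y * Complex.I)‖ with hC1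
  -- The representation of θ on each edge of the strip yields one of the two exponentials.
  have hθb : ∀ t, ‖θ t‖ ≤ max C0 C1 * minWeight a₀ a₁ t := by
    intro t
    rcases min_choice (Real.exp (-a₀ * t)) (Real.exp (-a₁ * t)) with h | h
    · rw [minWeight, h]
      refine (norm_invTransform_le E a₀ t).trans ?_
      gcongr
      exact le_max_left _ _
    · rw [minWeight, h, hθ1]
      refine (norm_invTransform_le E a₁ t).trans ?_
      gcongr
      exact le_max_right _ _
  have e1 := corr_kconv_of_integrable (integrable_corr_of_minWeight 0 hint hv.aestronglyMeasurable
    hk0 hk1 (continuous_invTransform hE0).aestronglyMeasurable hθb)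
  simp only [hcorr, zero_mul, integral_zero] at e1
  rw [e1]
  congr 1
  have i1 := expTransform_bump hg₁ hc₁ a₀
  have hg2 : ExpIntegrable (fun t => (g₂ t : ℂ)) a₀ := by
    refine Continuous.integrable_of_hasCompactSupport ?_ ?_
    · have := hg₂.continuous
      fun_prop
    · exact (hc₂.comp_left (g := Complex.ofReal) (by simp)).mul_left
  have L : kconv k θ = _ := kconv_invTransform hk0 hE0
  have R := kconv_invTransform hg2 i1.1
  rw [i1.2] at R
  rw [L, R]
  -- Both kernels are now inverse transforms along Re β = a₀, and the integrands agree because H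
  -- cancels its inverse.
  funext t
  rw [invTransform, invTransform]
  congr 2
  funext y
  have hre : ((a₀ : ℂ) + y * Complex.I).re = a₀ := by simp
  have hH := h0 (a₀ + y * Complex.I) (by rw [hre]) (by rw [hre]; exact h01)
  rw [htr _ hre, hE]
  field_simp

/-! ### Bounds for sine, Beta and Gamma on vertical strips -/

theorem Complex.norm_sin_le (z : ℂ) : ‖Complex.sin z‖ ≤ Real.exp |z.im| := by
  rw [Complex.sin, norm_div, norm_mul, Complex.norm_I, mul_one]
  have h1 : ‖Complex.exp (-z * Complex.I)‖ ≤ Real.exp |z.im| := by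
    rw [Complex.norm_exp]
    simpa using le_abs_self z.im
  have h2 : ‖Complex.exp (z * Complex.I)‖ ≤ Real.exp |z.im| := by
    rw [Complex.norm_exp]
    simpa using neg_le_abs z.im
  have := (norm_sub_le (Complex.exp (-z * Complex.I)) (Complex.exp (z * Complex.I)))
  rw [Complex.norm_ofNat, div_le_iff₀ (by norm_num)]
  linarith

theorem Complex.le_norm_sin {z : ℂ} (hz : 1 ≤ |z.im|) :
    Real.exp |z.im| / 4 ≤ ‖Complex.sin z‖ := by
  have key : Real.exp |z.im| - Real.exp (-|z.im|) ≤
      ‖Complex.exp (-z * Complex.I) - Complex.exp (z * Complex.I)‖ := by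
    rcases abs_cases z.im with ⟨h, _⟩ | ⟨h, _⟩
    · have := norm_sub_norm_le (Complex.exp (-z * Complex.I)) (Complex.exp (z * Complex.I))
      rw [Complex.norm_exp, Complex.norm_exp] at this
      rw [h]
      simpa using this
    · have := norm_sub_norm_le (Complex.exp (z * Complex.I)) (Complex.exp (-z * Complex.I))
      rw [Complex.norm_exp, Complex.norm_exp, norm_sub_rev] at this
      rw [h]
      simpa using this
  rw [Complex.sin, norm_div, norm_mul, Complex.norm_I, mul_one, Complex.norm_ofNat]
  have h1 : Real.exp (-|z.im|) ≤ 1 := Real.exp_le_one_iff.2 (by linarith)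
  have h2 : 2 ≤ Real.exp |z.im| := by linarith [Real.add_one_le_exp |z.im|]
  linarith

/-- The modulus of a complex power of a positive real depends only on the real part of the exponent,
so moving the norm inside the integral gives the real Beta integral. -/
theorem Complex.norm_betaIntegral_le (u v : ℂ) :
    ‖Complex.betaIntegral u v‖ ≤ ‖Complex.betaIntegral u.re v.re‖ := by
  have e : Complex.betaIntegral u.re v.re =
      ((∫ x in (0 : ℝ)..1, ‖(x : ℂ) ^ (u - 1) * (1 - (x : ℂ)) ^ (v - 1)‖ : ℝ) : ℂ) := by
    rw [Complex.betaIntegral, ← intervalIntegral.integral_ofReal,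
      intervalIntegral.integral_of_le zero_le_one, intervalIntegral.integral_of_le zero_le_one,
      integral_Ioc_eq_integral_Ioo, integral_Ioc_eq_integral_Ioo]
    refine setIntegral_congr_fun measurableSet_Ioo fun x hx => ?_
    have h1 : 0 < 1 - x := by linarith [hx.2]
    have e1 : (1 - (x : ℂ)) = ((1 - x : ℝ) : ℂ) := by push_cast; ring
    rw [e1, norm_mul, Complex.norm_cpow_eq_rpow_re_of_pos hx.1,
      Complex.norm_cpow_eq_rpow_re_of_pos h1, Complex.ofReal_mul, Complex.ofReal_cpow hx.1.le,
      Complex.ofReal_cpow h1.le]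
    simp
  rw [e, Complex.norm_real]
  exact (intervalIntegral.norm_integral_le_integral_norm zero_le_one).trans (le_abs_self _)

/-- This is the bound on B(z, a) = Γ(z)Γ(a)/Γ(z+a) by its value at Re z, solved for Γ(z+a). It takes
the place of Stirling's formula. -/
theorem Complex.norm_Gamma_add_ge {z : ℂ} {a : ℝ} (hz : 0 < z.re) (ha : 0 < a) :
    ‖Complex.Gamma z‖ * (Real.Gamma (z.re + a) / Real.Gamma z.re) ≤ ‖Complex.Gamma (z + a)‖ := by
  have h := Complex.norm_betaIntegral_le z a
  rw [Complex.betaIntegral_eq_Gamma_mul_div _ _ hz (by simpa using ha),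
    Complex.betaIntegral_eq_Gamma_mul_div _ _ (by simpa using hz) (by simpa using ha),
    Complex.ofReal_re, ← Complex.ofReal_add, Complex.Gamma_ofReal, Complex.Gamma_ofReal,
    Complex.Gamma_ofReal, ← Complex.ofReal_mul, ← Complex.ofReal_div, Complex.norm_real, norm_div,
    norm_mul, Complex.norm_real] at h
  have g1 := Real.Gamma_pos_of_pos hz
  have g2 := Real.Gamma_pos_of_pos ha
  have g3 := Real.Gamma_pos_of_pos (add_pos hz ha)
  have g4 : 0 < ‖Complex.Gamma (z + a)‖ :=
    norm_pos_iff.2 (Complex.Gamma_ne_zero_of_re_pos (by simp; linarith))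
  rw [Real.norm_of_nonneg g2.le, Real.norm_of_nonneg (by positivity),
    div_le_div_iff₀ g4 g3] at h
  rw [← mul_div_assoc, div_le_iff₀ g1]
  have : (‖Complex.Gamma z‖ * Real.Gamma (z.re + a)) * Real.Gamma a ≤
      (‖Complex.Gamma (z + a)‖ * Real.Gamma z.re) * Real.Gamma a := by linarith
  exact le_of_mul_le_mul_right this g2

/-- The factor equals (2s+1) B(β+1, 2s+1-β), so the bound for Beta integrals applies. -/
theorem norm_betaFactor_le {s : ℝ} (hs : 0 < s) {β : ℂ} (h1 : -1 < β.re)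
    (h2 : β.re < 2 * s + 1) : ‖betaFactor s β‖ ≤ ‖betaFactor s β.re‖ := by
  have hne : (2 * s + 1 : ℂ) ≠ 0 := by
    intro h0
    have : (2 * s + 1 : ℝ) = 0 := by exact_mod_cast h0
    linarith
  have e : ∀ z : ℂ, -1 < z.re → z.re < 2 * s + 1 → betaFactor s z =
      (2 * s + 1) * Complex.betaIntegral (z + 1) (2 * s + 1 - z) := by
    intro z hz1 hz2
    rw [Complex.betaIntegral_eq_Gamma_mul_div _ _ (by simp; linarith) (by simp; linarith),
      show z + 1 + (2 * s + 1 - z) = 2 * s + 1 + 1 by ring, Complex.Gamma_add_one _ hne, betaFactor]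
    field_simp
  rw [e β h1 h2, e β.re (by simpa using h1) (by simpa using h2), norm_mul, norm_mul]
  refine mul_le_mul_of_nonneg_left ?_ (norm_nonneg _)
  have := Complex.norm_betaIntegral_le (β + 1) (2 * s + 1 - β)
  refine this.trans (le_of_eq ?_)
  congr 2
  · simp
  · simp

/-! ### Zeros and growth of the symbol -/

/-- The symbol of the half-line Neumann problem after elimination of the exterior values. -/
noncomputable def halfLineSymbol (s : ℝ) (β : ℂ) : ℂ :=
  -(betaFactor s β * ((2 * s - β) / (2 * s) *
    (Complex.sin (Real.pi * (β - s)) / Complex.sin (Real.pi * s)) + betaFactor s β))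

theorem differentiableAt_halfLineSymbol {s : ℝ} {β : ℂ} (h1 : -1 < β.re) (h2 : β.re < 2 * s + 1) :
    DifferentiableAt ℂ (halfLineSymbol s) β := by
  have hA := differentiableAt_betaFactor h1 h2
  refine (hA.mul (DifferentiableAt.add (DifferentiableAt.mul ?_ ?_) hA)).neg
  · exact DifferentiableAt.div_const (by fun_prop) _
  · exact DifferentiableAt.div_const (by fun_prop) _

theorem betaFactor_ne_zero {s : ℝ} (hs : 0 < s) {β : ℂ} (h1 : -1 < β.re) (h2 : β.re < 2 * s + 1) :
    betaFactor s β ≠ 0 := by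
  refine div_ne_zero (mul_ne_zero ?_ ?_) ?_
  · exact Complex.Gamma_ne_zero_of_re_pos (by simp; linarith)
  · exact Complex.Gamma_ne_zero_of_re_pos (by simp; linarith)
  · exact Complex.Gamma_ne_zero_of_re_pos (by simp; linarith)

theorem Complex.abs_im_le_norm_sub {z : ℂ} (x : ℝ) : |z.im| ≤ ‖(x : ℂ) - z‖ := by
  have := Complex.abs_im_le_norm ((x : ℂ) - z)
  simpa using this

theorem Complex.norm_sub_le_add_abs_im {z : ℂ} (x : ℝ) : ‖(x : ℂ) - z‖ ≤ |x - z.re| + |z.im| := by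
  have := Complex.norm_le_abs_re_add_abs_im ((x : ℂ) - z)
  simpa using this

/-- Reflection gives |Γ(z)Γ(1-z)| ≥ π e^(-π|Im z|), and Γ(z+1) = zΓ(z) supplies the factor |Im z|.
To compare Γ(2s+1-z) with Γ(1-z), both arguments are raised by 2, so that Re(3-z) > 0 and
`Complex.norm_Gamma_add_ge` applies. -/
theorem exists_le_norm_betaFactor {s : ℝ} (hs : 0 < s) (hs1 : s < 1) {a₀ a₁ : ℝ} (h0 : 0 < a₀)
    (h01 : a₀ ≤ a₁) (h1 : a₁ < 2 * s + 1) :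
    ∃ c > 0, ∀ z : ℂ, a₀ ≤ z.re → z.re ≤ a₁ → 1 ≤ |z.im| →
      c * (|z.im| * Real.exp (-(Real.pi * |z.im|))) ≤ ‖betaFactor s z‖ := by
  have hcont : ContinuousOn (fun x : ℝ => Real.Gamma (3 - x + 2 * s) / Real.Gamma (3 - x))
      (Icc a₀ a₁) := by
    intro x hx
    refine ContinuousAt.continuousWithinAt (ContinuousAt.div ?_ ?_ ?_)
    · refine ContinuousAt.comp (g := Real.Gamma) (f := fun x => 3 - x + 2 * s)
        (Real.differentiableOn_Gamma_Ioi.differentiableAt (Ioi_mem_nhds (by linarith [hx.2]))).continuousAt (by fun_prop)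
    · refine ContinuousAt.comp (g := Real.Gamma) (f := fun x => 3 - x)
        (Real.differentiableOn_Gamma_Ioi.differentiableAt (Ioi_mem_nhds (by linarith [hx.2]))).continuousAt (by fun_prop)
    · exact (Real.Gamma_pos_of_pos (by linarith [hx.2])).ne'
  -- The ratio of Gamma values depends on Re z alone, so compactness gives a positive lower bound κ.
  obtain ⟨x₀, hx₀, hmin⟩ := isCompact_Icc.exists_isMinOn (nonempty_Icc.2 h01) hcont
  set κ := Real.Gamma (3 - x₀ + 2 * s) / Real.Gamma (3 - x₀) with hκ
  have hκ0 : 0 < κ := div_pos (Real.Gamma_pos_of_pos (by linarith [hx₀.2]))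
    (Real.Gamma_pos_of_pos (by linarith [hx₀.2]))
  have hG : 0 < Real.Gamma (2 * s + 1) := Real.Gamma_pos_of_pos (by linarith)
  -- 20 = 5 · 4 comes from `g3` and `g4`, the cost of lowering the arguments back by 2.
  refine ⟨Real.pi * κ / (20 * Real.Gamma (2 * s + 1)), by positivity, fun z hz0 hz1 hy => ?_⟩
  set y := |z.im| with hyd
  have him : z.im ≠ 0 := by
    intro h
    rw [hyd, h] at hy
    norm_num at hy
  have hne (x : ℝ) : (x : ℂ) - z ≠ 0 := fun h => him (by simpa using congrArg Complex.im h)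
  have f1 : Complex.Gamma (z + 1) = z * Complex.Gamma z :=
    Complex.Gamma_add_one _ (fun h => him (by simp [h]))
  have f2 : Complex.Gamma (3 - z) = (2 - z) * ((1 - z) * Complex.Gamma (1 - z)) := by
    rw [← Complex.Gamma_add_one (1 - z) (by simpa using hne 1), show 1 - z + 1 = 2 - z by ring,
      ← Complex.Gamma_add_one (2 - z) (by simpa using hne 2)]
    congr 1
    ring
  have f3 : Complex.Gamma (3 - z + (2 * s : ℝ)) =
      (2 * s + 2 - z) * ((2 * s + 1 - z) * Complex.Gamma (2 * s + 1 - z)) := by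
    rw [← Complex.Gamma_add_one (2 * s + 1 - z) (by simpa using hne (2 * s + 1)),
      show 2 * s + 1 - z + 1 = 2 * s + 2 - z by ring,
      ← Complex.Gamma_add_one (2 * s + 2 - z) (by simpa using hne (2 * s + 2))]
    congr 1
    push_cast
    ring
  have f4 := Complex.norm_Gamma_add_ge (z := 3 - z) (a := 2 * s) (by simp; linarith) (by linarith)
  have f5 : κ ≤ Real.Gamma ((3 - z).re + 2 * s) / Real.Gamma (3 - z).re := by
    simpa using hmin ⟨hz0, hz1⟩
  have f6 : ‖Complex.Gamma (3 - z)‖ * κ ≤ ‖Complex.Gamma (3 - z + (2 * s : ℝ))‖ :=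
    (mul_le_mul_of_nonneg_left f5 (norm_nonneg _)).trans f4
  rw [f2, f3] at f6
  simp only [norm_mul] at f6
  have g1 : y ≤ ‖2 - z‖ := by simpa using Complex.abs_im_le_norm_sub (z := z) 2
  have g2 : y ≤ ‖1 - z‖ := by simpa using Complex.abs_im_le_norm_sub (z := z) 1
  have g3 : ‖2 * s + 2 - z‖ ≤ 5 * y := by
    have := Complex.norm_sub_le_add_abs_im (z := z) (2 * s + 2)
    rw [abs_of_pos (by linarith)] at this
    push_cast at this
    linarith
  have g4 : ‖2 * s + 1 - z‖ ≤ 4 * y := by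
    have := Complex.norm_sub_le_add_abs_im (z := z) (2 * s + 1)
    rw [abs_of_pos (by linarith)] at this
    push_cast at this
    linarith
  have g5 : y ≤ ‖z‖ := Complex.abs_im_le_norm z
  have hπ := Real.pi_pos
  have g6 : Real.pi * Real.exp (-(Real.pi * y)) ≤ ‖Complex.Gamma z‖ * ‖Complex.Gamma (1 - z)‖ := by
    rw [← norm_mul, Complex.Gamma_mul_Gamma_one_sub, norm_div, Complex.norm_real,
      Real.norm_of_nonneg hπ.le, Real.exp_neg, ← div_eq_mul_inv]
    have hsin := Complex.norm_sin_le (Real.pi * z)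
    have hpos := Complex.le_norm_sin (z := Real.pi * z) (by
      simp only [Complex.mul_im, Complex.ofReal_re, Complex.ofReal_im, zero_mul, add_zero, abs_mul,
        abs_of_pos hπ]
      nlinarith [Real.pi_gt_three])
    simp only [Complex.mul_im, Complex.ofReal_re, Complex.ofReal_im, zero_mul, add_zero, abs_mul,
        abs_of_pos hπ] at hsin hpos
    have : 0 < Real.exp (Real.pi * |z.im|) := Real.exp_pos _
    gcongr
    linarith
  have hy0 : 0 < y := by linarith
  rw [betaFactor, f1, norm_div, norm_mul, norm_mul, show (2 * s + 1 : ℂ) = ((2 * s + 1 : ℝ) : ℂ) by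
    push_cast; ring, Complex.Gamma_ofReal, Complex.norm_real, Real.norm_of_nonneg hG.le,
    le_div_iff₀ hG]
  push_cast
  have k1 : κ / 20 * ‖Complex.Gamma (1 - z)‖ ≤ ‖Complex.Gamma (2 * s + 1 - z)‖ := by
    have l1 : y * (y * ‖Complex.Gamma (1 - z)‖) * κ ≤
        5 * y * (4 * y * ‖Complex.Gamma (2 * s + 1 - z)‖) := by
      refine le_trans ?_ (f6.trans ?_) <;> gcongr
    have hyy : 0 < y * y := by positivity
    refine le_of_mul_le_mul_left ?_ hyy
    linarith
  calc Real.pi * κ / (20 * Real.Gamma (2 * s + 1)) * (y * Real.exp (-(Real.pi * y))) *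
        Real.Gamma (2 * s + 1)
      = y * (κ / 20 * (Real.pi * Real.exp (-(Real.pi * y)))) := by field_simp
    _ ≤ ‖z‖ * (κ / 20 * (‖Complex.Gamma z‖ * ‖Complex.Gamma (1 - z)‖)) := by gcongr
    _ = ‖z‖ * ‖Complex.Gamma z‖ * (κ / 20 * ‖Complex.Gamma (1 - z)‖) := by ring
    _ ≤ _ := by gcongr

theorem exists_norm_betaFactor_le {s : ℝ} (hs : 0 < s) {a₀ a₁ : ℝ} (h0 : -1 < a₀)
    (h1 : a₁ < 2 * s + 1) :
    ∃ c ≥ 0, ∀ z : ℂ, a₀ ≤ z.re → z.re ≤ a₁ → ‖betaFactor s z‖ ≤ c := by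
  have hcont : ContinuousOn (fun x : ℝ => betaFactor s x) (Icc a₀ a₁) := by
    intro x hx
    refine ContinuousAt.continuousWithinAt ?_
    exact (differentiableAt_betaFactor (by simp; linarith [hx.1])
      (by simp; linarith [hx.2])).continuousAt.comp Complex.continuous_ofReal.continuousAt
  obtain ⟨c, hc⟩ := isCompact_Icc.exists_bound_of_continuousOn hcont
  exact ⟨|c|, abs_nonneg c, fun z h0 h1 => (norm_betaFactor_le hs (by linarith) (by linarith)).trans
    ((hc _ ⟨h0, h1⟩).trans (le_abs_self c))⟩

/-- The exponential decay of A is exactly compensated by the growth of sin π(β-s). One factor |Im z|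
from A and one from 2s-β remain, giving quadratic growth. -/
theorem exists_le_norm_halfLineSymbol {s : ℝ} (hs : 0 < s) (hs1 : s < 1) {a₀ a₁ : ℝ} (h0 : 0 < a₀)
    (h01 : a₀ ≤ a₁) (h1 : a₁ < 2 * s + 1) :
    ∃ c > 0, ∃ T : ℝ, ∀ z : ℂ, a₀ ≤ z.re → z.re ≤ a₁ → T ≤ |z.im| →
      c * (1 + z.im ^ 2) ≤ ‖halfLineSymbol s z‖ := by
  obtain ⟨c₀, hc₀, hlow⟩ := exists_le_norm_betaFactor hs hs1 h0 h01 h1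
  obtain ⟨K, hK, hup⟩ := exists_norm_betaFactor_le hs (a₀ := a₀) (by linarith) h1
  -- The main term of the bracket is at least y e^(πy)/8 with y = |Im z|; y ≥ 16K makes A at most
  -- half of that, leaving y e^(πy)/16. The last factor 2 comes from 1 + y² ≤ 2y².
  refine ⟨c₀ / 32, by positivity, max 1 (16 * K), fun z hz0 hz1 hT => ?_⟩
  have hy : 1 ≤ |z.im| := (le_max_left _ _).trans hT
  have hyK : 16 * K ≤ |z.im| := (le_max_right _ _).trans hT
  have hA := hlow z hz0 hz1 hy
  have hB := hup z hz0 hz1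
  rw [← sq_abs]
  set y := |z.im| with hyd
  have hπ := Real.pi_pos
  have e1 : y / 2 ≤ ‖(2 * s - z) / (2 * s)‖ := by
    have := Complex.abs_im_le_norm_sub (z := z) (2 * s)
    have e2 : ‖(2 * s : ℂ)‖ = 2 * s := by
      rw [show (2 * s : ℂ) = ((2 * s : ℝ) : ℂ) by push_cast; ring, Complex.norm_real,
        Real.norm_of_nonneg (by linarith)]
    rw [norm_div, e2, div_le_div_iff₀ (by norm_num) (by linarith)]
    push_cast at this
    nlinarith
  have e2 : Real.exp (Real.pi * y) / 4 ≤
      ‖Complex.sin (Real.pi * (z - s)) / Complex.sin (Real.pi * s)‖ := by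
    have him : |((Real.pi : ℂ) * (z - s)).im| = Real.pi * y := by
      simp [abs_mul, abs_of_pos hπ, hyd]
    have l := Complex.le_norm_sin (z := Real.pi * (z - s)) (by
      rw [him]; nlinarith [Real.pi_gt_three])
    have hsp : 0 < Real.sin (Real.pi * s) :=
      Real.sin_pos_of_pos_of_lt_pi (by positivity) (by nlinarith)
    rw [him] at l
    rw [norm_div, show (Real.pi * s : ℂ) = ((Real.pi * s : ℝ) : ℂ) by push_cast; ring,
      ← Complex.ofReal_sin, Complex.norm_real, Real.norm_of_nonneg hsp.le, le_div_iff₀ hsp]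
    refine le_trans ?_ l
    have := Real.sin_le_one (Real.pi * s)
    have := Real.exp_pos (Real.pi * y)
    nlinarith
  have hexp : 1 ≤ Real.exp (Real.pi * y) := Real.one_le_exp (by positivity)
  have e3 : y * Real.exp (Real.pi * y) / 16 ≤ ‖(2 * s - z) / (2 * s) *
      (Complex.sin (Real.pi * (z - s)) / Complex.sin (Real.pi * s)) + betaFactor s z‖ := by
    have l1 := norm_sub_le_norm_add ((2 * s - z) / (2 * s) *
      (Complex.sin (Real.pi * (z - s)) / Complex.sin (Real.pi * s))) (betaFactor s z)
    rw [norm_mul] at l1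
    have l2 : y / 2 * (Real.exp (Real.pi * y) / 4) ≤ ‖(2 * s - z) / (2 * s)‖ *
      ‖Complex.sin (Real.pi * (z - s)) / Complex.sin (Real.pi * s)‖ := by gcongr
    have l3 : y ≤ y * Real.exp (Real.pi * y) := by nlinarith
    linarith
  rw [halfLineSymbol, norm_neg, norm_mul]
  calc c₀ / 32 * (1 + y ^ 2) ≤ c₀ / 32 * (y ^ 2 + y ^ 2) := by
        gcongr
        nlinarith
    _ = c₀ / 16 * y ^ 2 := by ring
    _ = c₀ * (y * Real.exp (-(Real.pi * y))) * (y * Real.exp (Real.pi * y) / 16) := by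
      rw [Real.exp_neg]
      field_simp
    _ ≤ _ := by gcongr

theorem isCompact_strip (a₀ a₁ T : ℝ) :
    IsCompact {z : ℂ | a₀ ≤ z.re ∧ z.re ≤ a₁ ∧ |z.im| ≤ T} := by
  have : {z : ℂ | a₀ ≤ z.re ∧ z.re ≤ a₁ ∧ |z.im| ≤ T} = Icc a₀ a₁ ×ℂ Icc (-T) T := by
    ext z
    simp [Complex.mem_reProdIm, abs_le, and_assoc]
  rw [this]
  exact isCompact_Icc.reProdIm isCompact_Icc

/-- Large imaginary parts are covered by the quadratic lower bound, the remaining rectangle by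
compactness. -/
theorem exists_norm_inv_halfLineSymbol_le {s : ℝ} (hs : 0 < s) (hs1 : s < 1) {a₀ a₁ : ℝ}
    (h0 : 0 < a₀) (h01 : a₀ ≤ a₁) (h1 : a₁ < 2 * s + 1)
    (hne : ∀ z : ℂ, a₀ ≤ z.re → z.re ≤ a₁ → halfLineSymbol s z ≠ 0) :
    ∃ C, ∀ z : ℂ, a₀ ≤ z.re → z.re ≤ a₁ → ‖(halfLineSymbol s z)⁻¹‖ ≤ C / (1 + z.im ^ 2) := by
  obtain ⟨c, hc, T, hT⟩ := exists_le_norm_halfLineSymbol hs hs1 h0 h01 h1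
  have hcont : ContinuousOn (fun z => (halfLineSymbol s z)⁻¹ * (1 + z.im ^ 2 : ℝ))
      {z : ℂ | a₀ ≤ z.re ∧ z.re ≤ a₁ ∧ |z.im| ≤ T} := by
    rintro z ⟨hz0, hz1, -⟩
    refine ContinuousAt.continuousWithinAt (ContinuousAt.mul ?_ ?_)
    · exact (differentiableAt_halfLineSymbol (by linarith) (by linarith)).continuousAt.inv₀
        (hne z hz0 hz1)
    · exact Continuous.continuousAt (by fun_prop)
  obtain ⟨D, hD⟩ := (isCompact_strip a₀ a₁ T).exists_bound_of_continuousOn hcont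
  refine ⟨max D c⁻¹, fun z hz0 hz1 => ?_⟩
  have hpos : 0 < 1 + z.im ^ 2 := by positivity
  rw [le_div_iff₀ hpos]
  rcases le_total |z.im| T with h | h
  · have := hD z ⟨hz0, hz1, h⟩
    rw [norm_mul, Complex.norm_real, Real.norm_of_nonneg hpos.le] at this
    exact this.trans (le_max_left _ _)
  · have := hT z hz0 hz1 h
    refine le_trans ?_ (le_max_right _ _)
    rw [norm_inv, ← div_eq_inv_mul, div_le_iff₀ (norm_pos_iff.2 (hne z hz0 hz1)),
      ← div_eq_inv_mul, le_div_iff₀ hc]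
    linarith

/-- Away from β = 2s the recurrence Γ(2s+1-β) = (2s-β)Γ(2s-β) extracts (2s-β)/(2s) from A, and what
remains is the bracket of `neumannSymbol`. A zero would therefore belong to the set whose infimum is
B₀. -/
theorem halfLineSymbol_ne_zero_of_re_lt_neumannExponent {s : ℝ} (hs : 0 < s) (hs1 : s < 1) {z : ℂ}
    (h0 : max (2 * s - 1) 0 < z.re) (h1 : z.re < 2 * s + 1) (hz : z.re < neumannExponent s) :
    halfLineSymbol s z ≠ 0 := by
  intro h
  have hz0 : 0 < z.re := (le_max_right _ _).trans_lt h0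
  have hz1 : 2 * s - 1 < z.re := (le_max_left _ _).trans_lt h0
  have hA := betaFactor_ne_zero hs (β := z) (by linarith) h1
  have hs2 : (s : ℂ) ≠ 0 := by exact_mod_cast hs.ne'
  rw [halfLineSymbol, neg_eq_zero, mul_eq_zero, or_iff_right hA] at h
  -- At β = 2s, a double pole of f, the symbol is simply -A² and does not vanish.
  by_cases hzs : z = 2 * s
  · rw [hzs, sub_self, zero_div, zero_mul, zero_add, ← hzs] at h
    exact hA h
  have hsub : (2 * s - z : ℂ) ≠ 0 := fun h => hzs (sub_eq_zero.1 h).symm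
  -- A zero of the sine has z - 2s an integer, and 2s-1 < Re z < 2s+1 leaves only the excluded value
  -- 0.
  have hsin : Complex.sin (Real.pi * (z - 2 * s)) ≠ 0 := by
    intro hsin
    obtain ⟨k, hk⟩ := Complex.sin_eq_zero_iff.1 hsin
    have hπ : (Real.pi : ℂ) ≠ 0 := by exact_mod_cast Real.pi_ne_zero
    have e : z - 2 * s = k := by
      apply mul_left_cancel₀ hπ
      rw [hk, mul_comm]
    have er := congrArg Complex.re e
    simp at er
    have k1 : (-1 : ℝ) < k := by linarith
    have k2 : (k : ℝ) < 1 := by linarith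
    have k3 : (-1 : ℤ) < k := by exact_mod_cast k1
    have k4 : k < 1 := by exact_mod_cast k2
    have : k = 0 := by omega
    rw [this, Int.cast_zero, sub_eq_zero] at e
    exact hzs e
  have hbr : Complex.sin (Real.pi * (z - s)) / Complex.sin (Real.pi * s) +
      Complex.Gamma (2 * s - z) * Complex.Gamma (z + 1) / Complex.Gamma (2 * s) = 0 := by
    have e1 : betaFactor s z = (2 * s - z) / (2 * s) *
        (Complex.Gamma (2 * s - z) * Complex.Gamma (z + 1) / Complex.Gamma (2 * s)) := by
      have l1 := Complex.Gamma_add_one _ hsub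
      have l2 := Complex.Gamma_add_one (2 * s : ℂ) (by simpa using hs2)
      have l3 : Complex.Gamma (2 * s : ℂ) ≠ 0 :=
        Complex.Gamma_ne_zero_of_re_pos (by simpa using hs)
      rw [betaFactor, show (2 * s + 1 - z : ℂ) = 2 * s - z + 1 by ring, l1, l2]
      field_simp
    rw [e1, ← mul_add, mul_eq_zero] at h
    exact h.resolve_left (div_ne_zero hsub (by simpa using hs2))
  refine hz.not_ge (csInf_le ⟨0, ?_⟩ ⟨z, ?_, hsin, hz0, ?_, rfl⟩)
  · rintro b ⟨β, -, -, hβ, -, rfl⟩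
    exact hβ.le
  · rw [neumannSymbol, hbr, mul_zero]
  · intro h
    rw [h] at hz1
    simp at hz1

/-- If every line in between met a zero, there would be infinitely many zeros, all with bounded
imaginary part. They would accumulate, the symbol would vanish identically, and this contradicts its
quadratic lower bound. -/
theorem exists_halfLineSymbol_ne_zero {s : ℝ} (hs : 0 < s) (hs1 : s < 1) {l r : ℝ} (h0 : 0 < l)
    (hlr : l < r) (h1 : r < 2 * s + 1) :
    ∃ c ∈ Ioo l r, ∀ z : ℂ, z.re = c → halfLineSymbol s z ≠ 0 := by
  obtain ⟨c, hc, T, hT⟩ := exists_le_norm_halfLineSymbol hs hs1 h0 hlr.le h1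
  by_contra! hcon
  choose! ζ hζ using hcon
  set U : Set ℂ := {z | -1 < z.re} ∩ {z | z.re < 2 * s + 1} with hU
  have hUo : IsOpen U := (isOpen_lt continuous_const Complex.continuous_re).inter
    (isOpen_lt Complex.continuous_re continuous_const)
  have hUc : Convex ℝ U := (convex_halfSpace_re_gt _).inter (convex_halfSpace_re_lt _)
  have han : AnalyticOnNhd ℂ (halfLineSymbol s) U := DifferentiableOn.analyticOnNhd
    (fun z hz => (differentiableAt_halfLineSymbol hz.1 hz.2).differentiableWithinAt) hUo
  have hinf : (ζ '' Ioo l r).Infinite := by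
    refine (Ioo_infinite hlr).image fun x hx y hy hxy => ?_
    rw [← (hζ x hx).1, ← (hζ y hy).1, hxy]
  have hsub : ζ '' Ioo l r ⊆ {z : ℂ | l ≤ z.re ∧ z.re ≤ r ∧ |z.im| ≤ T} := by
    rintro _ ⟨x, hx, rfl⟩
    have e := (hζ x hx).1
    refine ⟨by rw [e]; exact hx.1.le, by rw [e]; exact hx.2.le, ?_⟩
    by_contra! hlt
    have := hT _ (by rw [e]; exact hx.1.le) (by rw [e]; exact hx.2.le) hlt.le
    rw [(hζ x hx).2, norm_zero] at this
    nlinarith [sq_nonneg (ζ x).im]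
  obtain ⟨z₀, hz₀, hacc⟩ := hinf.exists_accPt_of_subset_isCompact (isCompact_strip l r T) hsub
  have hz₀U : z₀ ∈ U := ⟨by have := hz₀.1; simp; linarith, by have := hz₀.2.1; simp; linarith⟩
  have hfreq : ∃ᶠ z in 𝓝[≠] z₀, halfLineSymbol s z = 0 := by
    refine (accPt_iff_frequently_nhdsNE.1 hacc).mono ?_
    rintro _ ⟨x, hx, rfl⟩
    exact (hζ x hx).2
  have hzero := han.eqOn_zero_of_preconnected_of_frequently_eq_zero hUc.isPreconnected hz₀U hfreq
  have hw := hT (l + max T 0 * Complex.I) (by simp) (by simp [hlr.le])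
    (by simpa using (le_max_left T 0).trans (le_abs_self _))
  rw [hzero (show (l + max T 0 * Complex.I : ℂ) ∈ U from ⟨by simp; linarith, by simp; linarith⟩)] at hw
  simp at hw
  nlinarith [sq_nonneg (max T 0)]

/-! ### The two equations on the half-lines and their logarithmic form -/

section

variable {s m M : ℝ} {φ ψ u : ℝ → ℝ}

theorem fracLapConst_pos (hs : 0 < s) (hs1 : s < 1) : 0 < fracLapConst s := by
  have h1 := Real.Gamma_pos_of_pos (show 0 < s + 1 / 2 by linarith)
  have h2 := Real.Gamma_pos_of_pos (show 0 < 1 - s by linarith)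
  have h3 := Real.pi_pos
  rw [fracLapConst]
  positivity

theorem IsBump.eq_zero_of_nonpos (h : IsBump m M φ) {x : ℝ} (hx : x ≤ 0) : φ x = 0 :=
  h.zero x fun hx' => by linarith [hx'.1, h.pos]

theorem fracLaplacian_eq_halfLaplacian (ψ : ℝ → ℝ) (x : ℝ) :
    fracLaplacian s ψ x = fracLapConst s * halfLaplacian s ψ x := by
  have e : (fun t : ℝ => (2 * ψ x - ψ (x + t) - ψ (x - t)) / |t| ^ (1 + 2 * s)) =
      fun t => (fun r : ℝ => (2 * ψ x - ψ (x + r) - ψ (x - r)) / r ^ (1 + 2 * s)) |t| := by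
    funext t
    rcases abs_cases t with ⟨h, _⟩ | ⟨h, _⟩ <;> rw [h]
    simp only [sub_neg_eq_add, ← sub_eq_add_neg]
    ring
  rw [fracLaplacian, e,
    integral_comp_abs (f := fun r : ℝ => (2 * ψ x - ψ (x + r) - ψ (x - r)) / r ^ (1 + 2 * s)),
    halfLaplacian]
  have e2 : ∫ t in Ioi (0 : ℝ), (2 * ψ x - ψ (x + t) - ψ (x - t)) / t ^ (1 + 2 * s) =
      ∫ h in Ioi (0 : ℝ), (2 * ψ x - ψ (x + h) - ψ (x - h)) * h ^ (-(1 + 2 * s)) := by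
    refine setIntegral_congr_fun measurableSet_Ioi fun t ht => ?_
    rw [Real.rpow_neg (le_of_lt ht), div_eq_mul_inv]
  rw [e2]
  ring

theorem nonlocalNormalDeriv_bump (h : IsBump m M ψ) {x : ℝ} (hx : x < 0) :
    nonlocalNormalDeriv s ψ x = -(fracLapConst s * reflPotential s ψ (-x)) := by
  rw [nonlocalNormalDeriv, reflPotential, ← mul_neg, ← integral_neg]
  congr 1
  refine setIntegral_congr_fun measurableSet_Ioi fun y hy => ?_
  have hy' : 0 < y := hy
  rw [h.eq_zero_of_nonpos hx.le, abs_of_neg (by linarith), show -(x - y) = -x + y by ring,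
    Real.rpow_neg (by linarith)]
  ring

theorem nonlocalNormalDeriv_bump_neg (hs : 0 < s) (h : IsBump m M ψ) {x : ℝ} (hx : x < 0) :
    nonlocalNormalDeriv s (fun y => ψ (-y)) x =
      fracLapConst s * (ψ (-x) * (-x) ^ (-(2 * s)) / (2 * s)) := by
  rw [nonlocalNormalDeriv]
  congr 1
  have e : ∫ y in Ioi (0 : ℝ), (ψ (-x) - ψ (-y)) / |x - y| ^ (1 + 2 * s) =
      ∫ y in Ioi (0 : ℝ), ψ (-x) * (fun r : ℝ => r ^ (-(1 + 2 * s))) (y + -x) := by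
    refine setIntegral_congr_fun measurableSet_Ioi fun y hy => ?_
    have hy' : 0 < y := hy
    beta_reduce
    rw [h.eq_zero_of_nonpos (x := -y) (by linarith), abs_of_neg (by linarith),
      show -(x - y) = y + -x by ring, Real.rpow_neg (by linarith)]
    ring
  rw [e, integral_const_mul]
  have e2 := integral_Ioi_rpow_of_lt (a := -(1 + 2 * s)) (by linarith) (c := -x) (by linarith)
  have e3 := (measurePreserving_add_right volume (-x)).setIntegral_preimage_emb
    (MeasurableEquiv.addRight (-x)).measurableEmbedding (fun r : ℝ => r ^ (-(1 + 2 * s))) (Ioi (-x))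
  rw [preimage_add_const_Ioi, sub_self] at e3
  rw [e3, e2, show -(1 + 2 * s) + 1 = -(2 * s) by ring]
  field_simp

theorem halfLaplacian_bump_neg (h : IsBump m M ψ) {x : ℝ} (hx : 0 < x) :
    halfLaplacian s (fun y => ψ (-y)) x = -reflPotential s ψ x := by
  rw [halfLaplacian, reflPotential]
  have e1 : ∫ t in Ioi (0 : ℝ), (2 * ψ (-x) - ψ (-(x + t)) - ψ (-(x - t))) * t ^ (-(1 + 2 * s)) =
      -∫ t in Ioi (0 : ℝ), ψ (t - x) * t ^ (-(1 + 2 * s)) := by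
    rw [← integral_neg]
    refine setIntegral_congr_fun measurableSet_Ioi fun t ht => ?_
    have ht' : 0 < t := ht
    rw [h.eq_zero_of_nonpos (x := -x) (by linarith),
      h.eq_zero_of_nonpos (x := -(x + t)) (by linarith), neg_sub]
    ring
  rw [e1, setIntegral_eq_integral_of_forall_compl_eq_zero,
    setIntegral_eq_integral_of_forall_compl_eq_zero,
    ← integral_add_right_eq_self (fun t => ψ (t - x) * t ^ (-(1 + 2 * s))) x]
  · congr 2
    funext y
    rw [add_sub_cancel_right, add_comm]
  · intro t ht
    rw [h.eq_zero_of_nonpos (by simpa using ht), zero_mul]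
  · intro t ht
    rw [h.eq_zero_of_nonpos, zero_mul]
    have : t ≤ 0 := by simpa using ht
    linarith

theorem integral_Iio_zero (f : ℝ → ℝ) : ∫ x in Iio (0 : ℝ), f x = ∫ t in Ioi (0 : ℝ), f (-t) := by
  rw [integral_comp_neg_Ioi, neg_zero, integral_Iic_eq_integral_Iio]

/-- The weak equation tested inside the domain: the exterior values enter through the reflected
potential. -/
theorem IsFasterGrowthNeumannSolution.integral_mul_halfLaplacian (hs : 0 < s) (hs1 : s < 1)
    (hu : IsFasterGrowthNeumannSolution s u) (h : IsBump m M ψ)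
    (h0 : ∫ y in Ioi (0 : ℝ), ψ y = 0) :
    ∫ x in Ioi (0 : ℝ), u x * halfLaplacian s ψ x =
      ∫ t in Ioi (0 : ℝ), u (-t) * reflPotential s ψ t := by
  have hc := fracLapConst_pos hs hs1
  have e := hu.weak_eq ψ h.smooth h.hasCompactSupport h0 (by
    rw [setIntegral_congr_fun measurableSet_Iio
      (fun x (hx : x < 0) => h.eq_zero_of_nonpos hx.le), integral_zero])
  have e1 : ∫ x in Iio (0 : ℝ), u x * nonlocalNormalDeriv s ψ x =
      -(fracLapConst s * ∫ t in Ioi (0 : ℝ), u (-t) * reflPotential s ψ t) := by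
    rw [integral_Iio_zero, ← integral_const_mul, ← integral_neg]
    refine setIntegral_congr_fun measurableSet_Ioi fun t ht => ?_
    have ht' : 0 < t := ht
    rw [nonlocalNormalDeriv_bump h (by linarith), neg_neg]
    ring
  have e2 : ∫ x in Ioi (0 : ℝ), u x * fracLaplacian s ψ x =
      fracLapConst s * ∫ x in Ioi (0 : ℝ), u x * halfLaplacian s ψ x := by
    rw [← integral_const_mul]
    congr 1
    funext x
    rw [fracLaplacian_eq_halfLaplacian]
    ring
  rw [e1, e2] at e
  exact mul_left_cancel₀ hc.ne' (by linarith)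

/-- The weak equation tested with the reflection of ψ, carried by the exterior: the Neumann operator
is then multiplication by t^(-2s)/(2s), up to the constant `fracLapConst s`. -/
theorem IsFasterGrowthNeumannSolution.integral_mul_reflPotential (hs : 0 < s) (hs1 : s < 1)
    (hu : IsFasterGrowthNeumannSolution s u) (h : IsBump m M ψ)
    (h0 : ∫ y in Ioi (0 : ℝ), ψ y = 0) :
    ∫ t in Ioi (0 : ℝ), u (-t) * (ψ t * t ^ (-(2 * s)) / (2 * s)) =
      ∫ x in Ioi (0 : ℝ), u x * reflPotential s ψ x := by
  have hc := fracLapConst_pos hs hs1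
  have e := hu.weak_eq (fun y => ψ (-y)) (h.smooth.comp contDiff_neg)
    (h.hasCompactSupport.comp_homeomorph (Homeomorph.neg ℝ)) (by
      rw [setIntegral_congr_fun measurableSet_Ioi
        (fun x (hx : 0 < x) => h.eq_zero_of_nonpos (x := -x) (by linarith)), integral_zero])
    (by rw [integral_Iio_zero]; simpa using h0)
  have e1 : ∫ x in Iio (0 : ℝ), u x * nonlocalNormalDeriv s (fun y => ψ (-y)) x =
      fracLapConst s * ∫ t in Ioi (0 : ℝ), u (-t) * (ψ t * t ^ (-(2 * s)) / (2 * s)) := by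
    rw [integral_Iio_zero, ← integral_const_mul]
    refine setIntegral_congr_fun measurableSet_Ioi fun t ht => ?_
    have ht' : 0 < t := ht
    rw [nonlocalNormalDeriv_bump_neg hs h (by linarith), neg_neg]
    ring
  have e2 : ∫ x in Ioi (0 : ℝ), u x * fracLaplacian s (fun y => ψ (-y)) x =
      -(fracLapConst s * ∫ x in Ioi (0 : ℝ), u x * reflPotential s ψ x) := by
    rw [← integral_const_mul, ← integral_neg]
    refine setIntegral_congr_fun measurableSet_Ioi fun x hx => ?_
    rw [fracLaplacian_eq_halfLaplacian, halfLaplacian_bump_neg h hx]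
    ring
  rw [e1, e2] at e
  exact mul_left_cancel₀ hc.ne' (by linarith)

/-- The test function `y ^ (2 s) * g (log y)` on the half-line. -/
noncomputable def logBump (s : ℝ) (g : ℝ → ℝ) (y : ℝ) : ℝ :=
  if 0 < y then y ^ (2 * s) * g (Real.log y) else 0

theorem exists_isBump_logBump (s : ℝ) {g : ℝ → ℝ} (hg : ContDiff ℝ ∞ g)
    (hc : HasCompactSupport g) : ∃ m M, IsBump m M (logBump s g) := by
  obtain ⟨r, hr⟩ := hc.isCompact.isBounded.subset_ball 0
  set R := max r 1 with hR
  have hR1 : 1 ≤ R := le_max_right _ _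
  have hz : ∀ t, t ∉ Ioo (-R) R → g t = 0 := by
    intro t ht
    by_contra hne
    have h1 := hr (subset_tsupport g hne)
    rw [Metric.mem_ball, dist_zero_right, Real.norm_eq_abs] at h1
    exact ht (abs_lt.1 (h1.trans_le (le_max_left _ _)))
  have hzero : ∀ y, y ∉ Ioo (Real.exp (-R)) (Real.exp R) → logBump s g y = 0 := by
    intro y hy
    rw [logBump]
    split_ifs with h
    · rw [hz, mul_zero]
      intro hl
      exact hy ⟨(Real.lt_log_iff_exp_lt h).1 hl.1, (Real.log_lt_iff_lt_exp h).1 hl.2⟩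
    · rfl
  refine ⟨Real.exp (-R), Real.exp R, Real.exp_pos _, Real.exp_lt_exp.2 (by linarith), ?_, hzero⟩
  rw [contDiff_iff_contDiffAt]
  intro y
  rcases lt_or_ge 0 y with hy | hy
  · have h1 : ContDiffAt ℝ ∞ (fun y : ℝ => y ^ (2 * s) * g (Real.log y)) y :=
      (Real.contDiffAt_rpow_const_of_ne hy.ne').mul
        (hg.contDiffAt.comp y (Real.contDiffAt_log.2 hy.ne'))
    refine h1.congr_of_eventuallyEq ?_
    filter_upwards [Ioi_mem_nhds hy] with x hx
    rw [logBump, if_pos (mem_Ioi.1 hx)]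
  · refine contDiffAt_const (c := (0 : ℝ)) |>.congr_of_eventuallyEq ?_
    filter_upwards [Iio_mem_nhds (hy.trans_lt (Real.exp_pos (-R)))] with x hx
    exact hzero x fun h => lt_asymm h.1 hx

/-- The weight y^(2s) offsets the order of the operators, which evaluate the Mellin transform at β -
2s. -/
theorem mellin_logBump (s : ℝ) (g : ℝ → ℝ) (β : ℂ) :
    mellin (fun y => ((logBump s g y : ℝ) : ℂ)) (β - 2 * s) = expTransform (fun t => (g t : ℂ)) β := by
  rw [mellin, setIntegral_Ioi_eq_integral_exp, expTransform]
  congr 1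
  funext t
  rw [logBump, if_pos (Real.exp_pos t), Real.log_exp, ← Real.exp_mul, smul_eq_mul,
    Complex.real_smul, Complex.cpow_def_of_ne_zero (by exact_mod_cast (Real.exp_pos t).ne'),
    ← Complex.ofReal_log (Real.exp_pos t).le, Real.log_exp, Complex.ofReal_mul,
    Complex.ofReal_exp, Complex.ofReal_exp, ← mul_assoc, ← mul_assoc, ← Complex.exp_add,
    ← Complex.exp_add]
  congr 2
  push_cast
  ring

theorem logBump_translate (s σ : ℝ) (g : ℝ → ℝ) (y : ℝ) :
    logBump s (fun t => g (t - σ)) y =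
      Real.exp σ ^ (2 * s) * logBump s g (y * (Real.exp σ)⁻¹) := by
  have hσ := Real.exp_pos σ
  rcases lt_or_ge 0 y with h | h
  · rw [logBump, if_pos h, logBump, if_pos (by positivity), Real.log_mul h.ne' (by positivity),
      Real.log_inv, Real.log_exp, Real.mul_rpow h.le (by positivity), Real.inv_rpow hσ.le]
    have := (Real.rpow_pos_of_pos hσ (2 * s)).ne'
    field_simp
    ring_nf
  · rw [logBump, if_neg h.not_gt, logBump, if_neg (by
      rw [not_lt]; exact mul_nonpos_of_nonpos_of_nonneg h (by positivity)), mul_zero]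

theorem deriv_logBump_translate (s σ : ℝ) (g : ℝ → ℝ) :
    deriv (logBump s fun t => g (t - σ)) = fun y =>
      Real.exp σ ^ (2 * s) * (Real.exp σ)⁻¹ * deriv (logBump s g) (y * (Real.exp σ)⁻¹) := by
  funext y
  have e : (logBump s fun t => g (t - σ)) = fun y =>
      Real.exp σ ^ (2 * s) * (fun z => logBump s g ((Real.exp σ)⁻¹ * z)) y := by
    funext z
    rw [logBump_translate, mul_comm z]
  rw [e, deriv_const_mul_field, deriv_comp_mul_left, smul_eq_mul, mul_comm y]
  ring

theorem reflPotential_scale {c l : ℝ} (hl : 0 < l) {t : ℝ} (ht : 0 < t) :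
    reflPotential s (fun y => c * ψ (y * l⁻¹)) t = c * l ^ (-(2 * s)) * reflPotential s ψ (t * l⁻¹) := by
  rw [reflPotential, reflPotential, ← integral_const_mul]
  have h := integral_comp_mul_left_Ioi
    (fun y : ℝ => c * ψ (y * l⁻¹) * (t + y) ^ (-(1 + 2 * s))) 0 hl
  rw [mul_zero, smul_eq_mul, eq_inv_mul_iff_mul_eq₀ hl.ne', ← integral_const_mul] at h
  rw [← h]
  refine setIntegral_congr_fun measurableSet_Ioi fun y hy => ?_
  have hy' : 0 < y := hy
  rw [show t + l * y = l * (t * l⁻¹ + y) by field_simp, Real.mul_rpow hl.le (by positivity),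
    show -(1 + 2 * s) = -1 + -(2 * s) by ring, Real.rpow_add hl, Real.rpow_neg_one,
    show l * y * l⁻¹ = y by field_simp]
  field_simp

theorem halfLaplacian_scale {c l : ℝ} (hl : 0 < l) (x : ℝ) :
    halfLaplacian s (fun y => c * ψ (y * l⁻¹)) x = c * l ^ (-(2 * s)) * halfLaplacian s ψ (x * l⁻¹) := by
  rw [halfLaplacian, halfLaplacian, ← integral_const_mul]
  have h := integral_comp_mul_left_Ioi (fun y : ℝ => (2 * (c * ψ (x * l⁻¹)) -
    c * ψ ((x + y) * l⁻¹) - c * ψ ((x - y) * l⁻¹)) * y ^ (-(1 + 2 * s))) 0 hl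
  rw [mul_zero, smul_eq_mul, eq_inv_mul_iff_mul_eq₀ hl.ne', ← integral_const_mul] at h
  rw [← h]
  refine setIntegral_congr_fun measurableSet_Ioi fun y hy => ?_
  have hy' : 0 < y := hy
  rw [show (x + l * y) * l⁻¹ = x * l⁻¹ + y by field_simp,
    show (x - l * y) * l⁻¹ = x * l⁻¹ - y by field_simp, Real.mul_rpow hl.le hy'.le,
    show -(1 + 2 * s) = -1 + -(2 * s) by ring, Real.rpow_add hl, Real.rpow_neg_one]
  field_simp

theorem corr_logKernel (u P : ℝ → ℝ) (σ : ℝ) :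
    corr (fun τ => (u (Real.exp τ) : ℂ)) (logKernel P) σ =
      ((∫ x in Ioi (0 : ℝ), u x * ((Real.exp σ)⁻¹ * P (x * (Real.exp σ)⁻¹)) : ℝ) : ℂ) := by
  rw [setIntegral_Ioi_eq_integral_exp, corr, ← integral_complex_ofReal]
  congr 1
  funext τ
  rw [logKernel, ← Complex.ofReal_mul, Real.exp_sub, smul_eq_mul, div_eq_mul_inv]
  congr 1
  ring

theorem IsBump.integral_deriv (h : IsBump m M φ) : ∫ y in Ioi (0 : ℝ), deriv φ y = 0 := by
  have := h.integral_deriv_smul (E := ℝ) (S := Ioi 0) measurableSet_Ioi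
    (fun y hy => h.pos.trans hy.1) (k := fun _ => 1) (k' := fun _ => 0)
    (fun y _ => hasDerivAt_const y 1) continuousOn_const
  simpa using this

/-- The value of the nonlocal normal derivative at a test function carried by the exterior. -/
noncomputable def exteriorKernel (s : ℝ) (ψ : ℝ → ℝ) (t : ℝ) : ℝ :=
  ψ t * t ^ (-(2 * s)) / (2 * s)

/-- Translating g by σ dilates the test function by e^σ, and homogeneity turns the resulting family
of weak equations into an identity between correlations at σ. -/
theorem corr_halfLaplacian_eq (hs : 0 < s) (hs1 : s < 1) (hu : IsFasterGrowthNeumannSolution s u)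
    {g : ℝ → ℝ} (hg : ContDiff ℝ ∞ g) (hc : HasCompactSupport g) (σ : ℝ) :
    corr (fun τ => (u (Real.exp τ) : ℂ)) (logKernel (halfLaplacian s (deriv (logBump s g)))) σ =
      corr (fun τ => (u (-Real.exp τ) : ℂ))
        (logKernel (reflPotential s (deriv (logBump s g)))) σ := by
  have hg' : ContDiff ℝ ∞ fun t => g (t - σ) := hg.comp (by fun_prop)
  have hc' : HasCompactSupport fun t => g (t - σ) :=
    hc.comp_homeomorph (Homeomorph.subRight σ)
  obtain ⟨m, M, h⟩ := exists_isBump_logBump s hg' hc'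
  have e := hu.integral_mul_halfLaplacian hs hs1 h.derivative h.integral_deriv
  rw [deriv_logBump_translate] at e
  have hσ := Real.exp_pos σ
  -- The weight of the test function cancels the homogeneity of order -2s, leaving only the factor
  -- e^(-σ) of a dilated density.
  have hk : Real.exp σ ^ (2 * s) * (Real.exp σ)⁻¹ * Real.exp σ ^ (-(2 * s)) = (Real.exp σ)⁻¹ := by
    rw [mul_right_comm, ← Real.rpow_add hσ, add_neg_cancel, Real.rpow_zero, one_mul]
  rw [corr_logKernel, corr_logKernel (fun x => u (-x))]
  congr 1
  have e1 : ∀ x, halfLaplacian s (fun y => Real.exp σ ^ (2 * s) * (Real.exp σ)⁻¹ *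
      deriv (logBump s g) (y * (Real.exp σ)⁻¹)) x =
      (Real.exp σ)⁻¹ * halfLaplacian s (deriv (logBump s g)) (x * (Real.exp σ)⁻¹) := fun x => by
    rw [halfLaplacian_scale hσ, hk]
  simp only [e1] at e
  rw [e]
  refine setIntegral_congr_fun measurableSet_Ioi fun t ht => ?_
  rw [reflPotential_scale hσ ht, hk]

theorem corr_exteriorKernel_eq (hs : 0 < s) (hs1 : s < 1) (hu : IsFasterGrowthNeumannSolution s u)
    {g : ℝ → ℝ} (hg : ContDiff ℝ ∞ g) (hc : HasCompactSupport g) (σ : ℝ) :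
    corr (fun τ => (u (-Real.exp τ) : ℂ)) (logKernel (exteriorKernel s (deriv (logBump s g)))) σ =
      corr (fun τ => (u (Real.exp τ) : ℂ))
        (logKernel (reflPotential s (deriv (logBump s g)))) σ := by
  have hg' : ContDiff ℝ ∞ fun t => g (t - σ) := hg.comp (by fun_prop)
  have hc' : HasCompactSupport fun t => g (t - σ) :=
    hc.comp_homeomorph (Homeomorph.subRight σ)
  obtain ⟨m, M, h⟩ := exists_isBump_logBump s hg' hc'
  have e := hu.integral_mul_reflPotential hs hs1 h.derivative h.integral_deriv
  rw [deriv_logBump_translate] at e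
  have hσ := Real.exp_pos σ
  have hk : Real.exp σ ^ (2 * s) * (Real.exp σ)⁻¹ * Real.exp σ ^ (-(2 * s)) = (Real.exp σ)⁻¹ := by
    rw [mul_right_comm, ← Real.rpow_add hσ, add_neg_cancel, Real.rpow_zero, one_mul]
  rw [corr_logKernel, corr_logKernel (fun x => u (-x))]
  congr 1
  trans ∫ t in Ioi (0 : ℝ), u (-t) * (Real.exp σ ^ (2 * s) * (Real.exp σ)⁻¹ *
      deriv (logBump s g) (t * (Real.exp σ)⁻¹) * t ^ (-(2 * s)) / (2 * s))
  · refine setIntegral_congr_fun measurableSet_Ioi fun t ht => ?_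
    have ht' : 0 < t := ht
    rw [exteriorKernel, Real.mul_rpow ht'.le (by positivity), Real.inv_rpow hσ.le,
      Real.rpow_neg hσ.le, inv_inv]
    ring
  · rw [e]
    refine setIntegral_congr_fun measurableSet_Ioi fun t ht => ?_
    rw [reflPotential_scale hσ ht, hk]

theorem expIntegrable_logKernel_iff {P : ℝ → ℝ} {c : ℝ} :
    ExpIntegrable (logKernel P) c ↔ IntegrableOn (fun x => x ^ c * P x) (Ioi 0) := by
  rw [integrableOn_Ioi_iff_integrable_exp, ExpIntegrable]
  have e : (fun t => (Real.exp (c * t) : ℂ) * logKernel P t) =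
      fun t => ((Real.exp t • (Real.exp t ^ c * P (Real.exp t)) : ℝ) : ℂ) := by
    funext t
    rw [logKernel, ← Complex.ofReal_mul, ← Real.exp_mul, smul_eq_mul, mul_comm t c]
    congr 1
    ring
  rw [e]
  exact ⟨fun h => h.re, fun h => h.ofReal⟩

/-- Boundedness at 0 gives c > -1 and decay of order 2 + 2s at infinity gives c < 2s+1, the strip on
which all the transforms are used. -/
theorem expIntegrable_logKernel_of_bound {P : ℝ → ℝ} {K c : ℝ} (hP : ContinuousOn P (Ioi 0))
    (hb : ∀ x, 0 < x → |P x| ≤ K ∧ |P x| ≤ K * x ^ (-(2 + 2 * s))) (hc : -1 < c)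
    (hc1 : c < 2 * s + 1) : ExpIntegrable (logKernel P) c := by
  rw [expIntegrable_logKernel_iff]
  have h1 := (integrableOn_ite_rpow hc (q := c - (2 + 2 * s)) (by linarith)).const_mul K
  refine Integrable.mono' h1 ?_ ?_
  · refine ContinuousOn.aestronglyMeasurable (ContinuousOn.mul (fun x hx => ?_) hP) measurableSet_Ioi
    exact (Real.continuousAt_rpow_const x c (Or.inl (ne_of_gt hx))).continuousWithinAt
  · refine (ae_restrict_iff' measurableSet_Ioi).2 (Eventually.of_forall fun x hx => ?_)
    have hx' : 0 < x := hx
    have hp : 0 < x ^ c := Real.rpow_pos_of_pos hx' c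
    rw [norm_mul, Real.norm_eq_abs (P x), Real.norm_of_nonneg hp.le]
    split_ifs with h
    · rw [mul_comm]
      exact mul_le_mul_of_nonneg_right (hb x hx').1 hp.le
    · rw [sub_eq_add_neg, Real.rpow_add hx']
      nlinarith [(hb x hx').2]

theorem expIntegrable_exteriorKernel (h : IsBump m M ψ) (c : ℝ) :
    ExpIntegrable (logKernel (exteriorKernel s ψ)) c := by
  rw [expIntegrable_logKernel_iff]
  have hk : ContinuousOn (fun x : ℝ => x ^ c * (x ^ (-(2 * s)) / (2 * s))) (Icc m M) := by
    intro x hx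
    have hx0 : x ≠ 0 := (h.pos.trans_le hx.1).ne'
    exact ((Real.continuousAt_rpow_const x c (Or.inl hx0)).mul
      ((Real.continuousAt_rpow_const x _ (Or.inl hx0)).div_const _)).continuousWithinAt
  refine (h.integrableOn_smul hk (Ioi 0)).congr_fun (fun x _ => ?_) measurableSet_Ioi
  simp only [exteriorKernel, smul_eq_mul]
  ring

theorem expTransform_exteriorKernel (h : IsBump m M φ) (β : ℂ) :
    expTransform (logKernel (exteriorKernel s (deriv φ))) β =
      (2 * s - β) / (2 * s) * mellin (fun y => ((φ y : ℝ) : ℂ)) (β - 2 * s) := by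
  have h1 := h.mellin_deriv (β - 2 * s)
  have h2 : mellin (fun x => ((exteriorKernel s (deriv φ) x : ℝ) : ℂ)) (β + 1) =
      mellin (fun y => ((deriv φ y : ℝ) : ℂ)) (β - 2 * s + 1) / (2 * s) := by
    rw [mellin, mellin, ← integral_div]
    refine setIntegral_congr_fun measurableSet_Ioi fun x hx => ?_
    have hx' : 0 < x := hx
    have hx0 : (x : ℂ) ≠ 0 := by exact_mod_cast hx'.ne'
    rw [exteriorKernel, smul_eq_mul, smul_eq_mul, add_sub_cancel_right, add_sub_cancel_right,
      sub_eq_add_neg, Complex.cpow_add _ _ hx0, Complex.ofReal_div, Complex.ofReal_mul,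
      Complex.ofReal_cpow hx'.le]
    push_cast
    ring
  rw [expTransform_logKernel, h2, h1]
  ring

theorem kconv_comm (k₁ k₂ : ℝ → ℂ) : kconv k₁ k₂ = kconv k₂ k₁ := by
  funext t
  rw [kconv, kconv, ← integral_sub_left_eq_self _ volume t]
  congr 1
  funext r
  rw [sub_sub_cancel, mul_comm]

theorem integrable_mul_kconv {v k₁ k₂ : ℝ → ℂ} {ρ : ℝ}
    (h : Integrable (Function.uncurry fun σ τ : ℝ => v τ * k₁ (τ - σ) * k₂ (σ - ρ))) :
    Integrable fun τ => v τ * kconv k₁ k₂ (τ - ρ) := by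
  refine h.integral_prod_right.congr (Eventually.of_forall fun τ => ?_)
  simp only [Function.uncurry]
  rw [kconv, ← integral_const_mul,
    ← integral_sub_right_eq_self (fun r => v τ * (k₁ (τ - ρ - r) * k₂ r)) ρ]
  congr 1
  funext σ
  rw [show τ - ρ - (σ - ρ) = τ - σ by ring]
  ring

/-- Elimination of the second function from a pair of convolution equations. -/
theorem corr_elimination {v w p q₁ q₂ r : ℝ → ℂ} {a b C : ℝ} (hv : AEStronglyMeasurable v)
    (hw : AEStronglyMeasurable w)
    (hvb : ∀ τ, ‖v τ‖ ≤ C * (Real.exp (a * τ) + Real.exp (b * τ)))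
    (hwb : ∀ τ, ‖w τ‖ ≤ C * (Real.exp (a * τ) + Real.exp (b * τ)))
    (hp : ExpIntegrable p a ∧ ExpIntegrable p b) (hq₁ : ExpIntegrable q₁ a ∧ ExpIntegrable q₁ b)
    (hq₂ : ExpIntegrable q₂ a ∧ ExpIntegrable q₂ b) (hr : ExpIntegrable r a ∧ ExpIntegrable r b)
    (h1 : ∀ σ, corr v p σ = corr w q₂ σ) (h2 : ∀ σ, corr w r σ = corr v q₁ σ) (ρ : ℝ) :
    corr v (fun t => kconv p r t - kconv q₁ q₂ t) ρ = 0 := by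
  have i1 := integrable_corr_of_expIntegrable ρ hv hvb hp.1 hp.2 hr.1 hr.2
  have i2 := integrable_corr_of_expIntegrable ρ hv hvb hq₁.1 hq₁.2 hq₂.1 hq₂.2
  have i3 := integrable_corr_of_expIntegrable ρ hw hwb hq₂.1 hq₂.2 hr.1 hr.2
  have i4 := integrable_corr_of_expIntegrable ρ hw hwb hr.1 hr.2 hq₂.1 hq₂.2
  -- The first equation convolved with r and the second with q₂ both contain the correlation of w
  -- with q₂ * r, because convolution commutes.
  have e : corr v (kconv p r) ρ = corr v (kconv q₁ q₂) ρ := by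
    rw [← corr_kconv_of_integrable i1, ← corr_kconv_of_integrable i2]
    simp only [h1, ← h2]
    rw [corr_kconv_of_integrable i3, corr_kconv_of_integrable i4, kconv_comm]
  simp only [corr, mul_sub] at e ⊢
  rw [integral_sub (integrable_mul_kconv i1) (integrable_mul_kconv i2), e, sub_self]

theorem exists_exp_bound {u : ℝ → ℝ} {C b : ℝ} (hb : 0 ≤ b)
    (hu : ∀ x, |u x| ≤ C * (1 + |x|) ^ b) :
    ∃ D, ∀ x, |u x| ≤ D * (1 + |x| ^ b) := by
  have hC : 0 ≤ C := by simpa using (abs_nonneg _).trans (hu 0)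
  refine ⟨C * 2 ^ b, fun x => (hu x).trans ?_⟩
  rw [mul_assoc]
  refine mul_le_mul_of_nonneg_left ?_ hC
  have h0 : 0 ≤ |x| ^ b := by positivity
  have h2 : 0 < (2 : ℝ) ^ b := by positivity
  rcases le_total |x| 1 with h | h
  · have : (1 + |x|) ^ b ≤ 2 ^ b := Real.rpow_le_rpow (by positivity) (by linarith) hb
    nlinarith
  · have : (1 + |x|) ^ b ≤ (2 * |x|) ^ b := Real.rpow_le_rpow (by positivity) (by linarith) hb
    rw [Real.mul_rpow (by norm_num) (abs_nonneg x)] at this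
    nlinarith

/-- The elimination is justified by the global growth bound alone; the finer behaviour at 0 and at
infinity is needed only for inverting the symbol. -/
theorem exists_annihilating_kernel (hs : 0 < s) (hs1 : s < 1)
    (hu : IsFasterGrowthNeumannSolution s u) (huc : Continuous u) {g₁ g₂ : ℝ → ℝ}
    (hg₁ : ContDiff ℝ ∞ g₁) (hc₁ : HasCompactSupport g₁) (hg₂ : ContDiff ℝ ∞ g₂)
    (hc₂ : HasCompactSupport g₂) :
    ∃ k : ℝ → ℂ, (∀ c, -1 < c → c < 2 * s + 1 → ExpIntegrable k c) ∧
      (∀ σ, corr (fun τ => (u (Real.exp τ) : ℂ)) k σ = 0) ∧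
      ∀ z : ℂ, -1 < z.re → z.re < 2 * s + 1 → expTransform k z =
        expTransform (fun t => (g₁ t : ℂ)) z * expTransform (fun t => (g₂ t : ℂ)) z *
          halfLineSymbol s z := by
  obtain ⟨m₁, M₁, b₁⟩ := exists_isBump_logBump s hg₁ hc₁
  obtain ⟨m₂, M₂, b₂⟩ := exists_isBump_logBump s hg₂ hc₂
  obtain ⟨C, ε, hε, hgr⟩ := hu.growth
  -- Nonnegative, so that |u| ≤ D(1 + |x|^b); the exponents 0 and b both lie in the strip where the
  -- kernels are integrable.
  set b : ℝ := max (2 * s + 1 - ε) 0 with hb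
  have hb0 : 0 ≤ b := le_max_right _ _
  have hb1 : b < 2 * s + 1 := max_lt (by linarith) (by linarith)
  have hC : 0 ≤ C := by simpa using (abs_nonneg _).trans (hgr 0)
  obtain ⟨D, hD⟩ := exists_exp_bound (u := u) (C := C) hb0 fun x => (hgr x).trans
    (mul_le_mul_of_nonneg_left (Real.rpow_le_rpow_of_exponent_le
      (by linarith [abs_nonneg x]) (le_max_left _ _)) hC)
  have hbound : ∀ τ x : ℝ, |x| = Real.exp τ →
      ‖(u x : ℂ)‖ ≤ D * (Real.exp (0 * τ) + Real.exp (b * τ)) := by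
    intro τ x hx
    have := hD x
    rw [hx, ← Real.exp_mul] at this
    rw [Complex.norm_real, Real.norm_eq_abs, zero_mul, Real.exp_zero, mul_comm b]
    exact this
  have hpos (τ : ℝ) : |Real.exp τ| = Real.exp τ := abs_of_pos (Real.exp_pos τ)
  obtain ⟨K₁, -, B₁⟩ := reflPotential_bound hs b₁
  obtain ⟨K₂, -, B₂⟩ := reflPotential_bound hs b₂
  obtain ⟨K₃, -, B₃⟩ := halfLaplacian_bound hs hs1 b₂
  have iq₁ (c : ℝ) (h : -1 < c) (h' : c < 2 * s + 1) :=
    expIntegrable_logKernel_of_bound (continuousOn_reflPotential hs b₁) B₁ h h'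
  have iq₂ (c : ℝ) (h : -1 < c) (h' : c < 2 * s + 1) :=
    expIntegrable_logKernel_of_bound (continuousOn_reflPotential hs b₂) B₂ h h'
  have ip (c : ℝ) (h : -1 < c) (h' : c < 2 * s + 1) := expIntegrable_logKernel_of_bound
    (b₂.derivative.continuous_halfLaplacian hs hs1).1.continuousOn B₃ h h'
  have ir (c : ℝ) := expIntegrable_exteriorKernel (s := s) b₁.derivative c
  refine ⟨fun t => kconv (logKernel (halfLaplacian s (deriv (logBump s g₂))))
      (logKernel (exteriorKernel s (deriv (logBump s g₁)))) t -
    kconv (logKernel (reflPotential s (deriv (logBump s g₁))))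
      (logKernel (reflPotential s (deriv (logBump s g₂)))) t, fun c h h' =>
    ((ip c h h').kconv (ir c)).sub ((iq₁ c h h').kconv (iq₂ c h h')), ?_, fun z h h' => ?_⟩
  · have hb2 : -1 < b := by linarith
    have h0 : (-1 : ℝ) < 0 := by norm_num
    have h0' : 0 < 2 * s + 1 := by linarith
    refine corr_elimination (w := fun τ => (u (-Real.exp τ) : ℂ)) (a := 0) (b := b)
      (C := D) ?_ ?_ (fun τ => hbound τ _ (hpos τ)) (fun τ => hbound τ _ (by rw [abs_neg, hpos]))
      ⟨ip 0 h0 h0', ip b hb2 hb1⟩ ⟨iq₁ 0 h0 h0', iq₁ b hb2 hb1⟩ ⟨iq₂ 0 h0 h0', iq₂ b hb2 hb1⟩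
      ⟨ir 0, ir b⟩ (corr_halfLaplacian_eq hs hs1 hu hg₂ hc₂) (corr_exteriorKernel_eq hs hs1 hu hg₁ hc₁)
    · exact Continuous.aestronglyMeasurable (by fun_prop)
    · exact Continuous.aestronglyMeasurable (by fun_prop)
  · rw [expTransform_sub ((ip _ h h').kconv (ir _)) ((iq₁ _ h h').kconv (iq₂ _ h h')),
      expTransform_kconv (ip _ h h') (ir _), expTransform_kconv (iq₁ _ h h') (iq₂ _ h h'),
      expTransform_exteriorKernel b₁, expTransform_logKernel, expTransform_logKernel,
      expTransform_logKernel, mellin_halfLaplacian hs hs1 b₂ h h', mellin_reflPotential hs b₁ h h',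
      mellin_reflPotential hs b₂ h h', mellin_logBump, mellin_logBump, halfLineSymbol, betaFactor]
    ring

/-! ### Vanishing on the positive half-line -/

theorem LocallyHolderOfOrder.exists_rpow_bound {b δ : ℝ} (hb1 : b < 1) (hδ : 0 < δ)
    (h : LocallyHolderOfOrder (b + δ) u) (h0 : u 0 = 0) :
    Continuous u ∧ ∃ a K : ℝ, b < a ∧ a ≤ 1 ∧ ∀ x, |x| ≤ 1 → |u x| ≤ K * |x| ^ a := by
  refine ⟨h.1.continuous, ?_⟩
  rcases le_or_gt (b + δ) 1 with hle | hgt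
  · have hn : ⌈b + δ⌉₊ - 1 = 0 := by
      have : ⌈b + δ⌉₊ ≤ 1 := Nat.ceil_le.2 (by simpa using hle)
      omega
    obtain ⟨C, hC⟩ := h.2 1 one_pos
    refine ⟨b + δ, C, by linarith, hle, fun x hx => ?_⟩
    have := hC x (abs_le.1 hx) 0 ⟨by norm_num, by norm_num⟩
    rw [hn] at this
    simpa [h0] using this
  -- For order above 1 the function is C¹, so a = 1 works, and b < 1 keeps it above b.
  · have hn : 1 ≤ ⌈b + δ⌉₊ - 1 := by
      have : 1 < ⌈b + δ⌉₊ := Nat.lt_ceil.2 (by simpa using hgt)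
      omega
    have h1 : ContDiff ℝ 1 u := h.1.of_le (by exact_mod_cast hn)
    obtain ⟨C, hC⟩ := (isCompact_Icc (a := (-1 : ℝ)) (b := 1)).exists_bound_of_continuousOn
      (h1.continuous_deriv le_rfl).continuousOn
    refine ⟨1, C, hb1, le_rfl, fun x hx => ?_⟩
    have := (convex_Icc (-1 : ℝ) 1).norm_image_sub_le_of_norm_deriv_le
      (fun x _ => h1.differentiable (by simp) x) hC (x := 0) (y := x)
      ⟨by norm_num, by norm_num⟩ (abs_le.1 hx)
    simpa [h0] using this

theorem integrable_mul_minWeight {v : ℝ → ℂ} {a γ a₀ a₁ K D : ℝ} (hv : Continuous v)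
    (h0 : ∀ τ, τ ≤ 0 → ‖v τ‖ ≤ K * Real.exp (a * τ))
    (h1 : ∀ τ, 0 ≤ τ → ‖v τ‖ ≤ D * Real.exp (γ * τ)) (ha : a₀ < a) (hγ : γ < a₁) :
    Integrable fun τ => v τ * (minWeight a₀ a₁ τ : ℂ) := by
  have hm : Continuous fun τ => v τ * (minWeight a₀ a₁ τ : ℂ) :=
    hv.mul (Complex.continuous_ofReal.comp (continuous_minWeight a₀ a₁))
  have hn : ∀ τ, ‖v τ * (minWeight a₀ a₁ τ : ℂ)‖ = ‖v τ‖ * minWeight a₀ a₁ τ := fun τ => by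
    rw [norm_mul, Complex.norm_real, Real.norm_of_nonneg (minWeight_pos _ _ _).le]
  rw [← integrableOn_univ, ← Iic_union_Ioi (a := (0 : ℝ))]
  refine IntegrableOn.union ?_ ?_
  · refine Integrable.mono' ((integrableOn_exp_mul_Iic (sub_pos.2 ha) 0).const_mul K)
      hm.aestronglyMeasurable ((ae_restrict_iff' measurableSet_Iic).2 (Eventually.of_forall
      fun τ hτ => ?_))
    rw [hn, show (a - a₀) * τ = a * τ + -a₀ * τ by ring, Real.exp_add, ← mul_assoc]
    exact mul_le_mul (h0 τ hτ) (min_le_left _ _) (minWeight_pos _ _ _).le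
      ((norm_nonneg _).trans (h0 τ hτ))
  · refine Integrable.mono' ((integrableOn_exp_mul_Ioi (sub_neg.2 hγ) 0).const_mul D)
      hm.aestronglyMeasurable ((ae_restrict_iff' measurableSet_Ioi).2 (Eventually.of_forall
      fun τ hτ => ?_))
    have hτ' : 0 ≤ τ := le_of_lt hτ
    rw [hn, show (γ - a₁) * τ = γ * τ + -a₁ * τ by ring, Real.exp_add, ← mul_assoc]
    exact mul_le_mul (h1 τ hτ') (min_le_right _ _) (minWeight_pos _ _ _).le
      ((norm_nonneg _).trans (h1 τ hτ'))

/-- A solution which is small at the origin and grows slowly vanishes on the half-line, provided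
that the symbol has no zeros in the corresponding strip. -/
theorem IsFasterGrowthNeumannSolution.eq_zero_of_pos (hs : 0 < s) (hs1 : s < 1)
    (hu : IsFasterGrowthNeumannSolution s u) (huc : Continuous u) {a γ a₀ a₁ K D : ℝ}
    (h0 : ∀ x, |x| ≤ 1 → |u x| ≤ K * |x| ^ a) (h1 : ∀ x, 1 ≤ x → |u x| ≤ D * x ^ γ)
    (ha₀ : 0 < a₀) (h01 : a₀ ≤ a₁) (ha₁ : a₁ < 2 * s + 1) (ha : a₀ < a) (hγ : γ < a₁)
    (hne : ∀ z : ℂ, a₀ ≤ z.re → z.re ≤ a₁ → halfLineSymbol s z ≠ 0) {x : ℝ} (hx : 0 < x) :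
    u x = 0 := by
  obtain ⟨C, hC⟩ := exists_norm_inv_halfLineSymbol_le hs hs1 ha₀ h01 ha₁ hne
  have hv : Continuous fun τ => (u (Real.exp τ) : ℂ) := by fun_prop
  have hint := integrable_mul_minWeight (a := a) (γ := γ) (a₀ := a₀) (a₁ := a₁) (K := K) (D := D) hv
    (fun τ hτ => by
      rw [Complex.norm_real, Real.norm_eq_abs, mul_comm a, Real.exp_mul]
      have := h0 (Real.exp τ) (by rw [abs_of_pos (Real.exp_pos τ)]; exact Real.exp_le_one_iff.2 hτ)
      rwa [abs_of_pos (Real.exp_pos τ)] at this)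
    (fun τ hτ => by
      rw [Complex.norm_real, Real.norm_eq_abs, mul_comm γ, Real.exp_mul]
      exact h1 _ (Real.one_le_exp hτ)) ha hγ
  have hz := eq_zero_of_corr_eq_zero hv h01 hint
    (fun z hz0 hz1 => differentiableAt_halfLineSymbol (s := s) (β := z) (by linarith) (by linarith))
    hne hC fun g₁ g₂ hg₁ hc₁ hg₂ hc₂ => by
      obtain ⟨k, hk, hk0, hkt⟩ := exists_annihilating_kernel hs hs1 hu huc hg₁ hc₁ hg₂ hc₂
      exact ⟨k, hk _ (by linarith) (by linarith), hk _ (by linarith) (by linarith), hk0,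
        fun z hz => hkt z (by linarith) (by linarith)⟩
  have := congrFun hz (Real.log x)
  simpa [Real.exp_log hx] using this

/-- The strip must start below the order of vanishing a, end above the growth γ, and avoid the zeros
of the symbol, which are controlled only between max(2s-1, 0) and B₀. -/
theorem exists_zero_free_strip (hs : 0 < s) (hs1 : s < 1) {a γ : ℝ} (ha : max (2 * s - 1) 0 < a)
    (ha1 : a ≤ 1) (hγ : γ < 2 * s + 1)
    (hγB : γ < neumannExponent s ∨ γ ≤ max (2 * s - 1) 0) :
    ∃ a₀ a₁, 0 < a₀ ∧ a₀ ≤ a₁ ∧ a₁ < 2 * s + 1 ∧ a₀ < a ∧ γ < a₁ ∧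
      ∀ z : ℂ, a₀ ≤ z.re → z.re ≤ a₁ → halfLineSymbol s z ≠ 0 := by
  set b := max (2 * s - 1) 0 with hb
  have hb0 : 0 ≤ b := le_max_right _ _
  rcases lt_or_ge b (min γ (neumannExponent s)) with hcase | hcase
  · obtain ⟨hbγ, hbB⟩ := lt_min_iff.1 hcase
    have hγB' : γ < neumannExponent s := hγB.resolve_right hbγ.not_ge
    -- Choosing a₀ below γ as well ensures a₀ ≤ a₁.
    obtain ⟨a₀, h1, h2⟩ := exists_between (lt_min ha hbγ)
    obtain ⟨a₁, h3, h4⟩ := exists_between (lt_min hγ hγB')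
    obtain ⟨h5, h6⟩ := lt_min_iff.1 h2
    obtain ⟨h7, h8⟩ := lt_min_iff.1 h4
    exact ⟨a₀, a₁, by linarith, by linarith, h7, h5, h3, fun z hz0 hz1 =>
      halfLineSymbol_ne_zero_of_re_lt_neumannExponent hs hs1 (by linarith) (by linarith)
        (by linarith)⟩
  -- Here γ is already below a, so a single zero-free vertical line between b and a suffices and
  -- nothing about B₀ is needed.
  · have hγb : γ ≤ b := by
      rcases hγB with h | h
      · rwa [min_eq_left h.le] at hcase
      · exact h
    obtain ⟨l, h1, h2⟩ := exists_between ha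
    obtain ⟨r, h3, h4⟩ := exists_between h2
    obtain ⟨c, hc, hne⟩ := exists_halfLineSymbol_ne_zero hs hs1 (l := l) (r := r) (by linarith) h3
      (by linarith)
    exact ⟨c, c, by linarith [hc.1], le_rfl, by linarith [hc.2], by linarith [hc.2],
      by linarith [hc.1], fun z hz0 hz1 => hne z (le_antisymm hz1 hz0)⟩

/-! ### Vanishing in the exterior -/

theorem IsBump.widen (h : IsBump m M φ) {m' M' : ℝ} (h0 : 0 < m') (hm : m' ≤ m) (hM : M ≤ M') :
    IsBump m' M' φ :=
  ⟨h0, hm.trans_lt (h.lt.trans_le hM), h.smooth, fun y hy =>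
    h.zero y fun hy' => hy ⟨hm.trans_lt hy'.1, hy'.2.trans_le hM⟩⟩

theorem IsBump.sub_const_mul (h : IsBump m M φ) (h' : IsBump m M ψ) (c : ℝ) :
    IsBump m M fun y => φ y - c * ψ y :=
  ⟨h.pos, h.lt, h.smooth.sub (contDiff_const.mul h'.smooth), fun y hy => by
    rw [h.zero y hy, h'.zero y hy, mul_zero, sub_zero]⟩

theorem exists_isBump_integral_eq_one : ∃ ρ : ℝ → ℝ, IsBump 1 3 ρ ∧ ∫ y in Ioi (0 : ℝ), ρ y = 1 := by
  let f : ContDiffBump (2 : ℝ) := ⟨1 / 2, 1, by norm_num, by norm_num⟩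
  have hz : ∀ y, y ∉ Ioo (1 : ℝ) 3 → f.normed volume y = 0 := by
    intro y hy
    by_contra hne
    have : y ∈ Function.support (f.normed volume) := hne
    rw [f.support_normed_eq, Real.ball_eq_Ioo] at this
    norm_num [f] at this
    exact hy this
  refine ⟨f.normed volume, ⟨one_pos, by norm_num, f.contDiff_normed, hz⟩, ?_⟩
  rw [setIntegral_eq_integral_of_forall_compl_eq_zero, f.integral_normed]
  exact fun y hy => hz y fun hy' => hy (one_pos.trans hy'.1)

theorem exists_isBump_of_tsupport_subset {g : ℝ → ℝ} (hg : ContDiff ℝ ∞ g)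
    (hc : HasCompactSupport g) (hsub : tsupport g ⊆ Ioi 0) : ∃ m M, IsBump m M g := by
  rcases (tsupport g).eq_empty_or_nonempty with he | hne
  · refine ⟨1, 2, one_pos, by norm_num, hg, fun y _ => ?_⟩
    rw [tsupport_eq_empty_iff.1 he, Pi.zero_apply]
  · obtain ⟨p, hp, hmin⟩ := hc.isCompact.exists_isMinOn hne continuousOn_id
    obtain ⟨q, hq, hmax⟩ := hc.isCompact.exists_isMaxOn hne continuousOn_id
    have hp0 : 0 < p := hsub hp
    have hpq : p ≤ q := hmin hq
    refine ⟨p / 2, q + 1, by linarith, by linarith, hg, fun y hy => ?_⟩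
    by_contra hy0
    have hyt := subset_tsupport g hy0
    have h1 : p ≤ y := hmin hyt
    have h2 : y ≤ q := hmax hyt
    exact hy ⟨by linarith, by linarith⟩

/-- The du Bois-Reymond lemma on the half-line. -/
theorem exists_eq_const_of_integral_bump_eq_zero {f : ℝ → ℝ} (hf : ContinuousOn f (Ioi 0))
    (h : ∀ (m M : ℝ) (ψ : ℝ → ℝ), IsBump m M ψ → ∫ y in Ioi (0 : ℝ), ψ y = 0 →
      ∫ y in Ioi (0 : ℝ), f y * ψ y = 0) : ∃ K, ∀ x, 0 < x → f x = K := by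
  obtain ⟨ρ, hρ, hρ1⟩ := exists_isBump_integral_eq_one
  have hint : ∀ {m M : ℝ} {g : ℝ → ℝ}, IsBump m M g → IntegrableOn (fun y => f y * g y) (Ioi 0) := by
    intro m M g hg
    refine (hg.integrableOn_smul (k := f) (hf.mono fun y hy => hg.pos.trans_le hy.1) (Ioi 0)).congr_fun
      (fun y _ => ?_) measurableSet_Ioi
    simp [mul_comm]
  set K := ∫ y in Ioi (0 : ℝ), f y * ρ y with hK
  refine ⟨K, ?_⟩
  have hfK : ContinuousOn (fun y => f y - K) (Ioi 0) := hf.sub continuousOn_const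
  have hae := isOpen_Ioi.ae_eq_zero_of_integral_contDiff_smul_eq_zero (f := fun y => f y - K)
    (μ := volume) (hfK.locallyIntegrableOn measurableSet_Ioi) fun g hg hc hsub => by
      obtain ⟨m, M, hb⟩ := exists_isBump_of_tsupport_subset hg hc hsub
      set I := ∫ y in Ioi (0 : ℝ), g y with hI
      have hpos : 0 < min m 1 := lt_min hb.pos one_pos
      have hb' := hb.widen hpos (min_le_left _ _) (le_max_left M 3)
      have hρ' := hρ.widen hpos (min_le_right m _) (le_max_right M 3)
      -- Subtracting I times the normalised bump ρ makes the mean vanish, on a common support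
      -- interval.
      have e := h _ _ _ (hb'.sub_const_mul hρ' I) (by
        rw [integral_sub hb.integrable.integrableOn (hρ.integrable.integrableOn.const_mul I),
          integral_const_mul, hρ1, mul_one, sub_self])
      have e1 : ∫ y in Ioi (0 : ℝ), f y * (g y - I * ρ y) =
          (∫ y in Ioi (0 : ℝ), f y * g y) - I * K := by
        rw [hK, ← integral_const_mul, ← integral_sub (hint hb) ((hint hρ).const_mul I)]
        congr 1
        funext y
        ring
      rw [e1] at e
      rw [← setIntegral_eq_integral_of_forall_compl_eq_zero (s := Ioi 0) fun y hy => by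
        rw [hb.eq_zero_of_nonpos (by simpa using hy), zero_smul]]
      have e2 : ∫ y in Ioi (0 : ℝ), g y • (f y - K) =
          (∫ y in Ioi (0 : ℝ), f y * g y) - K * I := by
        rw [hI, ← integral_const_mul,
          ← integral_sub (hint hb) (hb.integrable.integrableOn.const_mul K)]
        congr 1
        funext y
        rw [smul_eq_mul]
        ring
      rw [e2]
      linarith
  have := Measure.eqOn_open_of_ae_eq (μ := volume) (f := fun y => f y - K) (g := fun _ => 0)
    ((ae_restrict_iff' measurableSet_Ioi).2 hae) isOpen_Ioi hfK continuousOn_const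
  exact fun x hx => sub_eq_zero.1 (this hx)

/-- The factor e^(-bt) undoes the weight of the transform, leaving the positive integral of a bump.
-/
theorem exists_expTransform_ne_zero (b : ℝ) : ∃ g : ℝ → ℝ, ContDiff ℝ ∞ g ∧ HasCompactSupport g ∧
    expTransform (fun t => (g t : ℂ)) b ≠ 0 := by
  let f : ContDiffBump (0 : ℝ) := ⟨1, 2, by norm_num, by norm_num⟩
  refine ⟨fun t => Real.exp (-(b * t)) * f t, ?_, f.hasCompactSupport.mul_left, ?_⟩
  · exact ContDiff.mul (by fun_prop) f.contDiff
  · have e : (fun t : ℝ => Complex.exp (b * t) * ((Real.exp (-(b * t)) * f t : ℝ) : ℂ)) =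
        fun t => ((f t : ℝ) : ℂ) := by
      funext t
      rw [← Complex.ofReal_mul, ← Complex.ofReal_exp, ← Complex.ofReal_mul, ← mul_assoc,
        ← Real.exp_add, add_neg_cancel, Real.exp_zero, one_mul]
    rw [expTransform, e, integral_complex_ofReal]
    exact_mod_cast (f.integral_pos (μ := volume)).ne'

/-- A solution that vanishes on the half-line vanishes in the exterior. -/
theorem IsFasterGrowthNeumannSolution.eq_zero_of_neg (hs : 0 < s) (hs1 : s < 1)
    (hu : IsFasterGrowthNeumannSolution s u) (huc : Continuous u) (h0 : ∀ x, 0 < x → u x = 0)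
    {x : ℝ} (hx : x < 0) : u x = 0 := by
  obtain ⟨K, hK⟩ := exists_eq_const_of_integral_bump_eq_zero
    (f := fun t => u (-t) * t ^ (-(2 * s))) (by
      refine ContinuousOn.mul (by fun_prop) fun t ht => ?_
      exact (Real.continuousAt_rpow_const t _ (Or.inl (ne_of_gt ht))).continuousWithinAt)
    fun m M ψ hψ hψ0 => by
      have e := hu.integral_mul_reflPotential hs hs1 hψ hψ0
      have e0 : ∫ y in Ioi (0 : ℝ), u y * reflPotential s ψ y = 0 := by
        rw [setIntegral_congr_fun (g := fun _ => (0 : ℝ)) measurableSet_Ioi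
          (fun y hy => by rw [h0 y hy, zero_mul]), integral_zero]
      have e1 : ∫ t in Ioi (0 : ℝ), u (-t) * (ψ t * t ^ (-(2 * s)) / (2 * s)) =
          (2 * s)⁻¹ * ∫ t in Ioi (0 : ℝ), u (-t) * t ^ (-(2 * s)) * ψ t := by
        rw [← integral_const_mul]
        congr 1
        funext t
        ring
      rw [e0, e1, mul_eq_zero] at e
      exact e.resolve_left (by positivity)
  -- The second equation alone allows this power; it remains to exclude it with the first one.
  have huK : ∀ t, 0 < t → u (-t) = K * t ^ (2 * s) := by
    intro t ht
    rw [← hK t ht, mul_assoc, ← Real.rpow_add ht, neg_add_cancel, Real.rpow_zero, mul_one]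
  obtain ⟨g, hg, hc, hne⟩ := exists_expTransform_ne_zero (2 * s)
  obtain ⟨m, M, hb⟩ := exists_isBump_logBump s hg hc
  have e := corr_halfLaplacian_eq hs hs1 hu hg hc 0
  have e1 : corr (fun τ => (u (Real.exp τ) : ℂ))
      (logKernel (halfLaplacian s (deriv (logBump s g)))) 0 = 0 := by
    simp [corr, h0 _ (Real.exp_pos _)]
  have e2 : corr (fun τ => (u (-Real.exp τ) : ℂ))
      (logKernel (reflPotential s (deriv (logBump s g)))) 0 =
      K * expTransform (logKernel (reflPotential s (deriv (logBump s g)))) (2 * s : ℝ) := by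
    rw [corr, expTransform, ← integral_const_mul]
    congr 1
    funext τ
    rw [huK _ (Real.exp_pos τ), ← Real.exp_mul, sub_zero, mul_comm τ, ← mul_assoc]
    push_cast
    rfl
  -- Correlating the power t^(2s) with the kernel evaluates its transform at β = 2s, which is A(2s)
  -- times that of g and hence nonzero.
  rw [e1, e2, expTransform_logKernel, mellin_reflPotential hs hb (by simp; linarith) (by simp)] at e
  have hA := betaFactor_ne_zero hs (β := (2 * s : ℝ)) (by simp; linarith) (by simp)
  have hK0 : K = 0 := by
    have e3 := mellin_logBump s g (2 * s : ℝ)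
    rw [e3] at e
    by_contra hK0
    exact mul_ne_zero (by exact_mod_cast hK0) (mul_ne_zero hA hne) e.symm
  have := huK (-x) (by linarith)
  rwa [neg_neg, hK0, zero_mul] at this

/-! ### Choice of the growth exponent and conclusion -/

/-- The smaller of the two exponents lies below both B and 2s+1. Replacing it by its maximum with 0
permits 1 + x ≤ 2x for x ≥ 1 and accounts for the alternative γ ≤ 0. -/
theorem exists_rpow_growth {C ε C' ε' B : ℝ} (hs : 0 < s) (hε : 0 < ε) (hε' : 0 < ε')
    (h1 : ∀ x : ℝ, 0 ≤ x → |u x| ≤ C * (1 + x) ^ (B - ε))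
    (h2 : ∀ x : ℝ, |u x| ≤ C' * (1 + |x|) ^ (2 * s + 1 - ε')) :
    ∃ γ D : ℝ, γ < 2 * s + 1 ∧ (γ < B ∨ γ ≤ 0) ∧ ∀ x, 1 ≤ x → |u x| ≤ D * x ^ γ := by
  have key : ∀ c E : ℝ, (∀ x : ℝ, 0 ≤ x → |u x| ≤ E * (1 + x) ^ c) → ∀ x : ℝ, 1 ≤ x →
      |u x| ≤ (E * 2 ^ max c 0) * x ^ max c 0 := by
    intro c E h x hx
    have hE : 0 ≤ E := by simpa using (abs_nonneg _).trans (h 0 le_rfl)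
    rw [mul_assoc, ← Real.mul_rpow (by norm_num) (by linarith)]
    refine (h x (by linarith)).trans (mul_le_mul_of_nonneg_left ?_ hE)
    exact (Real.rpow_le_rpow_of_exponent_le (by linarith) (le_max_left c 0)).trans
      (Real.rpow_le_rpow (by linarith) (by linarith) (le_max_right _ _))
  rcases le_total (B - ε) (2 * s + 1 - ε') with h | h
  · refine ⟨max (B - ε) 0, _, max_lt (by linarith) (by linarith), ?_, key _ C h1⟩
    rcases le_total (B - ε) 0 with h' | h'
    · exact Or.inr (max_le h' le_rfl)
    · exact Or.inl (by rw [max_eq_left h']; linarith)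
  · refine ⟨max (2 * s + 1 - ε') 0, _, max_lt (by linarith) (by linarith), ?_, key _ C' ?_⟩
    · rcases le_total (2 * s + 1 - ε') 0 with h' | h'
      · exact Or.inr (max_le h' le_rfl)
      · exact Or.inl (by rw [max_eq_left h']; linarith)
    · intro x hx
      have := h2 x
      rwa [abs_of_nonneg hx] at this

end

theorem theorem5p8 (s : ℝ) (hs0 : 0 < s) (hs1 : s < 1) (u : ℝ → ℝ)
    (δ : ℝ) (hδ : 0 < δ) (hreg : LocallyHolderOfOrder (max (2 * s - 1) 0 + δ) u)
    (hsol : IsFasterGrowthNeumannSolution s u)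
    (hu0 : u 0 = 0)
    (C ε : ℝ) (hε : 0 < ε)
    (hgrowth : ∀ x : ℝ, 0 ≤ x → |u x| ≤ C * (1 + x) ^ (neumannExponent s - ε)) :
    ∀ x : ℝ, u x = 0 := by
  obtain ⟨huc, a, K, ha, ha1, hsmall⟩ := hreg.exists_rpow_bound
    (max_lt (by linarith) one_pos) hδ hu0
  obtain ⟨C', ε', hε', hgr⟩ := hsol.growth
  obtain ⟨γ, D, hγ, hγB, hlarge⟩ := exists_rpow_growth hs0 hε hε' hgrowth hgr
  obtain ⟨a₀, a₁, h0, h01, h1, ha₀, hγa, hne⟩ := exists_zero_free_strip hs0 hs1 ha ha1 hγ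
    (hγB.imp_right fun h => h.trans (le_max_right _ _))
  have hpos : ∀ x, 0 < x → u x = 0 := fun x hx =>
    hsol.eq_zero_of_pos hs0 hs1 huc hsmall hlarge h0 h01 h1 ha₀ hγa hne hx
  intro x
  rcases lt_trichotomy x 0 with hx | rfl | hx
  · exact hsol.eq_zero_of_neg hs0 hs1 huc hpos hx
  · exact hu0
  · exact hpos x hx
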